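/- **Theorem 1 (twisted sectors of a simplicial toric variety).** Let $N\cong\mathbb Z^n$ be a lattice, $N_{\mathbb R}=N\otimes_{\mathbb Z}\mathbb R$, and let $\Xi$ be a finite simplicial fan of strongly convex rational polyhedral cones in $N_{\mathbb R}$. Let $X_\Xi$ be the associated complex toric variety with its classical topology. For $\tau\in\Xi$ let $\overline{O}_\tau\subseteq X_\Xi$ be the closure of the torus orbit $O_\tau$, and call the primitive lattice vectors $v_1,\dots,v_j$ on the one-dimensional faces of $\tau$ the generators of $\tau$. Give $X_\Xi$ its standard complex orbifold structure: for $\sigma\in\Xi$ and vectors $w_1,\dots,w_n\in N$ which form a basis of $N_{\mathbb R}$ and contain the generators of $\sigma$, there is the chart $$\{z\in\mathbb C^n: z_l\neq 0 \text{ if } w_l \text{ is not a generator of } \sigma\}\longrightarrow U_\sigma\subseteq X_\Xi,\qquad \chi^m\mapsto\prod_l z_l^{\langle m,w_l\rangle},$$ with group $N/\langle w_1,\dots,w_n\rangle$, where the class of $\kappa=\sum_l c_lw_l\in N$ acts by the diagonal matrix $\mathrm{diag}(e^{2\pi i c_1},\dots,e^{2\pi i c_n})$. Let $\widetilde X_*$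 be the space of pairs $(p,(g))$ with $p\in X_\Xi$ and $(g)$ the conjugacy class of an element $g\neq1$ of the local group $G_p$; it is a complex orbifold with local charts $V^g\to V^g/C(g)$, where $V$ is an orbifold chart at $p$, $V^g$ the fixed locus and $C(g)$ the centralizer of $g$. The twisted sectors of $X_\Xi$ are the connected components of $\widetilde X_*$. The degree-shifting number of the sector containing $(p,(g))$ is $\theta_1+\dots+\theta_n$, where $e^{2\pi i\theta_1},\dots,e^{2\pi i\theta_n}$, $0\le\theta_k<1$, are the eigenvalues of $g$ on the tangent space of the chart at $p$. Say that a twisted sector is of type $\overline{O}_\tau$ if the projection $(p,(g))\mapsto p$ maps it isomorphically, as a complex analytic space, onto $\overline{O}_\tau$. Then: 1. Every twisted sector is of type $\overline{O}_\tau$ for some $\tau\in\Xi$ with $\tau\neq\{0\}$. 2. For every $\tau\in\Xi$ with $\tau\ne\{0\}$ there is a bijection between the set of lattice points $\kappa\in N$ of the form $\kappa=\sum_{i=1}^j a_iv_i$ with all $a_i\in(0,1)$ (such points lie in the relative interior of $\tau$) and the set of twisted sectors of type $\overline{O}_\tau$. It sends $\kappa$ to the sector which contains every point $(p,(g))$ given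 in a chart over a cone $\sigma\supseteq\tau$ with $g$ the class of $\kappa$. 3. The degree-shifting number of the sector corresponding to $\kappa=\sum_i a_iv_i$ is $\sum_i a_i$. -/

import Mathlib

open scoped TensorProduct Topology

noncomputable section

namespace ToricOrbifold

universe u v w

/-! ## Complex orbifold charts, twisted sectors, degree shifting numbers -/

/-- The data of an `n`-dimensional complex uniformising system on a space `X`: an open set
`dom ⊆ ℂⁿ`, a finite group `G` acting on it by holomorphic maps, and a continuous `G`-invariant
map `proj : dom → X`. (The values of `act g` outside `dom` are irrelevant.) -/
structure OrbifoldChart (X : Type u) [TopologicalSpace X] (n : ℕ) where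
  dom : Set (Fin n → ℂ)
  isOpen_dom : IsOpen dom
  G : Type v
  [group : Group G]
  [finite : Finite G]
  act : G → (Fin n → ℂ) → (Fin n → ℂ)
  mapsTo_act : ∀ g, Set.MapsTo (act g) dom dom
  act_one : ∀ z ∈ dom, act 1 z = z
  act_mul : ∀ g h, ∀ z ∈ dom, act (g * h) z = act g (act h z)
  differentiableOn_act : ∀ g, DifferentiableOn ℂ (act g) dom
  proj : dom → X
  continuous_proj : Continuous proj
  proj_act : ∀ (g : G) (z : dom), proj ⟨act g z, mapsTo_act g z.2⟩ = proj z

attribute [instance] OrbifoldChart.group OrbifoldChart.finite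

namespace OrbifoldChart

variable {X : Type u} [TopologicalSpace X] {n : ℕ}

/-- The isotropy group `G_x ⊆ G` of a point `x` of the chart. -/
def isotropy (c : OrbifoldChart.{u, v} X n) (x : c.dom) : Subgroup c.G where
  carrier := {g | c.act g x = x}
  one_mem' := c.act_one x x.2
  mul_mem' := by
    intro g h hg hh
    simp only [Set.mem_ofPred_eq] at hg hh ⊢
    rw [c.act_mul g h x x.2, hh, hg]
  inv_mem' := by
    intro g hg
    simp only [Set.mem_ofPred_eq] at hg ⊢
    have h := c.act_mul g⁻¹ g x x.2
    rw [inv_mul_cancel, c.act_one x x.2, hg] at h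
    exact h.symm

/-- The fixed-point set `V^g` of a group element in the chart. -/
def fixedLocus (c : OrbifoldChart.{u, v} X n) (g : c.G) : Set (Fin n → ℂ) :=
  {z | z ∈ c.dom ∧ c.act g z = z}

/-- `(x, g)` in the chart `c` and `(y, h)` in the chart `d` are identified: there is an isomorphism
of the uniformising systems which `c` and `d` induce near the images of `x` and `y`, i.e. a
biholomorphic map `φ` from a `G_x`-invariant open neighbourhood of `x` onto an open neighbourhood
of `y`, over `X`, equivariant for a group isomorphism `iso : G_x ≃ G_y`, such that `φ x = y` and
`iso g = h`. -/
def GermRel (c d : OrbifoldChart.{u, v} X n) (x : c.dom) (g : c.G) (y : d.dom) (h : d.G) : Prop :=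
  ∃ (φ : OpenPartialHomeomorph (Fin n → ℂ) (Fin n → ℂ))
    (hs : φ.source ⊆ c.dom) (ht : φ.target ⊆ d.dom) (iso : c.isotropy x ≃* d.isotropy y),
    (x : Fin n → ℂ) ∈ φ.source ∧ φ x = y ∧
    DifferentiableOn ℂ φ φ.source ∧ DifferentiableOn ℂ φ.symm φ.target ∧
    (∀ (z : Fin n → ℂ) (hz : z ∈ φ.source),
      d.proj ⟨φ z, ht (φ.map_source hz)⟩ = c.proj ⟨z, hs hz⟩) ∧
    (∀ k : c.isotropy x, ∀ z ∈ φ.source,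
      c.act k z ∈ φ.source ∧ φ (c.act k z) = d.act (iso k) (φ z)) ∧
    ∃ hg : g ∈ c.isotropy x, (iso ⟨g, hg⟩ : d.G) = h

end OrbifoldChart

/-- For an endomorphism with eigenvalues `exp (2π√-1 θ₁), …, exp (2π√-1 θₙ)`, listed with
multiplicity and with `0 ≤ θᵢ < 1`, this is `θ₁ + ⋯ + θₙ`. -/
def age {n : ℕ} (L : (Fin n → ℂ) →ₗ[ℂ] (Fin n → ℂ)) : ℝ :=
  (L.charpoly.roots.map fun μ => Int.fract (Complex.arg μ / (2 * Real.pi))).sum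

section Inertia

variable {X : Type u} [TopologicalSpace X] {n : ℕ} {I : Type w}

/-- The disjoint union of the fixed-point sets `V_i^g` over all charts `i` of an atlas and all
`g ∈ G_i`, `g ≠ 1` (with the topology of a disjoint union). -/
abbrev TwistedPoint (A : I → OrbifoldChart.{u, v} X n) :=
  Σ a : (Σ i : I, {g : (A i).G // g ≠ 1}), (A a.1).fixedLocus a.2.1

namespace TwistedPoint

variable {A : I → OrbifoldChart.{u, v} X n}

/-- The chart in which the point is given. -/
abbrev chart (q : TwistedPoint A) : OrbifoldChart.{u, v} X n := A q.1.1

/-- The group element of the point. -/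
abbrev elt (q : TwistedPoint A) : q.chart.G := q.1.2.1

/-- The underlying point of the chart. -/
abbrev pt (q : TwistedPoint A) : q.chart.dom := ⟨q.2.1, q.2.2.1⟩

/-- The identification of points in different charts, and of conjugate points in one chart. -/
def Rel (q r : TwistedPoint A) : Prop :=
  q.chart.GermRel r.chart q.pt q.elt r.pt r.elt

/-- The sum of the exponents `m_{i,g} / m_g` of the action of `g` on the tangent space at `x`. -/
def age (q : TwistedPoint A) : ℝ :=
  ToricOrbifold.age (fderiv ℂ (q.chart.act q.elt) q.pt).toLinearMap

theorem Rel.age_eq {q r : TwistedPoint A} (h : q.Rel r) : q.age = r.age := by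
  obtain ⟨φ, hs, ht, iso, hx, hxy, hφ, hψ, -, hequiv, hg, hgh⟩ := h
  set x : Fin n → ℂ := (q.pt : Fin n → ℂ) with hxdef
  set y : Fin n → ℂ := (r.pt : Fin n → ℂ) with hydef
  have hgx : q.chart.act q.elt x = x := q.2.2.2
  have hhy : r.chart.act r.elt y = y := r.2.2.2
  have hyt : y ∈ φ.target := hxy ▸ φ.map_source hx
  have hyx : φ.symm y = x := by rw [← hxy, φ.left_inv hx]
  have d1 : HasFDerivAt φ (fderiv ℂ φ x) x :=
    (hφ.differentiableAt (φ.open_source.mem_nhds hx)).hasFDerivAt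
  have d2 : HasFDerivAt φ.symm (fderiv ℂ φ.symm y) y :=
    (hψ.differentiableAt (φ.open_target.mem_nhds hyt)).hasFDerivAt
  have dg : HasFDerivAt (q.chart.act q.elt) (fderiv ℂ (q.chart.act q.elt) x) x :=
    ((q.chart.differentiableOn_act q.elt).differentiableAt
      (q.chart.isOpen_dom.mem_nhds q.pt.2)).hasFDerivAt
  have dh : HasFDerivAt (r.chart.act r.elt) (fderiv ℂ (r.chart.act r.elt) y) y :=
    ((r.chart.differentiableOn_act r.elt).differentiableAt
      (r.chart.isOpen_dom.mem_nhds r.pt.2)).hasFDerivAt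
  have e1 : (fderiv ℂ φ.symm y).comp (fderiv ℂ φ x) = ContinuousLinearMap.id ℂ _ := by
    have h1 : HasFDerivAt (φ.symm ∘ φ) ((fderiv ℂ φ.symm y).comp (fderiv ℂ φ x)) x := by
      refine HasFDerivAt.comp x ?_ d1
      rw [hxy]; exact d2
    refine (h1.congr_of_eventuallyEq ?_).unique (hasFDerivAt_id x)
    filter_upwards [φ.open_source.mem_nhds hx] with z hz
    simp [φ.left_inv hz]
  have e2 : (fderiv ℂ φ x).comp (fderiv ℂ φ.symm y) = ContinuousLinearMap.id ℂ _ := by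
    have h1 : HasFDerivAt (φ ∘ φ.symm) ((fderiv ℂ φ x).comp (fderiv ℂ φ.symm y)) y := by
      refine HasFDerivAt.comp y ?_ d2
      rw [hyx]; exact d1
    refine (h1.congr_of_eventuallyEq ?_).unique (hasFDerivAt_id y)
    filter_upwards [φ.open_target.mem_nhds hyt] with z hz
    simp [φ.right_inv hz]
  have e3 : (fderiv ℂ φ x).comp (fderiv ℂ (q.chart.act q.elt) x) =
      (fderiv ℂ (r.chart.act r.elt) y).comp (fderiv ℂ φ x) := by
    have h1 : HasFDerivAt (φ ∘ q.chart.act q.elt)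
        ((fderiv ℂ φ x).comp (fderiv ℂ (q.chart.act q.elt) x)) x := by
      refine HasFDerivAt.comp x ?_ dg
      rw [hgx]; exact d1
    have h2 : HasFDerivAt (r.chart.act r.elt ∘ φ)
        ((fderiv ℂ (r.chart.act r.elt) y).comp (fderiv ℂ φ x)) x := by
      refine HasFDerivAt.comp x ?_ d1
      rw [hxy]; exact dh
    refine h1.unique (h2.congr_of_eventuallyEq ?_)
    filter_upwards [φ.open_source.mem_nhds hx] with z hz
    have := (hequiv ⟨q.elt, hg⟩ z hz).2
    rw [hgh] at this
    exact this
  let E : (Fin n → ℂ) ≃ₗ[ℂ] (Fin n → ℂ) :=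
    LinearEquiv.ofLinearMap (fderiv ℂ φ x).toLinearMap (fderiv ℂ φ.symm y).toLinearMap
      (LinearMap.ext fun t => congrArg (fun L : (Fin n → ℂ) →L[ℂ] (Fin n → ℂ) => L t) e2)
      (LinearMap.ext fun t => congrArg (fun L : (Fin n → ℂ) →L[ℂ] (Fin n → ℂ) => L t) e1)
  have e4 : E.conj (fderiv ℂ (q.chart.act q.elt) x).toLinearMap =
      (fderiv ℂ (r.chart.act r.elt) y).toLinearMap := by
    refine LinearMap.ext fun v => ?_
    have h1 := congrArg (fun L : (Fin n → ℂ) →L[ℂ] (Fin n → ℂ) => L (fderiv ℂ φ.symm y v)) e3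
    have h2 := congrArg (fun L : (Fin n → ℂ) →L[ℂ] (Fin n → ℂ) => L v) e2
    simp only [ContinuousLinearMap.comp_apply, ContinuousLinearMap.id_apply] at h1 h2
    rw [h2] at h1
    exact h1
  unfold age ToricOrbifold.age
  rw [← hxdef, ← hydef, ← e4, LinearEquiv.charpoly_conj]

end TwistedPoint

/-- The space `X̃_*` of pairs `(p, (g))` with `p ∈ X` and `(g)` the conjugacy class of some `g ≠ 1`
in the local group at `p`, with the topology given by the charts `V^g → V^g / C(g)`. -/
def TwistedInertia (A : I → OrbifoldChart.{u, v} X n) :=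
  Quot (TwistedPoint.Rel (A := A))

variable {A : I → OrbifoldChart.{u, v} X n}

instance : TopologicalSpace (TwistedInertia A) :=
  inferInstanceAs (TopologicalSpace (Quot _))

namespace TwistedInertia

/-- The class of a point given in a chart. -/
def mk (q : TwistedPoint A) : TwistedInertia A := Quot.mk _ q

/-- The projection `(p, (g)) ↦ p`. -/
def proj : TwistedInertia A → X :=
  Quot.lift (fun q => q.chart.proj q.pt) (by
    rintro q r ⟨φ, hs, ht, iso, hx, hxy, -, -, hproj, -⟩
    rw [← hproj _ hx]
    congr 1
    exact Subtype.ext hxy)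

/-- The function `ι : X̃_* → ℝ`. -/
def degreeShift : TwistedInertia A → ℝ :=
  Quot.lift TwistedPoint.age fun _ _ h => h.age_eq

end TwistedInertia

variable (A) in
/-- The twisted sectors: the connected components of `X̃_*`. -/
abbrev TwistedSector := ConnectedComponents (TwistedInertia A)

namespace TwistedSector

/-- The twisted sector as a subset of `X̃_*`. -/
def carrier (Z : TwistedSector A) : Set (TwistedInertia A) :=
  {s | (s : ConnectedComponents (TwistedInertia A)) = Z}

/-- A function on a twisted sector is holomorphic near a point of it, for the complex orbifold
structure with the charts `V^g → V^g / C(g)`: its pull-back to `V^g` is, near a preimage of the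
point, the restriction of a holomorphic function of the ambient coordinates. -/
def HolomorphicAt (Z : TwistedSector A) (f : Z.carrier → ℂ) (s : Z.carrier) : Prop :=
  ∃ q : TwistedPoint A, TwistedInertia.mk q = s ∧
    ∃ F : (Fin n → ℂ) → ℂ, (∀ᶠ t in 𝓝 (q.pt : Fin n → ℂ), DifferentiableAt ℂ F t) ∧
      ∀ᶠ r in 𝓝 q, ∀ h : TwistedInertia.mk r ∈ Z.carrier, f ⟨TwistedInertia.mk r, h⟩ = F r.pt

end TwistedSector

end Inertia

/-! ## Fans and toric varieties -/

/-- The inclusion of the lattice `N` in `N_ℝ = ℝ ⊗ N`. -/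
def latt {N : Type u} [AddCommGroup N] (v : N) : ℝ ⊗[ℤ] N := (1 : ℝ) ⊗ₜ[ℤ] v

/-- A finite fan of strongly convex rational polyhedral cones in `N_ℝ`. -/
structure Fan (N : Type u) [AddCommGroup N] where
  cones : Set (PointedCone ℝ (ℝ ⊗[ℤ] N))
  finite : cones.Finite
  rational : ∀ σ ∈ cones, ∃ s : Finset N, σ = PointedCone.hull ℝ (latt '' (s : Set N))
  stronglyConvex : ∀ σ ∈ cones, ∀ x ∈ σ, -x ∈ σ → x = 0
  face_mem : ∀ σ ∈ cones, ∀ τ : PointedCone ℝ (ℝ ⊗[ℤ] N), τ.IsFaceOf σ → τ ∈ cones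
  inf_isFaceOf : ∀ σ ∈ cones, ∀ τ ∈ cones, (σ ⊓ τ).IsFaceOf σ ∧ (σ ⊓ τ).IsFaceOf τ

section Toric

variable {N : Type u} [AddCommGroup N]

/-- A fan is simplicial if each of its cones is generated by linearly independent vectors. -/
def Fan.IsSimplicial (Ξ : Fan N) : Prop := ∀ σ ∈ Ξ.cones, PointedCone.IsSimplicial σ

/-- The semigroup `S_σ = {m ∈ M : ⟨m, v⟩ ≥ 0 for all v ∈ σ}`, where `M = Hom(N, ℤ)`. -/
def dualMonoid (σ : PointedCone ℝ (ℝ ⊗[ℤ] N)) : AddSubmonoid (Module.Dual ℤ N) where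
  carrier := {m | ∀ v : N, latt v ∈ σ → 0 ≤ m v}
  zero_mem' := by intro v _; simp
  add_mem' := by
    intro a b ha hb v hv
    simpa using add_nonneg (ha v hv) (hb v hv)

theorem dualMonoid_anti {τ σ : PointedCone ℝ (ℝ ⊗[ℤ] N)} (h : τ ≤ σ) :
    dualMonoid σ ≤ dualMonoid τ := fun _ hm v hv => hm v (h hv)

/-- The complex points of `U_σ = Spec ℂ[S_σ]`: homomorphisms of monoids from `S_σ` to `(ℂ, ·)`. -/
def AffinePoint (σ : PointedCone ℝ (ℝ ⊗[ℤ] N)) := Multiplicative (dualMonoid σ) →* ℂ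

/-- The value `χ^m(x)` of the character `m ∈ S_σ` at the point `x ∈ U_σ`. -/
def AffinePoint.eval {σ : PointedCone ℝ (ℝ ⊗[ℤ] N)} (x : AffinePoint σ) (m : dualMonoid σ) : ℂ :=
  (show Multiplicative (dualMonoid σ) →* ℂ from x) (Multiplicative.ofAdd m)

/-- The classical topology of `U_σ`: the coarsest one in which all the functions `χ^m` are
continuous. -/
instance (σ : PointedCone ℝ (ℝ ⊗[ℤ] N)) : TopologicalSpace (AffinePoint σ) :=
  TopologicalSpace.induced AffinePoint.eval inferInstance

/-- The map `U_τ → U_σ` for `τ ⊆ σ`, i.e. restriction along `S_σ ⊆ S_τ`. -/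
def AffinePoint.incl {τ σ : PointedCone ℝ (ℝ ⊗[ℤ] N)} (h : τ ≤ σ) (x : AffinePoint τ) :
    AffinePoint σ :=
  MonoidHom.comp x (AddMonoidHom.toMultiplicative (AddSubmonoid.inclusion (dualMonoid_anti h)))

/-- The gluing relation: a point of `U_τ` is identified with its image in `U_σ`, for `τ` a face
of `σ`. -/
def Fan.Glue (Ξ : Fan N) (p q : Σ σ : Ξ.cones, AffinePoint σ.1) : Prop :=
  ∃ h : p.1.1.IsFaceOf q.1.1, AffinePoint.incl h.le p.2 = q.2

/-- The toric variety `X_Ξ` (its complex points, with the classical topology), glued from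
the affine varieties `U_σ`. -/
def ToricVariety (Ξ : Fan N) := Quot Ξ.Glue

instance (Ξ : Fan N) : TopologicalSpace (ToricVariety Ξ) :=
  inferInstanceAs (TopologicalSpace (Quot _))

/-- The map `U_σ → X_Ξ`. -/
def ToricVariety.mk {Ξ : Fan N} (σ : Ξ.cones) (x : AffinePoint σ.1) : ToricVariety Ξ :=
  Quot.mk _ ⟨σ, x⟩

/-- The torus orbit `O_τ = Hom(τ^⊥ ∩ M, ℂ^*)`, embedded in `U_τ` by extension by zero. -/
def orbit {Ξ : Fan N} (τ : Ξ.cones) : Set (ToricVariety Ξ) :=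
  {p | ∃ x : AffinePoint τ.1, p = ToricVariety.mk τ x ∧
    ∀ m : dualMonoid τ.1, x.eval m ≠ 0 ↔ ∀ v : N, latt v ∈ τ.1 → m.1 v = 0}

/-- The orbit closure `Ō_τ`. -/
def orbitClosure {Ξ : Fan N} (τ : Ξ.cones) : Set (ToricVariety Ξ) := closure (orbit τ)

/-- A function on a closed subvariety `Y` of `X_Ξ` is holomorphic near `y`, for the reduced
complex analytic structure on `Y`: for some affine chart `U_σ` containing `y` and some
`m₁, …, m_k ∈ S_σ`, it is near `y` a holomorphic function of `χ^{m₁}, …, χ^{m_k}`. -/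
def ToricVariety.HolomorphicAt {Ξ : Fan N} (Y : Set (ToricVariety Ξ)) (f : Y → ℂ) (y : Y) : Prop :=
  ∃ (σ : Ξ.cones) (x : AffinePoint σ.1), ToricVariety.mk σ x = y ∧
    ∃ (k : ℕ) (m : Fin k → dualMonoid σ.1) (F : (Fin k → ℂ) → ℂ),
      (∀ᶠ t in 𝓝 (fun j => x.eval (m j)), DifferentiableAt ℂ F t) ∧
      ∀ᶠ x' in 𝓝 x, ∀ h : ToricVariety.mk σ x' ∈ Y,
        f ⟨ToricVariety.mk σ x', h⟩ = F (fun j => x'.eval (m j))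

/-- The primitive generators of the one-dimensional faces of a cone: `v ≠ 0` such that
`η = ℝ_{≥0} v` is a face of `σ` and `v` generates the semigroup `η ∩ N`. -/
def rayGenerators (σ : PointedCone ℝ (ℝ ⊗[ℤ] N)) : Set N :=
  {v | v ≠ 0 ∧ (PointedCone.hull ℝ {latt v}).IsFaceOf σ ∧
    ∀ u : N, latt u ∈ PointedCone.hull ℝ {latt v} → ∃ k : ℕ, u = k • v}

/-! ## The orbifold structure of a simplicial toric variety -/

/-- The data of an orbifold chart of `X_Ξ` over `U_σ`: a cone `σ` of the fan and lattice vectors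
`w₁, …, w_n` which form a basis of `N_ℝ` and contain the primitive generators of `σ`.
If `σ` has dimension `n`, then `w` is just an enumeration of the generators of `σ`. -/
structure ChartIndex (Ξ : Fan N) where
  cone : Ξ.cones
  w : Fin (Module.finrank ℤ N) → N
  basis : Module.Basis (Fin (Module.finrank ℤ N)) ℝ (ℝ ⊗[ℤ] N)
  basis_eq : ∀ l, basis l = latt (w l)
  rays_subset : rayGenerators cone.1 ⊆ Set.range w

namespace ChartIndex

variable {Ξ : Fan N} (c : ChartIndex Ξ)

/-- The sublattice of `N` generated by `w₁, …, w_n`. -/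
def sublattice : Submodule ℤ N := Submodule.span ℤ (Set.range c.w)

/-- The coordinates of `κ ∈ N` with respect to `w₁, …, w_n`, modulo `ℤ`. -/
def angleAux : N →ₗ[ℤ] (Fin (Module.finrank ℤ N) → UnitAddCircle) :=
  AddMonoidHom.toIntLinearMap
    { toFun := fun v l => ((c.basis.repr (latt v) l : ℝ) : UnitAddCircle)
      map_zero' := by ext l; simp [latt]
      map_add' := by intro a b; ext l; simp [latt, TensorProduct.tmul_add] }

theorem angleAux_apply (v : N) (l) :
    c.angleAux v l = ((c.basis.repr (latt v) l : ℝ) : UnitAddCircle) := rfl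

theorem sublattice_le_ker : c.sublattice ≤ LinearMap.ker c.angleAux := by
  refine Submodule.span_le.2 ?_
  rintro _ ⟨k, rfl⟩
  simp only [SetLike.mem_coe, LinearMap.mem_ker]
  ext l
  rw [angleAux_apply, ← c.basis_eq, Module.Basis.repr_self, Finsupp.single_apply]
  split_ifs
  · exact AddCircle.coe_period (1 : ℝ)
  · simp

/-- The pairing of `N / ⟨w₁, …, w_n⟩` with the dual basis, with values in `ℝ / ℤ`. -/
def angle : (N ⧸ c.sublattice) →ₗ[ℤ] (Fin (Module.finrank ℤ N) → UnitAddCircle) :=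
  c.sublattice.liftQ c.angleAux c.sublattice_le_ker

/-- The action of `[κ] ∈ N / ⟨w₁, …, w_n⟩` on `ℂⁿ` by the diagonal matrix with entries
`exp (2π√-1 c₁), …, exp (2π√-1 c_n)`, where `κ = c₁ w₁ + ⋯ + c_n w_n`. -/
def act (g : Multiplicative (N ⧸ c.sublattice)) (z : Fin (Module.finrank ℤ N) → ℂ) :
    Fin (Module.finrank ℤ N) → ℂ :=
  fun l => ((AddCircle.toCircle (c.angle g.toAdd l) : Circle) : ℂ) * z l

/-- The set of those `z ∈ ℂⁿ` all of whose coordinates that do not belong to generators of `σ` are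
non-zero. -/
def dom : Set (Fin (Module.finrank ℤ N) → ℂ) :=
  {z | ∀ l, c.w l ∉ rayGenerators c.cone.1 → z l ≠ 0}

theorem ne_zero_or_nonneg {z : Fin (Module.finrank ℤ N) → ℂ} (hz : z ∈ c.dom)
    (m : dualMonoid c.cone.1) (l) : z l ≠ 0 ∨ 0 ≤ m.1 (c.w l) := by
  by_cases h : c.w l ∈ rayGenerators c.cone.1
  · exact Or.inr (m.2 _ (h.2.1.le (PointedCone.subset_hull rfl)))
  · exact Or.inl (hz l h)

/-- The point of `U_σ` with `χ^m = ∏_l z_l ^ ⟨m, w_l⟩`. -/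
def monomial (z : c.dom) : AffinePoint c.cone.1 where
  toFun m := ∏ l, z.1 l ^ ((Multiplicative.toAdd m).1 (c.w l))
  map_one' := by simp
  map_mul' := by
    intro a b
    rw [← Finset.prod_mul_distrib]
    refine Finset.prod_congr rfl fun l _ => ?_
    rcases eq_or_ne (z.1 l) 0 with h0 | h0
    · have ha := (c.ne_zero_or_nonneg z.2 (Multiplicative.toAdd a) l).resolve_left (by simpa)
      have hb := (c.ne_zero_or_nonneg z.2 (Multiplicative.toAdd b) l).resolve_left (by simpa)
      obtain ⟨i, hi⟩ := Int.eq_ofNat_of_zero_le ha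
      obtain ⟨j, hj⟩ := Int.eq_ofNat_of_zero_le hb
      have hab : (Multiplicative.toAdd (a * b)).1 (c.w l) = ((i + j : ℕ) : ℤ) := by
        simp [hi, hj]
      rw [hab, hi, hj, zpow_natCast, zpow_natCast, zpow_natCast, pow_add]
    · have hab : (Multiplicative.toAdd (a * b)).1 (c.w l) =
          (Multiplicative.toAdd a).1 (c.w l) + (Multiplicative.toAdd b).1 (c.w l) := by simp
      rw [hab, zpow_add₀ h0]

theorem eval_monomial (z : c.dom) (m : dualMonoid c.cone.1) :
    (c.monomial z).eval m = ∏ l, z.1 l ^ (m.1 (c.w l)) := rfl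

theorem isOpen_dom : IsOpen c.dom := by
  have : c.dom = ⋂ l, {z | c.w l ∉ rayGenerators c.cone.1 → z l ≠ 0} := by
    ext z; simp [dom]
  rw [this]
  refine isOpen_iInter_of_finite fun l => ?_
  by_cases h : c.w l ∈ rayGenerators c.cone.1
  · simp [h]
  · simpa [h] using isOpen_ne_fun (continuous_apply l) continuous_const

theorem continuous_monomial : Continuous c.monomial := by
  refine continuous_induced_rng.2 (continuous_pi fun m => ?_)
  simp only [Function.comp_apply, eval_monomial]
  refine continuous_finsetProd _ fun l _ => continuous_iff_continuousAt.2 fun z => ?_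
  exact ContinuousAt.zpow₀ (f := fun z : c.dom => z.1 l)
    ((continuous_apply l).comp continuous_subtype_val).continuousAt _
    (c.ne_zero_or_nonneg z.2 m l)

theorem sum_mul_repr (m : Module.Dual ℤ N) (v : N) :
    ∑ l, (m (c.w l) : ℝ) * c.basis.repr (latt v) l = (m v : ℝ) := by
  let f : ℝ ⊗[ℤ] N →ₗ[ℝ] ℝ := (TensorProduct.AlgebraTensorModule.rid ℤ ℝ ℝ).toLinearMap ∘ₗ
    LinearMap.baseChange ℝ m
  have hf : ∀ u : N, f (latt u) = (m u : ℝ) := by intro u; simp [f, latt]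
  rw [← hf v]
  conv_rhs => rw [← c.basis.sum_repr (latt v)]
  rw [map_sum]
  refine Finset.sum_congr rfl fun l _ => ?_
  rw [map_smul, c.basis_eq, hf, smul_eq_mul, mul_comm]

theorem toCircle_sum {ι : Type*} (s : Finset ι) (f : ι → UnitAddCircle) :
    AddCircle.toCircle (∑ i ∈ s, f i) = ∏ i ∈ s, AddCircle.toCircle (f i) := by
  classical
  induction s using Finset.induction_on with
  | empty => simp
  | insert a s ha ih => rw [Finset.sum_insert ha, Finset.prod_insert ha, AddCircle.toCircle_add, ih]

theorem prod_angle (m : Module.Dual ℤ N) (g : N ⧸ c.sublattice) :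
    ∏ l, ((AddCircle.toCircle (c.angle g l) : Circle) : ℂ) ^ (m (c.w l)) = 1 := by
  obtain ⟨v, rfl⟩ := Submodule.Quotient.mk_surjective _ g
  have h : ∀ l, c.angle (Submodule.Quotient.mk v) l =
      ((c.basis.repr (latt v) l : ℝ) : UnitAddCircle) := fun l => rfl
  have h2 : ∏ l, (AddCircle.toCircle (c.angle (Submodule.Quotient.mk v) l) : Circle) ^
      (m (c.w l)) = 1 := by
    simp_rw [← AddCircle.toCircle_zsmul, ← toCircle_sum, h, ← AddCircle.coe_zsmul, zsmul_eq_mul]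
    have hsum := map_sum (QuotientAddGroup.mk' (AddSubgroup.zmultiples (1 : ℝ)))
      (fun l => (m (c.w l) : ℝ) * c.basis.repr (latt v) l) Finset.univ
    rw [c.sum_mul_repr] at hsum
    have : ((m v : ℝ) : UnitAddCircle) = 0 := by
      rw [AddCircle.coe_eq_zero_iff]
      exact ⟨m v, by simp⟩
    exact (congrArg AddCircle.toCircle (hsum.symm.trans this)).trans AddCircle.toCircle_zero
  have h3 := congrArg (Circle.coeHom) h2
  rw [map_prod, map_one] at h3
  simp only [map_zpow] at h3
  exact h3

theorem act_mem {z : Fin (Module.finrank ℤ N) → ℂ} (g : Multiplicative (N ⧸ c.sublattice))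
    (hz : z ∈ c.dom) : c.act g z ∈ c.dom := fun l hl =>
  mul_ne_zero (Circle.coe_ne_zero _) (hz l hl)

theorem monomial_act (g : Multiplicative (N ⧸ c.sublattice)) (z : c.dom) :
    c.monomial ⟨c.act g z, c.act_mem g z.2⟩ = c.monomial z := by
  refine MonoidHom.ext fun m => ?_
  change ∏ l, (((AddCircle.toCircle (c.angle g.toAdd l) : Circle) : ℂ) * z.1 l) ^ _ =
    ∏ l, z.1 l ^ _
  simp_rw [mul_zpow]
  rw [Finset.prod_mul_distrib, c.prod_angle, one_mul]

theorem finite_quotient [Module.Free ℤ N] [Module.Finite ℤ N] : Finite (N ⧸ c.sublattice) := by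
  apply Submodule.finiteQuotientOfFreeOfRankEq
  have hli : LinearIndependent ℤ c.w := by
    have h1 : LinearIndependent ℤ (fun l => latt (c.w l)) := by
      have := c.basis.linearIndependent.restrict_scalars
        (R := ℤ) (by intro a b h; simpa using h)
      simpa [← c.basis_eq] using this
    exact LinearIndependent.of_comp (TensorProduct.mk ℤ ℝ N 1) h1
  rw [sublattice, finrank_span_eq_card hli, Fintype.card_fin]

/-- The chart `dom → dom / G = U_σ ⊆ X_Ξ` with group `G = N / ⟨w₁, …, w_n⟩`. -/
def chart [Module.Free ℤ N] [Module.Finite ℤ N] :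
    OrbifoldChart.{u, u} (ToricVariety Ξ) (Module.finrank ℤ N) where
  dom := c.dom
  isOpen_dom := c.isOpen_dom
  G := Multiplicative (N ⧸ c.sublattice)
  finite := c.finite_quotient
  act := c.act
  mapsTo_act g _ hz := c.act_mem g hz
  act_one z _ := by ext l; simp [act]
  act_mul g h z _ := by
    ext l
    simp [act, AddCircle.toCircle_add, mul_assoc]
  differentiableOn_act g := by
    refine Differentiable.differentiableOn (differentiable_pi.2 fun l => ?_)
    exact (differentiable_apply l).const_mul _
  proj z := ToricVariety.mk c.cone (c.monomial z)
  continuous_proj := continuous_quot_mk.comp (continuous_sigmaMk.comp c.continuous_monomial)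
  proj_act g z := by rw [c.monomial_act g z]

/-- The element of the group of the chart given by a lattice vector. -/
def elt [Module.Free ℤ N] [Module.Finite ℤ N] (v : N) : c.chart.G :=
  Multiplicative.ofAdd (Submodule.Quotient.mk v : N ⧸ c.sublattice)

end ChartIndex

/-- The orbifold structure of the simplicial toric variety `X_Ξ`. -/
def toricAtlas [Module.Free ℤ N] [Module.Finite ℤ N] (Ξ : Fan N) :
    ChartIndex Ξ → OrbifoldChart.{u, u} (ToricVariety Ξ) (Module.finrank ℤ N) :=
  fun c => c.chart

/-- The twisted sector `Z` is of type `Ō_τ`: the projection `(p, (g)) ↦ p` restricts to an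
isomorphism of complex spaces from `Z` onto the orbit closure `Ō_τ`. -/
def IsOfType [Module.Free ℤ N] [Module.Finite ℤ N] {Ξ : Fan N} (Z : TwistedSector (toricAtlas Ξ))
    (τ : Ξ.cones) : Prop :=
  ∃ e : Z.carrier ≃ₜ orbitClosure τ,
    (∀ s, (e s : ToricVariety Ξ) = TwistedInertia.proj s.1) ∧
    ∀ (f : orbitClosure τ → ℂ) (s : Z.carrier),
      ToricVariety.HolomorphicAt (orbitClosure τ) f (e s) ↔ Z.HolomorphicAt (f ∘ e) s

/-- `v = ∑ a_ρ ρ`, the sum over the primitive generators `ρ` of `τ`, with all `a_ρ ∈ (0, 1)`. -/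
def IsBoxRepr (τ : PointedCone ℝ (ℝ ⊗[ℤ] N)) (v : N) (a : N →₀ ℝ) : Prop :=
  (a.support : Set N) = rayGenerators τ ∧ (∀ ρ ∈ rayGenerators τ, a ρ ∈ Set.Ioo (0 : ℝ) 1) ∧
    latt v = a.sum fun ρ t => t • latt ρ

/-- The lattice points which are linear combinations of the primitive generators of `τ` with
coefficients in `(0, 1)`. Such a point lies in the (relative) interior of `τ`. -/
def box (τ : PointedCone ℝ (ℝ ⊗[ℤ] N)) : Set N := {v | ∃ a, IsBoxRepr τ v a}

end Toric

end ToricOrbifold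

end

open ToricOrbifold

open scoped TensorProduct Topology

universe u

namespace ToricOrbifold

variable {N : Type u} [AddCommGroup N]

theorem latt_add (a b : N) : latt (a + b) = latt a + latt b := TensorProduct.tmul_add _ _ _

theorem latt_zero : latt (0 : N) = 0 := TensorProduct.tmul_zero _ _

theorem latt_sub (a b : N) : latt (a - b) = latt a - latt b := TensorProduct.tmul_sub _ _ _

theorem latt_zsmul (k : ℤ) (a : N) : latt (k • a) = (k : ℝ) • latt a := by
  rw [latt, latt, TensorProduct.tmul_smul, ← Int.cast_smul_eq_zsmul ℝ]

theorem latt_sum {ι : Type*} (s : Finset ι) (f : ι → N) :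
    latt (∑ i ∈ s, f i) = ∑ i ∈ s, latt (f i) := TensorProduct.tmul_sum _ _ _

/-- The real extension of an integral functional. -/
noncomputable def dualReal (m : Module.Dual ℤ N) : ℝ ⊗[ℤ] N →ₗ[ℝ] ℝ :=
  (TensorProduct.AlgebraTensorModule.rid ℤ ℝ ℝ).toLinearMap ∘ₗ LinearMap.baseChange ℝ m

theorem dualReal_latt (m : Module.Dual ℤ N) (v : N) : dualReal m (latt v) = (m v : ℝ) := by
  simp [dualReal, latt]

section Free

variable [Module.Free ℤ N]

theorem latt_injective : Function.Injective (latt : N → ℝ ⊗[ℤ] N) := by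
  intro a b h
  let B := Module.Free.chooseBasis ℤ N
  refine B.repr.injective (Finsupp.ext fun i => ?_)
  have := congrArg (dualReal (B.coord i)) h
  rw [dualReal_latt, dualReal_latt] at this
  exact_mod_cast this

theorem latt_eq_zero {v : N} : latt v = 0 ↔ v = 0 := by
  rw [← latt_zero]; exact latt_injective.eq_iff

variable [Module.Finite ℤ N]

theorem exists_dual_ne_zero {v : N} (hv : v ≠ 0) : ∃ m : Module.Dual ℤ N, 0 < m v := by
  let B := Module.Free.chooseBasis ℤ N
  have : ∃ i, B.repr v i ≠ 0 := by
    by_contra! h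
    exact hv (B.repr.injective (by ext i; simp [h i]))
  obtain ⟨i, hi⟩ := this
  rcases lt_or_gt_of_ne hi with h | h
  · exact ⟨-B.coord i, by simpa using h⟩
  · exact ⟨B.coord i, by simpa using h⟩

/-- A ray which contains a non-zero lattice vector has a primitive generator. -/
theorem exists_primitive {v : N} (hv : v ≠ 0) :
    ∃ u : N, u ≠ 0 ∧ (∃ t : ℝ, 0 < t ∧ latt u = t • latt v) ∧
      ∀ u' : N, (∃ t : ℝ, 0 ≤ t ∧ latt u' = t • latt v) → ∃ k : ℕ, u' = k • u := by
  obtain ⟨m, hm⟩ := exists_dual_ne_zero hv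
  have hmR : (0 : ℝ) < m v := by exact_mod_cast hm
  have hex : ∃ d : ℕ, 0 < d ∧ ∃ u : N, (∃ t : ℝ, 0 < t ∧ latt u = t • latt v) ∧ m u = d :=
    ⟨(m v).toNat, by omega, v, ⟨1, one_pos, (one_smul _ _).symm⟩, by omega⟩
  classical
  obtain ⟨hd, u, ⟨t, ht, hu⟩, hmu⟩ := Nat.find_spec hex
  have hmin := fun k => @Nat.find_min _ _ hex k
  set d := Nat.find hex
  have hval : ∀ (u' : N) (t' : ℝ), latt u' = t' • latt v → (m u' : ℝ) = t' * m v := by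
    intro u' t' h
    rw [← dualReal_latt, h, map_smul, dualReal_latt, smul_eq_mul]
  refine ⟨u, ?_, ⟨t, ht, hu⟩, ?_⟩
  · rintro rfl; simp at hmu; omega
  rintro u' ⟨t', ht', hu'⟩
  have h0 : 0 ≤ m u' := by
    have := hval u' t' hu'
    have h2 : (0 : ℝ) ≤ m u' := this ▸ mul_nonneg ht' hmR.le
    exact_mod_cast h2
  have hdiv := Int.emod_add_mul_ediv (m u') d
  set q := m u' / (d : ℤ)
  set r := m u' % (d : ℤ)
  have hr0 : 0 ≤ r := Int.emod_nonneg _ (by omega)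
  have hrd : r < d := Int.emod_lt_of_pos _ (by omega)
  have hq : 0 ≤ q := Int.ediv_nonneg h0 (by omega)
  have hl : latt (u' - q • u) = (t' - q * t) • latt v := by
    rw [latt_sub, latt_zsmul, hu', hu, smul_smul, sub_smul]
  have hmr : m (u' - q • u) = r := by
    rw [map_sub, map_smul, hmu, smul_eq_mul]; linarith
  have hr' := hval _ _ hl
  rw [hmr] at hr'
  have hs : 0 ≤ t' - q * t := by
    by_contra! hneg
    have : (r : ℝ) < 0 := by rw [hr']; exact mul_neg_of_neg_of_pos hneg hmR
    have : r < 0 := by exact_mod_cast this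
    omega
  have hs0 : t' - q * t = 0 := by
    by_contra hne
    have hpos := lt_of_le_of_ne hs (Ne.symm hne)
    have hrpos : (0 : ℝ) < r := by rw [hr']; exact mul_pos hpos hmR
    have hrpos' : 0 < r := by exact_mod_cast hrpos
    exact hmin r.toNat (by omega) ⟨by omega, u' - q • u, ⟨_, hpos, hl⟩, by omega⟩
  rw [hs0, zero_smul, latt_eq_zero, sub_eq_zero] at hl
  refine ⟨q.toNat, ?_⟩
  rw [hl, ← natCast_zsmul, Int.toNat_of_nonneg hq]

end Free

end ToricOrbifold

namespace ToricOrbifold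

section Cone

variable {V ι : Type*} [AddCommGroup V] [Module ℝ V]

theorem mem_hull_singleton {a x : V} :
    x ∈ PointedCone.hull ℝ {a} ↔ ∃ t : ℝ, 0 ≤ t ∧ x = t • a := by
  rw [PointedCone.hull, Submodule.mem_span_singleton]
  constructor
  · rintro ⟨c, rfl⟩; exact ⟨c, c.2, rfl⟩
  · rintro ⟨t, ht, rfl⟩; exact ⟨⟨t, ht⟩, rfl⟩

theorem mem_hull_basis_image (b : Module.Basis ι ℝ V) (S : Set ι) {x : V} :
    x ∈ PointedCone.hull ℝ (b '' S) ↔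
      ∀ i, 0 ≤ b.repr x i ∧ (i ∉ S → b.repr x i = 0) := by
  classical
  constructor
  · intro hx
    induction hx using Submodule.span_induction with
    | mem x hx =>
      obtain ⟨j, hj, rfl⟩ := hx
      intro i
      rw [b.repr_self, Finsupp.single_apply]
      split_ifs with h
      · subst h; simp [hj]
      · simp
    | zero => simp
    | add x y _ _ hx hy =>
      intro i
      simp only [map_add, Finsupp.add_apply]
      exact ⟨add_nonneg (hx i).1 (hy i).1, fun h => by rw [(hx i).2 h, (hy i).2 h, add_zero]⟩
    | smul a x _ hx =>
      intro i
      have : b.repr (a • x) i = (a : ℝ) * b.repr x i := by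
        change b.repr ((a : ℝ) • x) i = _
        rw [map_smul, Finsupp.smul_apply, smul_eq_mul]
      rw [this]
      exact ⟨mul_nonneg a.2 (hx i).1, fun h => by rw [(hx i).2 h, mul_zero]⟩
  · intro h
    rw [← b.linearCombination_repr x, Finsupp.linearCombination_apply]
    refine Submodule.sum_mem _ fun i hi => ?_
    have hS : i ∈ S := by
      by_contra hS
      exact (Finsupp.mem_support_iff.1 hi) ((h i).2 hS)
    exact PointedCone.smul_mem _ (h i).1 (PointedCone.subset_hull ⟨i, hS, rfl⟩)

theorem isFaceOf_hull_basis_image (b : Module.Basis ι ℝ V) {S T : Set ι} (h : T ⊆ S) :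
    (PointedCone.hull ℝ (b '' T)).IsFaceOf (PointedCone.hull ℝ (b '' S)) := by
  refine ⟨Submodule.span_mono (Set.image_mono h), ?_⟩
  intro x y a hx hy ha hxy
  rw [mem_hull_basis_image] at hx hy hxy ⊢
  refine fun i => ⟨(hx i).1, fun hi => ?_⟩
  have h1 := (hxy i).2 hi
  simp only [map_add, map_smul, Finsupp.add_apply, Finsupp.smul_apply, smul_eq_mul] at h1
  have h2 := mul_nonneg ha.le (hx i).1
  have h3 : a * b.repr x i = 0 := by linarith [(hy i).1]
  exact (mul_eq_zero.1 h3).resolve_left ha.ne'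

theorem exists_basis_mem_of_isFaceOf (b : Module.Basis ι ℝ V) {S : Set ι} {v : V} (hv : v ≠ 0)
    (h : (PointedCone.hull ℝ {v}).IsFaceOf (PointedCone.hull ℝ (b '' S))) :
    ∃ i ∈ S, ∃ t : ℝ, 0 < t ∧ v = t • b i := by
  classical
  have hvm : v ∈ PointedCone.hull ℝ (b '' S) := h.le (PointedCone.subset_hull rfl)
  have hc := (mem_hull_basis_image b S).1 hvm
  obtain ⟨i, hi⟩ : ∃ i, b.repr v i ≠ 0 := by
    by_contra! h0
    exact hv (b.repr.injective (by ext i; simp [h0 i]))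
  have hpos : 0 < b.repr v i := lt_of_le_of_ne (hc i).1 (Ne.symm hi)
  have hiS : i ∈ S := by by_contra hS; exact hi ((hc i).2 hS)
  have hb : b i ∈ PointedCone.hull ℝ {v} := by
    refine h.mem_of_smul_add_mem (x := b i) (y := v - b.repr v i • b i) (a := b.repr v i)
      (PointedCone.subset_hull ⟨i, hiS, rfl⟩) ?_ hpos ?_
    · rw [mem_hull_basis_image]
      intro j
      simp only [map_sub, map_smul, Finsupp.sub_apply, Finsupp.smul_apply, b.repr_self,
        Finsupp.single_apply, smul_eq_mul]
      split_ifs with hij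
      · subst hij; simp
      · simpa using hc j
    · rw [add_sub_cancel]; exact PointedCone.subset_hull rfl
  obtain ⟨t, ht, hbt⟩ := mem_hull_singleton.1 hb
  have ht0 : t ≠ 0 := by
    rintro rfl
    rw [zero_smul] at hbt
    exact b.ne_zero i hbt
  exact ⟨i, hiS, t⁻¹, inv_pos.2 (lt_of_le_of_ne ht ht0.symm), by
    rw [hbt, smul_smul, inv_mul_cancel₀ ht0, one_smul]⟩

theorem hull_singleton_smul {a : V} {t : ℝ} (ht : 0 < t) :
    PointedCone.hull ℝ {t • a} = PointedCone.hull ℝ {a} := by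
  ext x
  rw [mem_hull_singleton, mem_hull_singleton]
  constructor
  · rintro ⟨s, hs, rfl⟩; exact ⟨s * t, mul_nonneg hs ht.le, smul_smul _ _ _⟩
  · rintro ⟨s, hs, rfl⟩
    exact ⟨s / t, div_nonneg hs ht.le, by rw [smul_smul, div_mul_cancel₀ _ ht.ne']⟩

end Cone

variable {N : Type u} [AddCommGroup N]

theorem rayGenerators_eq_of_smul [Module.Free ℤ N] {σ : PointedCone ℝ (ℝ ⊗[ℤ] N)} {v v' : N}
    (hv : v ∈ rayGenerators σ) (hv' : v' ∈ rayGenerators σ) {t : ℝ} (ht : 0 < t)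
    (h : latt v = t • latt v') : v = v' := by
  obtain ⟨k, hk⟩ := hv'.2.2 v (mem_hull_singleton.2 ⟨t, ht.le, h⟩)
  obtain ⟨l, hl⟩ := hv.2.2 v' (mem_hull_singleton.2 ⟨t⁻¹, (inv_pos.2 ht).le, by
    rw [h, smul_smul, inv_mul_cancel₀ ht.ne', one_smul]⟩)
  have h1 : ((k * l : ℕ) : ℤ) • v = (1 : ℤ) • v := by
    rw [natCast_zsmul, one_smul, mul_smul, ← hl, ← hk]
  have h2 : (((k * l : ℕ) : ℤ) - 1) • v = 0 := by rw [sub_smul, h1, sub_self]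
  rcases smul_eq_zero.1 h2 with h3 | h3
  · have h4 : k * l = 1 := by omega
    have : k = 1 := Nat.eq_one_of_mul_eq_one_right h4
    rw [hk, this, one_smul]
  · exact absurd h3 hv.1

theorem rayGenerators_trans {τ σ : PointedCone ℝ (ℝ ⊗[ℤ] N)} (h : τ.IsFaceOf σ) :
    rayGenerators τ = {v ∈ rayGenerators σ | latt v ∈ τ} := by
  ext v
  constructor
  · exact fun hv => ⟨⟨hv.1, hv.2.1.trans h, hv.2.2⟩, hv.2.1.le (PointedCone.subset_hull rfl)⟩
  · rintro ⟨hv, hvτ⟩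
    refine ⟨hv.1, (hv.2.1.isFaceOf_iff_le h).2 ?_, hv.2.2⟩
    exact Submodule.span_le.2 (Set.singleton_subset_iff.2 hvτ)

theorem Fan.isFaceOf_of_le {Ξ : Fan N} {τ σ : Ξ.cones} (h : τ.1 ≤ σ.1) : τ.1.IsFaceOf σ.1 := by
  have := (Ξ.inf_isFaceOf σ.1 σ.2 τ.1 τ.2).1
  rwa [inf_eq_right.2 h] at this

section Rays

variable [Module.Free ℤ N] [Module.Finite ℤ N] {Ξ : Fan N}

theorem Fan.IsSimplicial.rays_spec (hΞ : Ξ.IsSimplicial) (σ : Ξ.cones) :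
    LinearIndepOn ℝ latt (rayGenerators σ.1) ∧
      σ.1 = PointedCone.hull ℝ (latt '' rayGenerators σ.1) := by
  classical
  obtain ⟨s, -, hli, hs⟩ := hΞ σ.1 σ.2
  have hli' : LinearIndepOn ℝ id s := hli
  let b := Module.Basis.extend hli'
  let S : Set _ := {i : hli'.extend (Set.subset_univ s) | (i : ℝ ⊗[ℤ] N) ∈ s}
  have hbS : b '' S = s := by
    ext x
    constructor
    · rintro ⟨i, hi, rfl⟩
      rw [Module.Basis.extend_apply_self]; exact hi
    · intro hx
      exact ⟨⟨x, hli'.subset_extend _ hx⟩, hx, Module.Basis.extend_apply_self _ _⟩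
  have hσ : σ.1 = PointedCone.hull ℝ (b '' S) := by rw [hbS, hs]
  have hray : ∀ v ∈ rayGenerators σ.1, ∃ i ∈ S, ∃ t : ℝ, 0 < t ∧ latt v = t • b i := by
    intro v hv
    refine exists_basis_mem_of_isFaceOf b (by simpa [latt_eq_zero] using hv.1) ?_
    rw [← hσ]; exact hv.2.1
  have hgen : ∀ i ∈ S, ∃ v ∈ rayGenerators σ.1, ∃ t : ℝ, 0 < t ∧ latt v = t • b i := by
    intro i hi
    obtain ⟨F, hF⟩ := Ξ.rational σ.1 σ.2
    have hface : (PointedCone.hull ℝ {b i}).IsFaceOf σ.1 := by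
      rw [hσ, ← Set.image_singleton]
      exact isFaceOf_hull_basis_image b (Set.singleton_subset_iff.2 hi)
    have hbi : b i ∈ σ.1 := hface.le (PointedCone.subset_hull rfl)
    obtain ⟨n, hn, hn0, hnray⟩ : ∃ n : N, latt n ∈ σ.1 ∧ n ≠ 0 ∧
        latt n ∈ PointedCone.hull ℝ {b i} := by
      by_contra! hcon
      have h1 : b i ∈ PointedCone.hull ℝ (latt '' (F : Set N)) := hF ▸ hbi
      obtain ⟨c, hcs, hc0, hcsum⟩ := PointedCone.mem_hull_set.1 h1
      have hz : ∀ y ∈ c.support, y = 0 := by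
        intro y hy
        obtain ⟨n, hnF, rfl⟩ := hcs hy
        have hnσ : latt n ∈ σ.1 := by
          rw [hF]; exact PointedCone.subset_hull ⟨n, hnF, rfl⟩
        by_contra hne
        have hne' : n ≠ 0 := by rintro rfl; exact hne latt_zero
        refine hcon n hnσ hne' (hface.mem_of_smul_add_mem (a := c (latt n))
          (y := (c.support.erase (latt n)).sum fun y => c y • y) hnσ ?_
          (lt_of_le_of_ne (hc0 _) (Ne.symm (Finsupp.mem_support_iff.1 hy))) ?_)
        · refine Submodule.sum_mem _ fun y hy' => PointedCone.smul_mem _ (hc0 _) ?_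
          obtain ⟨n', hn', rfl⟩ := hcs (Finset.mem_of_mem_erase hy')
          rw [hF]; exact PointedCone.subset_hull ⟨n', hn', rfl⟩
        · rw [Finset.add_sum_erase _ (fun y => c y • y) hy]
          have : ∑ y ∈ c.support, c y • y = b i := hcsum
          rw [this]; exact PointedCone.subset_hull rfl
      refine b.ne_zero i ?_
      rw [← hcsum]
      exact Finset.sum_eq_zero fun y hy => by
        change c y • y = 0
        rw [hz y hy, smul_zero]
    obtain ⟨t, ht, hnt⟩ := mem_hull_singleton.1 hnray
    have ht0 : 0 < t := by
      refine lt_of_le_of_ne ht ?_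
      rintro rfl
      rw [zero_smul, latt_eq_zero] at hnt
      exact hn0 hnt
    obtain ⟨u, hu0, ⟨r, hr, hur⟩, hprim⟩ := exists_primitive hn0
    have hub : latt u = (r * t) • b i := by rw [hur, hnt, smul_smul]
    have hrt := mul_pos hr ht0
    refine ⟨u, ⟨hu0, ?_, ?_⟩, r * t, hrt, hub⟩
    · rw [hub, hull_singleton_smul hrt]; exact hface
    · intro u' hu'
      rw [hur, hull_singleton_smul hr] at hu'
      exact hprim u' (mem_hull_singleton.1 hu')
  constructor
  · choose i hiS t ht hvt using fun v : rayGenerators σ.1 => hray v v.2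
    have hinj : Function.Injective i := by
      intro v v' h
      refine Subtype.ext (rayGenerators_eq_of_smul v.2 v'.2 (div_pos (ht v) (ht v')) ?_)
      rw [hvt v, hvt v', h, smul_smul, div_mul_cancel₀ _ (ht v').ne']
    have h1 : LinearIndependent ℝ (fun v : rayGenerators σ.1 => b (i v)) :=
      b.linearIndependent.comp i hinj
    have h2 := h1.units_smul (fun v => Units.mk0 (t v) (ht v).ne')
    unfold LinearIndepOn
    convert h2 using 2 with v
    exact hvt v
  · apply le_antisymm
    · conv_lhs => rw [hσ]
      refine Submodule.span_le.2 ?_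
      rintro _ ⟨i, hi, rfl⟩
      obtain ⟨v, hv, t, ht, hvt⟩ := hgen i hi
      have : b i = t⁻¹ • latt v := by rw [hvt, smul_smul, inv_mul_cancel₀ ht.ne', one_smul]
      rw [SetLike.mem_coe, this]
      exact PointedCone.smul_mem _ (inv_pos.2 ht).le (PointedCone.subset_hull ⟨v, hv, rfl⟩)
    · refine Submodule.span_le.2 ?_
      rintro _ ⟨v, hv, rfl⟩
      exact hv.2.1.le (PointedCone.subset_hull rfl)

theorem exists_chartIndex (hΞ : Ξ.IsSimplicial) (σ : Ξ.cones) : ∃ c : ChartIndex Ξ, c.cone = σ := by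
  classical
  obtain ⟨hli, -⟩ := hΞ.rays_spec σ
  have hli2 : LinearIndepOn ℝ id (latt '' rayGenerators σ.1) := hli.id_image
  obtain ⟨b, hb1, hb2, hb3, hb4⟩ := exists_linearIndepOn_id_extension hli2
    (Set.image_subset_range (latt : N → ℝ ⊗[ℤ] N) (rayGenerators σ.1))
  have hspan : ⊤ ≤ Submodule.span ℝ (Set.range (Subtype.val : b → ℝ ⊗[ℤ] N)) := by
    rw [Subtype.range_coe]
    intro x _
    induction x using TensorProduct.induction_on with
    | zero => simp
    | add a c ha hc => exact add_mem (ha trivial) (hc trivial)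
    | tmul r v =>
      have : r ⊗ₜ[ℤ] v = r • latt v := by simp [latt, TensorProduct.smul_tmul']
      rw [this]
      exact Submodule.smul_mem _ _ (hb3 ⟨v, rfl⟩)
  let B : Module.Basis b ℝ (ℝ ⊗[ℤ] N) := Module.Basis.mk hb4 hspan
  have : Fintype b := FiniteDimensional.fintypeBasisIndex B
  have hcard : Fintype.card b = Module.finrank ℤ N := by
    rw [← Module.finrank_eq_card_basis B, Module.finrank_baseChange]
  let e : b ≃ Fin (Module.finrank ℤ N) := Fintype.equivFinOfCardEq hcard
  choose w hw using fun l => hb1 (e.symm l).2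
  refine ⟨⟨σ, w, B.reindex e, fun l => ?_, ?_⟩, rfl⟩
  · rw [Module.Basis.reindex_apply, hw]
    exact Module.Basis.mk_apply _ _ _
  · intro v hv
    refine ⟨e ⟨latt v, hb2 ⟨v, hv, rfl⟩⟩, latt_injective ?_⟩
    rw [hw, Equiv.symm_apply_apply]

end Rays

end ToricOrbifold

namespace ToricOrbifold

variable {N : Type u} [AddCommGroup N]

theorem rayGenerators_subset_cone {σ : PointedCone ℝ (ℝ ⊗[ℤ] N)} {v : N}
    (hv : v ∈ rayGenerators σ) : latt v ∈ σ :=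
  hv.2.1.le (PointedCone.subset_hull rfl)

namespace ChartIndex

variable {Ξ : Fan N} (c : ChartIndex Ξ)

theorem w_injective : Function.Injective c.w := fun i j h =>
  c.basis.injective (by rw [c.basis_eq, c.basis_eq, h])

theorem repr_w (k l) : c.basis.repr (latt (c.w k)) l = if k = l then 1 else 0 := by
  rw [← c.basis_eq, c.basis.repr_self, Finsupp.single_apply]

theorem sum_repr_smul (x : ℝ ⊗[ℤ] N) : ∑ l, c.basis.repr x l • latt (c.w l) = x := by
  conv_rhs => rw [← c.basis.sum_repr x]
  simp only [c.basis_eq]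

theorem dual_ext {m m' : Module.Dual ℤ N} (h : ∀ l, m (c.w l) = m' (c.w l)) : m = m' := by
  refine LinearMap.ext fun v => ?_
  have h1 := c.sum_mul_repr m v
  have h2 := c.sum_mul_repr m' v
  simp only [h] at h1
  exact_mod_cast h1.symm.trans h2

theorem latt_image_rays :
    latt '' rayGenerators c.cone.1 = c.basis '' {l | c.w l ∈ rayGenerators c.cone.1} := by
  ext x
  constructor
  · rintro ⟨v, hv, rfl⟩
    obtain ⟨l, rfl⟩ := c.rays_subset hv
    exact ⟨l, hv, c.basis_eq l⟩
  · rintro ⟨l, hl, rfl⟩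
    exact ⟨c.w l, hl, (c.basis_eq l).symm⟩

/-- The chart over a face of the cone, with the same lattice basis. -/
def restrict (τ : Ξ.cones) (h : τ.1.IsFaceOf c.cone.1) : ChartIndex Ξ where
  cone := τ
  w := c.w
  basis := c.basis
  basis_eq := c.basis_eq
  rays_subset := by
    rw [rayGenerators_trans h]
    exact fun v hv => c.rays_subset hv.1

theorem linearIndependent_w : LinearIndependent ℤ c.w := by
  have h1 : LinearIndependent ℤ (fun l => latt (c.w l)) := by
    have := c.basis.linearIndependent.restrict_scalars
      (R := ℤ) (by intro a b h; simpa using h)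
    simpa [← c.basis_eq] using this
  exact LinearIndependent.of_comp (TensorProduct.mk ℤ ℝ N 1) h1

variable [Module.Free ℤ N] [Module.Finite ℤ N]

theorem exists_dual_basis : ∃ D : ℕ, 0 < D ∧ ∀ l, ∃ m : Module.Dual ℤ N,
    ∀ k, m (c.w k) = if k = l then (D : ℤ) else 0 := by
  have := c.finite_quotient
  let D := Nat.card (N ⧸ c.sublattice)
  have hD : ∀ v : N, (D : ℤ) • v ∈ c.sublattice := by
    intro v
    rw [← Submodule.Quotient.mk_eq_zero, Submodule.Quotient.mk_smul, natCast_zsmul]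
    exact card_nsmul_eq_zero'
  let B := Module.Basis.span c.linearIndependent_w
  refine ⟨D, Nat.card_pos, fun l => ?_⟩
  let f :=
    LinearMap.codRestrict c.sublattice ((D : ℤ) • LinearMap.id) hD
  refine ⟨B.coord l ∘ₗ f, fun k => ?_⟩
  have : f (c.w k) = (D : ℤ) • B k := by
    apply Subtype.ext
    simp [f, B, Module.Basis.span_apply]
  change B.coord l (f (c.w k)) = _
  rw [this, map_smul, Module.Basis.coord_apply, B.repr_self,
    Finsupp.single_apply]
  simp

section

variable (hΞ : Ξ.IsSimplicial)
include hΞ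

theorem mem_cone_iff {x : ℝ ⊗[ℤ] N} : x ∈ c.cone.1 ↔ ∀ l, 0 ≤ c.basis.repr x l ∧
    (c.w l ∉ rayGenerators c.cone.1 → c.basis.repr x l = 0) := by
  conv_lhs => rw [(hΞ.rays_spec c.cone).2, latt_image_rays, mem_hull_basis_image]
  rfl

theorem mem_dualMonoid_iff {m : Module.Dual ℤ N} : m ∈ dualMonoid c.cone.1 ↔
    ∀ l, c.w l ∈ rayGenerators c.cone.1 → 0 ≤ m (c.w l) := by
  constructor
  · exact fun h l hl => h _ (rayGenerators_subset_cone hl)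
  · intro h v hv
    have hv' := (c.mem_cone_iff hΞ).1 hv
    have : (0 : ℝ) ≤ m v := by
      rw [← c.sum_mul_repr m v]
      refine Finset.sum_nonneg fun l _ => ?_
      by_cases hl : c.w l ∈ rayGenerators c.cone.1
      · exact mul_nonneg (by exact_mod_cast h l hl) (hv' l).1
      · rw [(hv' l).2 hl, mul_zero]
    exact_mod_cast this

theorem exists_face {R : Set N} (hR : R ⊆ rayGenerators c.cone.1) :
    ∃ τ : Ξ.cones, τ.1.IsFaceOf c.cone.1 ∧ rayGenerators τ.1 = R := by
  let T := {l | c.w l ∈ R}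
  have hT : T ⊆ {l | c.w l ∈ rayGenerators c.cone.1} := fun l hl => hR hl
  have hface := isFaceOf_hull_basis_image c.basis hT
  rw [← latt_image_rays, ← (hΞ.rays_spec c.cone).2] at hface
  refine ⟨⟨_, Ξ.face_mem _ c.cone.2 _ hface⟩, hface, ?_⟩
  rw [rayGenerators_trans hface]
  ext v
  constructor
  · rintro ⟨hv, hv'⟩
    obtain ⟨l, rfl⟩ := c.rays_subset hv
    by_contra hl
    have := ((mem_hull_basis_image _ _).1 hv' l).2 hl
    rw [repr_w, if_pos rfl] at this
    exact one_ne_zero this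
  · intro hv
    obtain ⟨l, rfl⟩ := c.rays_subset (hR hv)
    exact ⟨hR hv, PointedCone.subset_hull ⟨l, hv, c.basis_eq l⟩⟩

theorem exists_supporting (τ : Ξ.cones) (h : τ.1.IsFaceOf c.cone.1) :
    ∃ m₀ ∈ dualMonoid c.cone.1, (∀ v, latt v ∈ τ.1 → m₀ v = 0) ∧
      (∀ v, latt v ∈ c.cone.1 → m₀ v = 0 → latt v ∈ τ.1) ∧
      ∀ m ∈ dualMonoid τ.1, ∃ k : ℕ, ∀ k' ≥ k, m + k' • m₀ ∈ dualMonoid c.cone.1 := by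
  classical
  obtain ⟨D, hD, hdual⟩ := c.exists_dual_basis
  choose μ hμ using hdual
  have hτ : ∀ l, (c.restrict τ h).w l = c.w l := fun _ => rfl
  let m₀ : Module.Dual ℤ N := ∑ l with c.w l ∉ rayGenerators τ.1, μ l
  have hm₀ : ∀ k, m₀ (c.w k) = if c.w k ∈ rayGenerators τ.1 then 0 else (D : ℤ) := by
    intro k
    simp only [m₀, LinearMap.sum_apply, hμ, Finset.sum_ite_eq, Finset.mem_filter,
      Finset.mem_univ, true_and]
    split_ifs <;> simp_all
  have hD0 : (0 : ℤ) < D := by exact_mod_cast hD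
  have hm₀mem : m₀ ∈ dualMonoid c.cone.1 := by
    rw [c.mem_dualMonoid_iff hΞ]
    intro l _
    rw [hm₀]
    split_ifs <;> omega
  refine ⟨m₀, hm₀mem, fun v hv => ?_, fun v hv h0 => ?_, fun m hm => ?_⟩
  · have hv' := ((c.restrict τ h).mem_cone_iff hΞ).1 hv
    have : (m₀ v : ℝ) = 0 := by
      rw [← c.sum_mul_repr m₀ v]
      refine Finset.sum_eq_zero fun l _ => ?_
      rw [hm₀]
      split_ifs with hl
      · simp
      · exact mul_eq_zero_of_right _ ((hv' l).2 hl)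
    exact_mod_cast this
  · have hv' := (c.mem_cone_iff hΞ).1 hv
    refine ((c.restrict τ h).mem_cone_iff hΞ).2 fun l => ⟨(hv' l).1, fun hl => ?_⟩
    have hs : ∑ l, (m₀ (c.w l) : ℝ) * c.basis.repr (latt v) l = 0 := by
      rw [c.sum_mul_repr, h0, Int.cast_zero]
    have hnn : ∀ l ∈ Finset.univ, 0 ≤ (m₀ (c.w l) : ℝ) * c.basis.repr (latt v) l := by
      intro l _
      refine mul_nonneg ?_ (hv' l).1
      rw [hm₀]; split_ifs <;> simp
    have := (Finset.sum_eq_zero_iff_of_nonneg hnn).1 hs l (Finset.mem_univ _)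
    rw [hm₀, if_neg (show c.w l ∉ rayGenerators τ.1 from hl)] at this
    exact (mul_eq_zero.1 this).resolve_left (by exact_mod_cast hD0.ne')
  · refine ⟨∑ l, (m (c.w l)).natAbs, fun k' hk' => ?_⟩
    rw [c.mem_dualMonoid_iff hΞ]
    intro l _
    rw [LinearMap.add_apply, LinearMap.smul_apply, hm₀]
    split_ifs with hl
    · simpa using hm _ (rayGenerators_subset_cone hl)
    · have h1 : (m (c.w l)).natAbs ≤ ∑ l, (m (c.w l)).natAbs :=
        Finset.single_le_sum (f := fun l => (m (c.w l)).natAbs) (fun _ _ => Nat.zero_le _)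
          (Finset.mem_univ l)
      have h2 : (m (c.w l)).natAbs ≤ k' := h1.trans hk'
      have h3 : (k' : ℤ) ≤ k' * D := le_mul_of_one_le_right (by omega) (by omega)
      rw [nsmul_eq_mul]
      omega

end

end ChartIndex

theorem Fan.IsSimplicial.cone_eq_of_rays_eq [Module.Free ℤ N] [Module.Finite ℤ N] {Ξ : Fan N}
    (hΞ : Ξ.IsSimplicial) {σ τ : Ξ.cones}
    (h : rayGenerators σ.1 = rayGenerators τ.1) : σ = τ :=
  Subtype.ext (by rw [(hΞ.rays_spec σ).2, (hΞ.rays_spec τ).2, h])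

end ToricOrbifold

namespace ToricOrbifold

variable {N : Type u} [AddCommGroup N]

namespace AffinePoint

variable {σ τ : PointedCone ℝ (ℝ ⊗[ℤ] N)}

theorem eval_add (x : AffinePoint σ) (a b : dualMonoid σ) :
    x.eval (a + b) = x.eval a * x.eval b :=
  MonoidHom.map_mul (show Multiplicative (dualMonoid σ) →* ℂ from x) _ _

theorem eval_zero (x : AffinePoint σ) : x.eval 0 = 1 :=
  MonoidHom.map_one (show Multiplicative (dualMonoid σ) →* ℂ from x)

theorem eval_nsmul (x : AffinePoint σ) (k : ℕ) (a : dualMonoid σ) :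
    x.eval (k • a) = x.eval a ^ k :=
  MonoidHom.map_pow (show Multiplicative (dualMonoid σ) →* ℂ from x) _ _

theorem eval_sum (x : AffinePoint σ) {ι : Type*} (s : Finset ι) (a : ι → dualMonoid σ) :
    x.eval (∑ i ∈ s, a i) = ∏ i ∈ s, x.eval (a i) := by
  classical
  induction s using Finset.induction_on with
  | empty => simp [eval_zero]
  | insert i s hi ih => rw [Finset.sum_insert hi, Finset.prod_insert hi, eval_add, ih]

theorem ext {x y : AffinePoint σ} (h : ∀ m, x.eval m = y.eval m) : x = y :=
  MonoidHom.ext fun m => h m.toAdd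

theorem eval_incl (h : τ ≤ σ) (x : AffinePoint τ) (m : dualMonoid σ) :
    (incl h x).eval m = x.eval ⟨m.1, dualMonoid_anti h m.2⟩ := rfl

theorem continuous_eval (m : dualMonoid σ) : Continuous fun x : AffinePoint σ => x.eval m :=
  (continuous_apply m).comp continuous_induced_dom

instance : T2Space (AffinePoint σ) := by
  have hinj : Function.Injective (AffinePoint.eval : AffinePoint σ → dualMonoid σ → ℂ) :=
    fun x y h => ext fun m => congrFun h m
  exact (Topology.IsEmbedding.mk ⟨rfl⟩ hinj).t2Space

/-- The ray generators of the face of the cone which corresponds to the orbit of a point. -/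
def rays (x : AffinePoint σ) : Set N :=
  {v | v ∈ rayGenerators σ ∧ ∀ m, x.eval m ≠ 0 → m.1 v = 0}

/-- The graph of the monomial functions which are defined at a point. -/
def germs (x : AffinePoint σ) : Set (Module.Dual ℤ N × ℂ) :=
  {p | ∃ m₁ m₂ : dualMonoid σ, p.1 = m₁.1 - m₂.1 ∧ x.eval m₂ ≠ 0 ∧
    p.2 * x.eval m₂ = x.eval m₁}

end AffinePoint

section Glue

variable [Module.Free ℤ N] [Module.Finite ℤ N] {Ξ : Fan N} (hΞ : Ξ.IsSimplicial)
include hΞ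

theorem Fan.IsSimplicial.exists_supporting (σ τ : Ξ.cones) (h : τ.1.IsFaceOf σ.1) :
    ∃ m₀ : dualMonoid σ.1, (∀ v, latt v ∈ τ.1 → m₀.1 v = 0) ∧
      (∀ v, latt v ∈ σ.1 → m₀.1 v = 0 → latt v ∈ τ.1) ∧
      (∀ x : AffinePoint τ.1, x.eval ⟨m₀.1, dualMonoid_anti h.le m₀.2⟩ ≠ 0) ∧
      ∀ m ∈ dualMonoid τ.1, ∃ k : ℕ, ∀ k' ≥ k, m + k' • m₀.1 ∈ dualMonoid σ.1 := by
  obtain ⟨c, rfl⟩ := exists_chartIndex hΞ σ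
  obtain ⟨m₀, h0, h1, h2, h3⟩ := c.exists_supporting hΞ τ h
  refine ⟨⟨m₀, h0⟩, h1, h2, fun x => ?_, h3⟩
  have hneg : -m₀ ∈ dualMonoid τ.1 := fun v hv => by simp [h1 v hv]
  have := x.eval_add ⟨m₀, dualMonoid_anti h.le h0⟩ ⟨-m₀, hneg⟩
  have h4 : (⟨m₀, dualMonoid_anti h.le h0⟩ + ⟨-m₀, hneg⟩ : dualMonoid τ.1) = 0 :=
    Subtype.ext (add_neg_cancel m₀)
  rw [h4, x.eval_zero] at this
  exact left_ne_zero_of_mul_eq_one this.symm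

theorem AffinePoint.rays_incl {σ τ : Ξ.cones} (h : τ.1.IsFaceOf σ.1) (x : AffinePoint τ.1) :
    (incl h.le x).rays = x.rays := by
  obtain ⟨m₀, h1, h2, h3, h4⟩ := hΞ.exists_supporting σ τ h
  have hray := rayGenerators_trans h
  ext v
  constructor
  · rintro ⟨hv, hv'⟩
    have h0 : m₀.1 v = 0 := hv' m₀ (h3 x)
    refine ⟨?_, fun m hm => ?_⟩
    · rw [hray]; exact ⟨hv, h2 v (rayGenerators_subset_cone hv) h0⟩
    · obtain ⟨k, hk⟩ := h4 m.1 m.2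
      have := hv' ⟨_, hk k le_rfl⟩ (by
        rw [eval_incl]
        have heq : (⟨m.1 + k • m₀.1, dualMonoid_anti h.le (hk k le_rfl)⟩ : dualMonoid τ.1) =
            m + k • ⟨m₀.1, dualMonoid_anti h.le m₀.2⟩ := rfl
        rw [heq, eval_add, eval_nsmul]
        exact mul_ne_zero hm (pow_ne_zero _ (h3 x)))
      simpa [h0] using this
  · rintro ⟨hv, hv'⟩
    rw [hray] at hv
    exact ⟨hv.1, fun m hm => hv' _ hm⟩

theorem AffinePoint.germs_incl {σ τ : Ξ.cones} (h : τ.1.IsFaceOf σ.1) (x : AffinePoint τ.1) :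
    (incl h.le x).germs = x.germs := by
  obtain ⟨m₀, h1, h2, h3, h4⟩ := hΞ.exists_supporting σ τ h
  ext ⟨m, t⟩
  constructor
  · rintro ⟨m₁, m₂, hm, hne, heq⟩
    exact ⟨⟨m₁.1, dualMonoid_anti h.le m₁.2⟩, ⟨m₂.1, dualMonoid_anti h.le m₂.2⟩, hm, hne, heq⟩
  · rintro ⟨m₁, m₂, hm, hne, heq⟩
    obtain ⟨k₁, hk₁⟩ := h4 m₁.1 m₁.2
    obtain ⟨k₂, hk₂⟩ := h4 m₂.1 m₂.2
    have hk₁' := hk₁ (max k₁ k₂) (le_max_left _ _)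
    have hk₂' := hk₂ (max k₁ k₂) (le_max_right _ _)
    have e : ∀ (m : dualMonoid τ.1) (hm : m.1 + max k₁ k₂ • m₀.1 ∈ dualMonoid σ.1),
        (incl h.le x).eval ⟨_, hm⟩ =
          x.eval m * x.eval ⟨m₀.1, dualMonoid_anti h.le m₀.2⟩ ^ max k₁ k₂ := by
      intro m hm
      rw [eval_incl, ← eval_nsmul, ← eval_add]
      rfl
    refine ⟨⟨_, hk₁'⟩, ⟨_, hk₂'⟩, ?_, ?_, ?_⟩
    · rw [hm]; simp
    · rw [e]; exact mul_ne_zero hne (pow_ne_zero _ (h3 x))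
    · rw [e, e, ← heq, mul_assoc]

theorem ToricVariety.rays_eq_of_mk_eq {σ τ : Ξ.cones} {x : AffinePoint σ.1} {y : AffinePoint τ.1}
    (h : ToricVariety.mk σ x = ToricVariety.mk τ y) : x.rays = y.rays := by
  let f : ToricVariety Ξ → Set N := Quot.lift (fun p => p.2.rays) (by
    rintro p q ⟨hf, he⟩
    rw [← he, AffinePoint.rays_incl hΞ hf])
  exact congrArg f h

theorem ToricVariety.germs_eq_of_mk_eq {σ τ : Ξ.cones} {x : AffinePoint σ.1} {y : AffinePoint τ.1}
    (h : ToricVariety.mk σ x = ToricVariety.mk τ y) : x.germs = y.germs := by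
  let f : ToricVariety Ξ → Set (Module.Dual ℤ N × ℂ) := Quot.lift (fun p => p.2.germs) (by
    rintro p q ⟨hf, he⟩
    rw [← he, AffinePoint.germs_incl hΞ hf])
  exact congrArg f h

end Glue

theorem AffinePoint.eval_eq_of_germs_eq {σ τ : PointedCone ℝ (ℝ ⊗[ℤ] N)} {x : AffinePoint σ}
    {y : AffinePoint τ} (h : x.germs = y.germs) {m : Module.Dual ℤ N} (hm : m ∈ dualMonoid σ)
    (hm' : m ∈ dualMonoid τ) : x.eval ⟨m, hm⟩ = y.eval ⟨m, hm'⟩ := by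
  have h1 : (m, x.eval ⟨m, hm⟩) ∈ x.germs :=
    ⟨⟨m, hm⟩, 0, by simp, by simp [eval_zero], by simp [eval_zero]⟩
  rw [h] at h1
  obtain ⟨m₁, m₂, e1, e2, e3⟩ := h1
  have h2 : m₁ = ⟨m, hm'⟩ + m₂ := Subtype.ext (by
    rw [AddSubmonoid.coe_add]
    exact (sub_eq_iff_eq_add.1 e1.symm))
  rw [h2, eval_add] at e3
  exact mul_right_cancel₀ e2 e3

namespace ChartIndex

variable {Ξ : Fan N} (c d : ChartIndex Ξ)

/-- The ray generators that belong to vanishing coordinates. -/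
def zeros (z : Fin (Module.finrank ℤ N) → ℂ) : Set N := {v | ∃ l, c.w l = v ∧ z l = 0}

/-- The Laurent monomial of exponent `m`. -/
noncomputable def val (z : Fin (Module.finrank ℤ N) → ℂ) (m : Module.Dual ℤ N) : ℂ :=
  ∏ l, z l ^ (m (c.w l))

variable {c} {z : Fin (Module.finrank ℤ N) → ℂ}

theorem w_mem_zeros {l} : c.w l ∈ c.zeros z ↔ z l = 0 := by
  constructor
  · rintro ⟨k, hk, h⟩
    rwa [c.w_injective hk] at h
  · exact fun h => ⟨l, rfl, h⟩

theorem zeros_subset (hz : z ∈ c.dom) : c.zeros z ⊆ rayGenerators c.cone.1 := by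
  rintro _ ⟨l, rfl, h⟩
  by_contra hl
  exact hz l hl h

theorem mem_dom_iff : z ∈ c.dom ↔ c.zeros z ⊆ rayGenerators c.cone.1 := by
  refine ⟨zeros_subset, fun h l hl h0 => hl (h (w_mem_zeros.2 h0))⟩

theorem val_ne_zero_iff {m : Module.Dual ℤ N} :
    c.val z m ≠ 0 ↔ ∀ v ∈ c.zeros z, m v = 0 := by
  rw [val, Finset.prod_ne_zero_iff]
  constructor
  · rintro h _ ⟨l, rfl, h0⟩
    by_contra hm
    exact h l (Finset.mem_univ l) (by rw [h0, zero_zpow _ hm])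
  · intro h l _
    by_cases h0 : z l = 0
    · rw [h _ ⟨l, rfl, h0⟩, zpow_zero]; exact one_ne_zero
    · exact zpow_ne_zero _ h0

theorem val_add {m m' : Module.Dual ℤ N}
    (h : ∀ v ∈ c.zeros z, (0 ≤ m v ∧ 0 ≤ m' v) ∨ m' v = 0) :
    c.val z (m + m') = c.val z m * c.val z m' := by
  rw [val, val, val, ← Finset.prod_mul_distrib]
  refine Finset.prod_congr rfl fun l _ => ?_
  by_cases h0 : z l = 0
  · rcases h _ ⟨l, rfl, h0⟩ with ⟨h1, h2⟩ | h2
    · rw [LinearMap.add_apply, h0]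
      rcases h1.eq_or_lt with h1 | h1
      · simp [← h1]
      · rw [zero_zpow _ (by omega), zero_zpow _ (by omega), zero_mul]
    · simp [h2]
  · rw [LinearMap.add_apply, zpow_add₀ h0]

theorem eval_monomial_eq_val (hz : z ∈ c.dom) (m : dualMonoid c.cone.1) :
    (c.monomial ⟨z, hz⟩).eval m = c.val z m.1 := rfl

theorem mk_monomial_restrict (τ : Ξ.cones) (h : τ.1.IsFaceOf c.cone.1) (hz : z ∈ c.dom)
    (hz' : z ∈ (c.restrict τ h).dom) :
    ToricVariety.mk τ ((c.restrict τ h).monomial ⟨z, hz'⟩) =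
      ToricVariety.mk c.cone (c.monomial ⟨z, hz⟩) :=
  Quot.sound ⟨h, rfl⟩

variable [Module.Free ℤ N] [Module.Finite ℤ N]

theorem exists_dualMonoid_separating (hΞ : Ξ.IsSimplicial) (hz : z ∈ c.dom) :
    ∃ m ∈ dualMonoid c.cone.1, (∀ v ∈ c.zeros z, m v = 0) ∧
      (∀ v ∈ rayGenerators c.cone.1, m v = 0 → v ∈ c.zeros z) ∧
      ∀ m' : Module.Dual ℤ N, (∀ v ∈ c.zeros z, 0 ≤ m' v) →
        ∃ k : ℕ, m' + k • m ∈ dualMonoid c.cone.1 := by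
  obtain ⟨τ, hτ, hR⟩ := c.exists_face hΞ (zeros_subset hz)
  obtain ⟨m₀, h1, h2, h3, h4⟩ := c.exists_supporting hΞ τ hτ
  refine ⟨m₀, h1, fun v hv => ?_, fun v hv h0 => ?_, fun m' hm' => ?_⟩
  · rw [← hR] at hv
    exact h2 v (rayGenerators_subset_cone hv)
  · rw [← hR, rayGenerators_trans hτ]
    exact ⟨hv, h3 v (rayGenerators_subset_cone hv) h0⟩
  · obtain ⟨k, hk⟩ := h4 m' (by
      have := (c.restrict τ hτ).mem_dualMonoid_iff hΞ (m := m')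
      refine this.2 fun l hl => hm' _ ?_
      rw [← hR]; exact hl)
    exact ⟨k, hk k le_rfl⟩

theorem rays_monomial (hΞ : Ξ.IsSimplicial) (hz : z ∈ c.dom) :
    (c.monomial ⟨z, hz⟩).rays = c.zeros z := by
  ext v
  constructor
  · rintro ⟨hv, hv'⟩
    obtain ⟨m, hm, h1, h2, -⟩ := exists_dualMonoid_separating hΞ hz
    exact h2 v hv (hv' ⟨m, hm⟩ (val_ne_zero_iff.2 h1))
  · intro hv
    exact ⟨zeros_subset hz hv, fun m hm => val_ne_zero_iff.1 hm v hv⟩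

theorem germs_monomial (hΞ : Ξ.IsSimplicial) (hz : z ∈ c.dom) :
    (c.monomial ⟨z, hz⟩).germs =
      {p | (∀ v ∈ c.zeros z, 0 ≤ p.1 v) ∧ p.2 = c.val z p.1} := by
  ext ⟨m, t⟩
  constructor
  · rintro ⟨m₁, m₂, e1, e2, e3⟩
    simp only [eval_monomial_eq_val] at e1 e2 e3
    have h2 := val_ne_zero_iff.1 e2
    have hm : ∀ v ∈ c.zeros z, 0 ≤ m v := by
      intro v hv
      rw [e1, LinearMap.sub_apply, h2 v hv, sub_zero]
      exact m₁.2 v (rayGenerators_subset_cone (zeros_subset hz hv))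
    refine ⟨hm, ?_⟩
    have h3 : m₁.1 = m + m₂.1 := by rw [e1, sub_add_cancel]
    rw [h3, val_add fun v hv => Or.inr (h2 v hv)] at e3
    exact mul_right_cancel₀ e2 e3
  · rintro ⟨hm, ht⟩
    simp only at hm ht
    subst ht
    obtain ⟨m₀, hm₀, h1, -, h3⟩ := exists_dualMonoid_separating hΞ hz
    obtain ⟨k, hk⟩ := h3 m hm
    have h0 : ∀ v ∈ c.zeros z, (k • m₀) v = 0 := fun v hv => by simp [h1 v hv]
    refine ⟨⟨_, hk⟩, ⟨_, AddSubmonoid.nsmul_mem _ hm₀ k⟩, by simp, ?_, ?_⟩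
    · exact val_ne_zero_iff.2 h0
    · exact (val_add fun v hv => Or.inr (h0 v hv)).symm

/-- Two points of charts define the same point of the toric variety if and only if the same
coordinates vanish and all Laurent monomials which are defined there agree. -/
theorem mk_monomial_eq_iff (hΞ : Ξ.IsSimplicial) {d : ChartIndex Ξ}
    {y : Fin (Module.finrank ℤ N) → ℂ} (hz : z ∈ c.dom) (hy : y ∈ d.dom) :
    ToricVariety.mk c.cone (c.monomial ⟨z, hz⟩) = ToricVariety.mk d.cone (d.monomial ⟨y, hy⟩) ↔
      c.zeros z = d.zeros y ∧
        ∀ m : Module.Dual ℤ N, (∀ v ∈ c.zeros z, 0 ≤ m v) → c.val z m = d.val y m := by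
  constructor
  · intro h
    have h1 := ToricVariety.rays_eq_of_mk_eq hΞ h
    have h2 := ToricVariety.germs_eq_of_mk_eq hΞ h
    rw [rays_monomial hΞ, rays_monomial hΞ] at h1
    rw [germs_monomial hΞ, germs_monomial hΞ] at h2
    refine ⟨h1, fun m hm => ?_⟩
    exact (h2 ▸ (⟨hm, rfl⟩ : (m, c.val z m) ∈ {p : Module.Dual ℤ N × ℂ |
      (∀ v ∈ c.zeros z, 0 ≤ p.1 v) ∧ p.2 = c.val z p.1}) :
      (m, c.val z m) ∈ {p : Module.Dual ℤ N × ℂ |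
        (∀ v ∈ d.zeros y, 0 ≤ p.1 v) ∧ p.2 = d.val y p.1}).2
  · rintro ⟨h1, h2⟩
    obtain ⟨τ, hτ, hR⟩ := c.exists_face hΞ (zeros_subset hz)
    obtain ⟨τ', hτ', hR'⟩ := d.exists_face hΞ (zeros_subset hy)
    have : τ = τ' := hΞ.cone_eq_of_rays_eq (by rw [hR, hR', h1])
    subst this
    have hz' : z ∈ (c.restrict τ hτ).dom := mem_dom_iff.2 (by
      change c.zeros z ⊆ rayGenerators τ.1; rw [hR])
    have hy' : y ∈ (d.restrict τ hτ').dom := mem_dom_iff.2 (by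
      change d.zeros y ⊆ rayGenerators τ.1; rw [hR'])
    rw [← mk_monomial_restrict τ hτ hz hz', ← mk_monomial_restrict τ hτ' hy hy']
    congr 1
    refine AffinePoint.ext fun m => h2 m.1 fun v hv => ?_
    rw [← hR] at hv
    exact m.2 v (rayGenerators_subset_cone hv)

end ChartIndex

end ToricOrbifold

namespace ToricOrbifold

section Extension

noncomputable instance : DivisibleBy (Additive ℂˣ) ℤ :=
  divisibleByOfSMulRightSurj _ _ (by
    intro n hn x
    obtain ⟨k, rfl | rfl⟩ := Int.eq_nat_or_neg n
    · have hk : k ≠ 0 := by simpa using hn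
      obtain ⟨z, hz⟩ := IsAlgClosed.exists_pow_nat_eq (x.toMul : ℂ) (Nat.pos_of_ne_zero hk)
      have hz0 : z ≠ 0 := by
        rintro rfl
        rw [zero_pow hk] at hz
        exact x.toMul.ne_zero hz.symm
      refine ⟨Additive.ofMul (Units.mk0 z hz0), ?_⟩
      simp only [natCast_zsmul, ← ofMul_pow]
      exact congrArg Additive.ofMul (Units.ext hz)
    · have hk : k ≠ 0 := by simpa using hn
      obtain ⟨z, hz⟩ := IsAlgClosed.exists_pow_nat_eq ((x.toMul⁻¹ : ℂˣ) : ℂ) (Nat.pos_of_ne_zero hk)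
      have hz0 : z ≠ 0 := by
        rintro rfl
        rw [zero_pow hk] at hz
        exact (x.toMul⁻¹).ne_zero hz.symm
      refine ⟨Additive.ofMul (Units.mk0 z hz0), ?_⟩
      simp only [natCast_zsmul, ← ofMul_pow, neg_smul, ← ofMul_inv]
      have : (Units.mk0 z hz0) ^ k = x.toMul⁻¹ := Units.ext hz
      rw [this, inv_inv]
      rfl)

/-- A `ℂˣ`-valued character of a subgroup is given by a Laurent monomial as soon as it is trivial
on the kernel of the exponent map. -/
theorem exists_prod_zpow_eq {M ι : Type*} [AddCommGroup M] [Fintype ι] (e : M →+ (ι → ℤ))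
    (H : AddSubgroup M) (f : H → ℂ) (h0 : f 0 = 1) (hadd : ∀ a b, f (a + b) = f a * f b)
    (hker : ∀ m : H, e m = 0 → f m = 1) :
    ∃ z : ι → ℂ, (∀ l, z l ≠ 0) ∧ ∀ m : H, f m = ∏ l, z l ^ e m l := by
  classical
  let F : Multiplicative H →* ℂ :=
    { toFun := fun m => f m.toAdd
      map_one' := h0
      map_mul' := fun a b => hadd _ _ }
  let F' : H →+ Additive ℂˣ := MonoidHom.toAdditiveRight F.toHomUnits
  have hF' : ∀ m, ((F' m).toMul : ℂ) = f m := fun m => rfl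
  let g : H →+ (ι → ℤ) := e.comp H.subtype
  have hle : g.rangeRestrict.ker ≤ F'.ker := by
    intro m hm
    rw [AddMonoidHom.ker_rangeRestrict, AddMonoidHom.mem_ker] at hm
    rw [AddMonoidHom.mem_ker]
    have : (F' m).toMul = 1 := Units.ext ((hF' m).trans (hker m hm))
    exact this
  let φ : g.range →+ Additive ℂˣ :=
    g.rangeRestrict.liftOfSurjective g.rangeRestrict_surjective ⟨F', hle⟩
  have hφ : ∀ m : H, φ (g.rangeRestrict m) = F' m := fun m =>
    AddMonoidHom.liftOfRightInverse_comp_apply _ _ _ ⟨F', hle⟩ m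
  obtain ⟨Φ, hΦ⟩ := (Module.Baer.of_divisible (Additive ℂˣ)).extension_property_addMonoidHom
    g.range.subtype Subtype.val_injective φ
  refine ⟨fun l => ((Φ (Pi.single l 1)).toMul : ℂ), fun l => Units.ne_zero _, fun m => ?_⟩
  have h1 : Φ (e m) = F' m := by
    rw [← hφ, ← hΦ]; rfl
  have h2 : Φ (e m) = ∑ l, e m l • Φ (Pi.single l 1) := by
    conv_lhs => rw [← Finset.univ_sum_single (e m)]
    rw [map_sum]
    refine Finset.sum_congr rfl fun l _ => ?_
    rw [← map_zsmul, ← Pi.single_smul, smul_eq_mul, mul_one]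
  rw [← hF', ← h1, h2, toMul_sum, Units.coe_prod]
  simp

end Extension

theorem isProperMap_pow {D : ℕ} (hD : 0 < D) : IsProperMap fun z : ℂ => z ^ D := by
  rw [isProperMap_iff_tendsto_cocompact]
  refine ⟨continuous_pow D, ?_⟩
  rw [← Metric.cobounded_eq_cocompact, ← comap_norm_atTop (E := ℂ), Filter.tendsto_comap_iff]
  have : (norm ∘ fun z : ℂ => z ^ D) = (fun r : ℝ => r ^ D) ∘ norm := by ext z; simp
  rw [this]
  exact (Filter.tendsto_pow_atTop hD.ne').comp Filter.tendsto_comap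

variable {N : Type u} [AddCommGroup N]

namespace ChartIndex

variable {Ξ : Fan N} (c : ChartIndex Ξ)

/-- The exponents of a character with respect to the lattice basis of a chart. -/
def exponents : Module.Dual ℤ N →+ (Fin (Module.finrank ℤ N) → ℤ) where
  toFun m l := m (c.w l)
  map_zero' := rfl
  map_add' _ _ := rfl

variable [Module.Free ℤ N] [Module.Finite ℤ N]

theorem eval_dual_basis_ne_zero (hΞ : Ξ.IsSimplicial) (x : AffinePoint c.cone.1) {D : ℕ}
    {μ : Module.Dual ℤ N} {l}
    (hμ : ∀ k, μ (c.w k) = if k = l then (D : ℤ) else 0) (hm : μ ∈ dualMonoid c.cone.1)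
    (hl : c.w l ∉ rayGenerators c.cone.1) : x.eval ⟨μ, hm⟩ ≠ 0 := by
  have hneg : -μ ∈ dualMonoid c.cone.1 := by
    rw [c.mem_dualMonoid_iff hΞ]
    intro k hk
    rw [LinearMap.neg_apply, hμ, if_neg (by rintro rfl; exact hl hk), neg_zero]
  have h4 : (⟨μ, hm⟩ + ⟨-μ, hneg⟩ : dualMonoid c.cone.1) = 0 := Subtype.ext (add_neg_cancel μ)
  have := x.eval_add ⟨μ, hm⟩ ⟨-μ, hneg⟩
  rw [h4, x.eval_zero] at this
  exact left_ne_zero_of_mul_eq_one this.symm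

theorem dual_basis_mem (hΞ : Ξ.IsSimplicial) {D : ℕ} {μ : Module.Dual ℤ N} {l}
    (hμ : ∀ k, μ (c.w k) = if k = l then (D : ℤ) else 0) : μ ∈ dualMonoid c.cone.1 := by
  rw [c.mem_dualMonoid_iff hΞ]
  intro k _
  rw [hμ]; split_ifs <;> simp

theorem isProperMap_monomial (hΞ : Ξ.IsSimplicial) : IsProperMap c.monomial := by
  obtain ⟨D, hD, hdual⟩ := c.exists_dual_basis
  choose μ hμ using hdual
  have hmem := fun l => c.dual_basis_mem hΞ (hμ l)
  let P : AffinePoint c.cone.1 → c.dom := fun x =>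
    ⟨fun l => x.eval ⟨μ l, hmem l⟩, fun l hl => c.eval_dual_basis_ne_zero hΞ x (hμ l) _ hl⟩
  have hP : Continuous P :=
    Continuous.subtype_mk (continuous_pi fun l => AffinePoint.continuous_eval _) _
  refine isProperMap_of_comp_of_t2 c.continuous_monomial hP ?_
  let pw : (Fin (Module.finrank ℤ N) → ℂ) → (Fin (Module.finrank ℤ N) → ℂ) := fun z l => z l ^ D
  have hpw : IsProperMap pw := IsProperMap.pi_map fun _ => isProperMap_pow hD
  have hpre : pw ⁻¹' c.dom = c.dom := by
    ext z
    simp only [Set.mem_preimage, dom, pw, Set.mem_ofPred_eq]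
    refine forall₂_congr fun l _ => ?_
    rw [ne_eq, pow_eq_zero_iff hD.ne']
  have h2 := (hpw.restrictPreimage c.dom).comp (Homeomorph.setCongr hpre.symm).isProperMap
  convert h2 using 1
  ext z l
  change (c.monomial z).eval ⟨μ l, _⟩ = z.1 l ^ D
  rw [eval_monomial, Finset.prod_eq_single l]
  · simp [hμ]
  · intro k _ hk
    simp [hμ, hk]
  · simp

theorem monomial_surjective (hΞ : Ξ.IsSimplicial) : Function.Surjective c.monomial := by
  classical
  intro x
  obtain ⟨D, hD, hdual⟩ := c.exists_dual_basis
  choose μ hμ using hdual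
  have hmem := fun l => c.dual_basis_mem hΞ (hμ l)
  have hne := fun l => c.eval_dual_basis_ne_zero hΞ x (hμ l) (hmem l)
  let X : Fin (Module.finrank ℤ N) → ℂ := fun l => x.eval ⟨μ l, hmem l⟩
  have hD0 : (0 : ℤ) < D := by exact_mod_cast hD
  have hZ : ∀ l, X l = 0 → c.w l ∈ rayGenerators c.cone.1 := fun l h => by
    by_contra hl; exact hne l hl h
  have key : ∀ m : dualMonoid c.cone.1, x.eval m ^ D * ∏ l, X l ^ (-(m.1 (c.w l))).toNat =
      ∏ l, X l ^ (m.1 (c.w l)).toNat := by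
    intro m
    simp only [X, ← AffinePoint.eval_nsmul, ← AffinePoint.eval_sum, ← AffinePoint.eval_add]
    congr 1
    refine Subtype.ext (c.dual_ext fun k => ?_)
    simp only [AddSubmonoid.coe_add, AddSubmonoidClass.coe_nsmul, AddSubmonoid.coe_finsetSum,
      LinearMap.add_apply, LinearMap.smul_apply, LinearMap.sum_apply, hμ, nsmul_eq_mul,
      mul_ite, mul_zero, Finset.sum_ite_eq, Finset.mem_univ, if_true]
    rcases le_total 0 (m.1 (c.w k)) with h | h
    · rw [Int.toNat_of_nonneg h, Int.toNat_of_nonpos (by omega)]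
      simp [mul_comm]
    · rw [Int.toNat_of_nonpos h, Int.toNat_of_nonneg (by omega)]
      ring
  have hiff : ∀ m : dualMonoid c.cone.1, x.eval m ≠ 0 ↔ ∀ l, X l = 0 → m.1 (c.w l) = 0 := by
    intro m
    have hnn : ∀ l, X l = 0 → 0 ≤ m.1 (c.w l) := fun l h =>
      m.2 _ (rayGenerators_subset_cone (hZ l h))
    have hb : ∏ l, X l ^ (-(m.1 (c.w l))).toNat ≠ 0 := by
      refine Finset.prod_ne_zero_iff.2 fun l _ => ?_
      by_cases h : X l = 0
      · rw [Int.toNat_of_nonpos (by have := hnn l h; omega), pow_zero]; exact one_ne_zero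
      · exact pow_ne_zero _ h
    constructor
    · intro h l hl
      have h1 : ∏ l, X l ^ (m.1 (c.w l)).toNat ≠ 0 := by
        rw [← key]; exact mul_ne_zero (pow_ne_zero _ h) hb
      have h2 := Finset.prod_ne_zero_iff.1 h1 l (Finset.mem_univ l)
      by_contra h3
      have := hnn l hl
      exact h2 (by rw [hl, zero_pow (by omega)])
    · intro h hx
      have h1 := key m
      rw [hx, zero_pow hD.ne', zero_mul] at h1
      refine Finset.prod_ne_zero_iff.2 (fun l _ => ?_) h1.symm
      by_cases hl : X l = 0
      · rw [h l hl]; simp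
      · exact pow_ne_zero _ hl
  let H : AddSubgroup (Module.Dual ℤ N) :=
    { carrier := {m | ∀ l, X l = 0 → m (c.w l) = 0}
      zero_mem' := fun _ _ => rfl
      add_mem' := fun ha hb l hl => by rw [LinearMap.add_apply, ha l hl, hb l hl, add_zero]
      neg_mem' := fun ha l hl => by rw [LinearMap.neg_apply, ha l hl, neg_zero] }
  let M₀ : dualMonoid c.cone.1 := ∑ l with X l ≠ 0, ⟨μ l, hmem l⟩
  have hM₀ : ∀ k, M₀.1 (c.w k) = if X k = 0 then 0 else (D : ℤ) := by
    intro k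
    simp only [M₀, AddSubmonoid.coe_finsetSum, LinearMap.sum_apply, hμ, Finset.sum_ite_eq,
      Finset.mem_filter, Finset.mem_univ, true_and]
    split_ifs <;> simp_all
  have hxM₀ : x.eval M₀ ≠ 0 := (hiff M₀).2 fun l hl => by rw [hM₀, if_pos hl]
  have hk : ∀ m : H, ∃ k : ℕ, m.1 + k • M₀.1 ∈ dualMonoid c.cone.1 := by
    intro m
    refine ⟨∑ l, (m.1 (c.w l)).natAbs, ?_⟩
    rw [c.mem_dualMonoid_iff hΞ]
    intro l _
    rw [LinearMap.add_apply, LinearMap.smul_apply, hM₀]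
    split_ifs with hl
    · rw [m.2 l hl]; simp
    · have h1 : (m.1 (c.w l)).natAbs ≤ ∑ l, (m.1 (c.w l)).natAbs :=
        Finset.single_le_sum (f := fun l => (m.1 (c.w l)).natAbs) (fun _ _ => Nat.zero_le _)
          (Finset.mem_univ l)
      set K := ∑ l, (m.1 (c.w l)).natAbs
      have h3 : (K : ℤ) ≤ K * D := le_mul_of_one_le_right (by omega) (by omega)
      rw [nsmul_eq_mul]
      omega
  have hf : ∀ m : H, ∃ t : ℂ, ∀ (k : ℕ) (hk : m.1 + k • M₀.1 ∈ dualMonoid c.cone.1),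
      x.eval ⟨_, hk⟩ = t * x.eval M₀ ^ k := by
    intro m
    obtain ⟨k₀, hk₀⟩ := hk m
    refine ⟨x.eval ⟨_, hk₀⟩ / x.eval M₀ ^ k₀, fun k hk => ?_⟩
    rw [div_mul_eq_mul_div, eq_div_iff (pow_ne_zero _ hxM₀), ← AffinePoint.eval_nsmul,
      ← AffinePoint.eval_nsmul, ← AffinePoint.eval_add, ← AffinePoint.eval_add]
    congr 1
    refine Subtype.ext ?_
    simp only [AddSubmonoid.coe_add, AddSubmonoidClass.coe_nsmul]
    abel
  choose f hf using hf
  have hfx : ∀ (m : dualMonoid c.cone.1) (hm : m.1 ∈ H), f ⟨m.1, hm⟩ = x.eval m := by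
    intro m hm
    have := hf ⟨m.1, hm⟩ 0 (by simp [m.2])
    rw [pow_zero, mul_one] at this
    rw [← this]
    congr 1
    exact Subtype.ext (by simp)
  have hadd : ∀ a b, f (a + b) = f a * f b := by
    intro a b
    obtain ⟨k, hka⟩ := hk a
    obtain ⟨l, hlb⟩ := hk b
    have h1 := hf a k hka
    have h2 := hf b l hlb
    have hs : (a + b).1 + (k + l) • M₀.1 = (a.1 + k • M₀.1) + (b.1 + l • M₀.1) := by
      rw [add_smul, AddSubgroup.coe_add]; abel
    have h3 := hf (a + b) (k + l) (by rw [hs]; exact add_mem hka hlb)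
    have h4 : x.eval ⟨(a + b).1 + (k + l) • M₀.1, by rw [hs]; exact add_mem hka hlb⟩ =
        x.eval ⟨_, hka⟩ * x.eval ⟨_, hlb⟩ := by
      rw [← AffinePoint.eval_add]
      congr 1
      exact Subtype.ext hs
    rw [h4, h1, h2, pow_add] at h3
    have hne2 := mul_ne_zero (pow_ne_zero k hxM₀) (pow_ne_zero l hxM₀)
    refine mul_right_cancel₀ hne2 ?_
    rw [← h3]; ring
  have h0 : f 0 = 1 := by
    have := hfx 0 H.zero_mem
    rw [AffinePoint.eval_zero] at this
    exact this
  obtain ⟨z, hz0, hz⟩ := exists_prod_zpow_eq c.exponents H f h0 hadd (by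
    intro m hm
    have : m = 0 := Subtype.ext (c.dual_ext fun l => congrFun hm l)
    rw [this, h0])
  let z' : Fin (Module.finrank ℤ N) → ℂ := fun l => if X l = 0 then 0 else z l
  have hz' : z' ∈ c.dom := by
    intro l hl
    have : X l ≠ 0 := hne l hl
    simp only [z', if_neg this]
    exact hz0 l
  refine ⟨⟨z', hz'⟩, AffinePoint.ext fun m => ?_⟩
  rw [eval_monomial]
  by_cases hm : ∀ l, X l = 0 → m.1 (c.w l) = 0
  · rw [← hfx m hm, hz]
    refine Finset.prod_congr rfl fun l _ => ?_
    change z' l ^ _ = z l ^ (m.1 (c.w l))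
    by_cases hl : X l = 0
    · rw [hm l hl, zpow_zero, zpow_zero]
    · simp only [z', if_neg hl]
  · have h1 : x.eval m = 0 := by
      by_contra h; exact hm ((hiff m).1 h)
    rw [h1]
    push Not at hm
    obtain ⟨l, hl, hml⟩ := hm
    refine Finset.prod_eq_zero (Finset.mem_univ l) ?_
    simp only [z', if_pos hl]
    exact zero_zpow _ hml

end ChartIndex

theorem ToricVariety.mk_injective [Module.Free ℤ N] [Module.Finite ℤ N] {Ξ : Fan N}
    (hΞ : Ξ.IsSimplicial) (σ : Ξ.cones) :
    Function.Injective (ToricVariety.mk (Ξ := Ξ) σ) := fun _ _ h =>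
  AffinePoint.ext fun m =>
    AffinePoint.eval_eq_of_germs_eq (ToricVariety.germs_eq_of_mk_eq hΞ h) m.2 m.2

end ToricOrbifold

namespace ToricOrbifold

section Transition

variable {ι : Type*}

open Classical in
/-- The logarithms of the coordinates relative to the non-zero coordinates of a base point. -/
noncomputable def logCoord (x z : ι → ℂ) (k : ι) : ℂ :=
  if x k = 0 then 0 else Complex.log (z k / x k)

open Classical in
/-- The exponential of the logarithms is one on the vanishing coordinates of the base point. -/
noncomputable def expWeight (x z : ι → ℂ) (k : ι) : ℂ := if x k = 0 then 1 else z k / x k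

theorem exp_logCoord {x z : ι → ℂ} {k : ι} (h : x k ≠ 0 → z k ≠ 0) :
    Complex.exp (logCoord x z k) = expWeight x z k := by
  unfold logCoord expWeight
  split_ifs with hx
  · exact Complex.exp_zero
  · exact Complex.exp_log (div_ne_zero (h hx) hx)

theorem logCoord_mul {x ζ : ι → ℂ} (hζ : ∀ k, x k ≠ 0 → ζ k = 1) (z : ι → ℂ) :
    logCoord x (ζ * z) = logCoord x z := by
  ext k
  unfold logCoord
  split_ifs with h
  · rfl
  · rw [Pi.mul_apply, hζ k h, one_mul]

variable [Fintype ι]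

/-- The linear combinations of the logarithms with coefficients in a real matrix. -/
noncomputable def logComb (x : ι → ℂ) (B : ι → ι → ℝ) (z : ι → ℂ) (l : ι) : ℂ :=
  ∑ k, (B l k : ℂ) * logCoord x z k

open Classical in
/-- A local map which sends `x` to `y` and is monomial with exponents `B`: the coordinates that
vanish at `y` are those that vanish at `x`, matched by `e` and rescaled by `C`. -/
noncomputable def transition (x y : ι → ℂ) (B : ι → ι → ℝ) (e : ι → ι) (C : ι → ℂ)
    (z : ι → ℂ) (l : ι) : ℂ :=
  (if y l = 0 then C l * z (e l) else y l) * Complex.exp (logComb x B z l)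

/-- A neighbourhood of `x` on which `transition` is invertible. -/
def transitionDom (x y : ι → ℂ) (B : ι → ι → ℝ) : Set (ι → ℂ) :=
  {z | (∀ k, x k ≠ 0 → z k / x k ∈ Complex.slitPlane) ∧
    ∀ l, y l ≠ 0 → (logComb x B z l).im ∈ Set.Ioo (-Real.pi) Real.pi}

theorem ne_zero_of_mem_transitionDom {x y : ι → ℂ} {B : ι → ι → ℝ} {z : ι → ℂ}
    (hz : z ∈ transitionDom x y B) {k : ι} (hk : x k ≠ 0) : z k ≠ 0 := by
  intro h
  have := hz.1 k hk
  rw [h, zero_div] at this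
  exact Complex.slitPlane_ne_zero this rfl

theorem logComb_self (x : ι → ℂ) (B : ι → ι → ℝ) : logComb x B x = 0 := by
  ext l
  refine Finset.sum_eq_zero fun k _ => ?_
  unfold logCoord
  split_ifs with h
  · simp
  · rw [div_self h]; simp

theorem self_mem_transitionDom (x y : ι → ℂ) (B : ι → ι → ℝ) : x ∈ transitionDom x y B := by
  refine ⟨fun k hk => by rw [div_self hk]; exact Complex.one_mem_slitPlane, fun l _ => ?_⟩
  rw [logComb_self]
  simp [Real.pi_pos]

theorem transition_self {x y : ι → ℂ} {B : ι → ι → ℝ} {e : ι → ι} {C : ι → ℂ}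
    (he : ∀ l, y l = 0 → x (e l) = 0) : transition x y B e C x = y := by
  ext l
  rw [transition, logComb_self]
  split_ifs with h
  · simp [he l h, h]
  · simp

theorem differentiableAt_logComb {x : ι → ℂ} {B : ι → ι → ℝ} {z : ι → ℂ}
    (hz : ∀ k, x k ≠ 0 → z k / x k ∈ Complex.slitPlane) (l : ι) :
    DifferentiableAt ℂ (fun z => logComb x B z l) z := by
  unfold logComb
  refine DifferentiableAt.fun_sum fun k _ => DifferentiableAt.const_mul ?_ _
  unfold logCoord
  split_ifs with h
  · exact differentiableAt_const _
  · have hd : DifferentiableAt ℂ (fun z : ι → ℂ => z k / x k) z := by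
      simp only [div_eq_mul_inv]
      exact (differentiableAt_apply k z).mul_const _
    exact hd.clog (hz k h)

theorem differentiableAt_transition {x y : ι → ℂ} {B : ι → ι → ℝ} {e : ι → ι} {C : ι → ℂ}
    {z : ι → ℂ} (hz : z ∈ transitionDom x y B) :
    DifferentiableAt ℂ (transition x y B e C) z := by
  rw [differentiableAt_pi]
  intro l
  unfold transition
  refine DifferentiableAt.fun_mul ?_ (differentiableAt_logComb hz.1 l).cexp
  split_ifs with h
  · exact (differentiableAt_apply _ _).const_mul _
  · exact differentiableAt_const _

theorem isOpen_transitionDom (x y : ι → ℂ) (B : ι → ι → ℝ) : IsOpen (transitionDom x y B) := by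
  rw [isOpen_iff_mem_nhds]
  intro z hz
  refine Filter.inter_mem (Filter.eventually_all.2 fun k => ?_)
    (Filter.eventually_all.2 fun l => ?_)
  · by_cases hk : x k = 0
    · exact Filter.Eventually.of_forall fun _ h => absurd hk h
    · have : ContinuousAt (fun z : ι → ℂ => z k / x k) z :=
        (continuous_apply k).continuousAt.div_const _
      filter_upwards [this.eventually_mem (Complex.isOpen_slitPlane.mem_nhds (hz.1 k hk))] with t ht _
      exact ht
  · by_cases hl : y l = 0
    · exact Filter.Eventually.of_forall fun _ h => absurd hl h
    · have : ContinuousAt (fun z : ι → ℂ => (logComb x B z l).im) z :=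
        Complex.continuous_im.continuousAt.comp (differentiableAt_logComb hz.1 l).continuousAt
      filter_upwards [this.eventually_mem (isOpen_Ioo.mem_nhds (hz.2 l hl))] with t ht _
      exact ht

/-- Compatibility of the data of two mutually inverse transition maps. -/
structure TransitionData (x y : ι → ℂ) (B B' : ι → ι → ℝ) (e e' : ι → ι) (C C' : ι → ℂ) : Prop where
  mul_eq : ∀ k (v : ι → ℂ), ∑ l, (B' k l : ℂ) * ∑ k', (B l k' : ℂ) * v k' = v k
  zero_e : ∀ l, y l = 0 → x (e l) = 0
  zero_e' : ∀ k, x k = 0 → y (e' k) = 0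
  e'_e : ∀ l, y l = 0 → e' (e l) = l
  e_e' : ∀ k, x k = 0 → e (e' k) = k
  single : ∀ l, y l = 0 → B' (e l) l = 1 ∧ ∀ k, k ≠ e l → B' k l = 0
  mul_C : ∀ k, x k = 0 → C' k * C (e' k) = 1

theorem TransitionData.left_inv {x y : ι → ℂ} {B B' : ι → ι → ℝ} {e e' : ι → ι} {C C' : ι → ℂ}
    (h : TransitionData x y B B' e e' C C') {z : ι → ℂ} (hz : z ∈ transitionDom x y B) :
    transition y x B' e' C' (transition x y B e C z) = z := by
  classical
  have hlog : ∀ l, logCoord y (transition x y B e C z) l =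
      if y l = 0 then 0 else logComb x B z l := by
    intro l
    unfold logCoord
    split_ifs with hy
    · rfl
    · rw [transition, if_neg hy, mul_div_cancel_left₀ _ hy, Complex.log_exp (hz.2 l hy).1
        (hz.2 l hy).2.le]
  have hsum : ∀ k, logComb y B' (transition x y B e C z) k =
      logCoord x z k - ∑ l, if y l = 0 then (B' k l : ℂ) * logComb x B z l else 0 := by
    intro k
    have h1 : logCoord x z k = ∑ l, (B' k l : ℂ) * logComb x B z l :=
      (h.mul_eq k (logCoord x z)).symm
    rw [h1, ← Finset.sum_sub_distrib]
    refine Finset.sum_congr rfl fun l _ => ?_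
    rw [hlog]
    split_ifs <;> simp
  ext k
  rw [transition, hsum]
  by_cases hx : x k = 0
  · have hy := h.zero_e' k hx
    have h2 : (∑ l, if y l = 0 then (B' k l : ℂ) * logComb x B z l else 0) =
        logComb x B z (e' k) := by
      rw [Finset.sum_eq_single (e' k)]
      · have := (h.single _ hy).1
        rw [h.e_e' k hx] at this
        rw [if_pos hy, this]; simp
      · intro l _ hl
        split_ifs with hyl
        · by_cases hk : k = e l
          · exact absurd (by rw [hk, h.e'_e l hyl]) hl
          · rw [(h.single l hyl).2 k hk]; simp
        · rfl
      · simp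
    rw [h2, if_pos hx, transition, if_pos hy, h.e_e' k hx, logCoord, if_pos hx, zero_sub,
      Complex.exp_neg]
    have hne := Complex.exp_ne_zero (logComb x B z (e' k))
    field_simp
    linear_combination z k * h.mul_C k hx
  · have h2 : (∑ l, if y l = 0 then (B' k l : ℂ) * logComb x B z l else 0) = 0 := by
      refine Finset.sum_eq_zero fun l _ => ?_
      split_ifs with hyl
      · rw [(h.single l hyl).2 k (by rintro rfl; exact hx (h.zero_e l hyl))]; simp
      · rfl
    rw [h2, sub_zero, if_neg hx, exp_logCoord fun _ => ne_zero_of_mem_transitionDom hz hx, expWeight, if_neg hx,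
      mul_div_cancel₀ _ hx]

/-- The local biholomorphism given by two mutually inverse transition maps. -/
noncomputable def transitionHomeo {x y : ι → ℂ} {B B' : ι → ι → ℝ} {e e' : ι → ι} {C C' : ι → ℂ}
    (h : TransitionData x y B B' e e' C C') (h' : TransitionData y x B' B e' e C' C) :
    OpenPartialHomeomorph (ι → ℂ) (ι → ℂ) where
  toFun := transition x y B e C
  invFun := transition y x B' e' C'
  source := transitionDom x y B ∩ transition x y B e C ⁻¹' transitionDom y x B'
  target := transitionDom y x B' ∩ transition y x B' e' C' ⁻¹' transitionDom x y B
  map_source' z hz := ⟨hz.2, by rw [Set.mem_preimage, h.left_inv hz.1]; exact hz.1⟩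
  map_target' z hz := ⟨hz.2, by rw [Set.mem_preimage, h'.left_inv hz.1]; exact hz.1⟩
  left_inv' z hz := h.left_inv hz.1
  right_inv' z hz := h'.left_inv hz.1
  open_source := ContinuousOn.isOpen_inter_preimage
    (fun z hz => (differentiableAt_transition hz).continuousAt.continuousWithinAt)
    (isOpen_transitionDom _ _ _) (isOpen_transitionDom _ _ _)
  open_target := ContinuousOn.isOpen_inter_preimage
    (fun z hz => (differentiableAt_transition hz).continuousAt.continuousWithinAt)
    (isOpen_transitionDom _ _ _) (isOpen_transitionDom _ _ _)
  continuousOn_toFun z hz := (differentiableAt_transition hz.1).continuousAt.continuousWithinAt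
  continuousOn_invFun z hz := (differentiableAt_transition hz.1).continuousAt.continuousWithinAt

section Phase

variable {x y : ι → ℂ} {B : ι → ι → ℝ} {e : ι → ι} {C : ι → ℂ} {ζ ζ' : ι → ℂ}

theorem logComb_mul (hζ : ∀ k, x k ≠ 0 → ζ k = 1) (z : ι → ℂ) :
    logComb x B (ζ * z) = logComb x B z := by
  unfold logComb
  rw [logCoord_mul hζ]

theorem mul_mem_transitionDom (hζ : ∀ k, x k ≠ 0 → ζ k = 1) {z : ι → ℂ}
    (hz : z ∈ transitionDom x y B) : ζ * z ∈ transitionDom x y B := by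
  refine ⟨fun k hk => ?_, fun l hl => ?_⟩
  · rw [Pi.mul_apply, hζ k hk, one_mul]; exact hz.1 k hk
  · rw [logComb_mul hζ]; exact hz.2 l hl

theorem transition_mul (hζ : ∀ k, x k ≠ 0 → ζ k = 1) (hζ' : ∀ l, y l = 0 → ζ' l = ζ (e l))
    (hζ'' : ∀ l, y l ≠ 0 → ζ' l = 1) (z : ι → ℂ) :
    transition x y B e C (ζ * z) = ζ' * transition x y B e C z := by
  ext l
  rw [Pi.mul_apply, transition, transition, logComb_mul hζ, Pi.mul_apply]
  split_ifs with h
  · rw [hζ' l h]; ring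
  · rw [hζ'' l h, one_mul]

end Phase

end Transition

end ToricOrbifold

namespace ToricOrbifold

variable {N : Type u} [AddCommGroup N]

namespace ChartIndex

variable {Ξ : Fan N} (c d : ChartIndex Ξ)

/-- Sums over the indices of two charts agree if the terms are matched by the lattice vectors. -/
@[to_additive]
theorem prod_eq_prod_of_match {α : Type*} [CommMonoid α] {c d : ChartIndex Ξ} {S : Set N}
    (hc : S ⊆ Set.range c.w) (hd : S ⊆ Set.range d.w) {f g : Fin (Module.finrank ℤ N) → α}
    (h : ∀ l l', c.w l = d.w l' → c.w l ∈ S → f l = g l')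
    (hf : ∀ l, c.w l ∉ S → f l = 1) (hg : ∀ l, d.w l ∉ S → g l = 1) :
    ∏ l, f l = ∏ l, g l := by
  classical
  have hc' : ∀ l, c.w l ∈ S → ∃ l', d.w l' = c.w l := fun l hl => hd hl
  have hd' : ∀ l, d.w l ∈ S → ∃ l', c.w l' = d.w l := fun l hl => hc hl
  choose! e he using hc'
  choose! e' he' using hd'
  have hf' : ∏ l with c.w l ∈ S, f l = ∏ l, f l :=
    Finset.prod_filter_of_ne fun l _ hl => by by_contra hS; exact hl (hf l hS)
  have hg' : ∏ l with d.w l ∈ S, g l = ∏ l, g l :=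
    Finset.prod_filter_of_ne fun l _ hl => by by_contra hS; exact hl (hg l hS)
  rw [← hf', ← hg']
  refine Finset.prod_nbij' e e' ?_ ?_ ?_ ?_ ?_
  · intro l hl
    simp only [Finset.mem_filter, Finset.mem_univ, true_and] at hl ⊢
    rwa [he l hl]
  · intro l hl
    simp only [Finset.mem_filter, Finset.mem_univ, true_and] at hl ⊢
    rwa [he' l hl]
  · intro l hl
    simp only [Finset.mem_filter, Finset.mem_univ, true_and] at hl
    exact c.w_injective (by rw [he' _ (by rwa [he l hl]), he l hl])
  · intro l hl
    simp only [Finset.mem_filter, Finset.mem_univ, true_and] at hl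
    exact d.w_injective (by rw [he _ (by rwa [he' l hl]), he' l hl])
  · intro l hl
    simp only [Finset.mem_filter, Finset.mem_univ, true_and] at hl
    exact h l (e l) (he l hl).symm hl

/-- The coordinates of a lattice vector. -/
noncomputable def coord (v : N) (l : Fin (Module.finrank ℤ N)) : ℝ := c.basis.repr (latt v) l

theorem sum_coord_smul (v : N) : ∑ l, c.coord v l • latt (c.w l) = latt v :=
  c.sum_repr_smul _

theorem coord_sub (v v' : N) (l) : c.coord (v - v') l = c.coord v l - c.coord v' l := by
  simp [coord, latt_sub]

theorem coord_eq_of_sum {v : N} {a : Fin (Module.finrank ℤ N) → ℝ}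
    (h : latt v = ∑ l, a l • latt (c.w l)) (l) : c.coord v l = a l := by
  classical
  rw [coord, h, map_sum, Finsupp.finsetSum_apply, Finset.sum_eq_single l]
  · simp [repr_w]
  · intro k _ hk
    simp [repr_w, hk]
  · simp

/-- The diagonal entries of the action of a group element. -/
noncomputable def phase (g : Multiplicative (N ⧸ c.sublattice)) (l : Fin (Module.finrank ℤ N)) : ℂ :=
  ((AddCircle.toCircle (c.angle g.toAdd l) : Circle) : ℂ)

theorem act_eq (g : Multiplicative (N ⧸ c.sublattice)) (z : Fin (Module.finrank ℤ N) → ℂ) :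
    c.act g z = c.phase g * z := rfl

theorem phase_mul (g h : Multiplicative (N ⧸ c.sublattice)) :
    c.phase (g * h) = c.phase g * c.phase h := by
  ext l
  simp [phase, AddCircle.toCircle_add]

theorem phase_one : c.phase 1 = 1 := by
  ext l
  simp [phase]

/-- The group element of a lattice vector. -/
def cls (v : N) : Multiplicative (N ⧸ c.sublattice) :=
  Multiplicative.ofAdd (Submodule.Quotient.mk v)

theorem cls_surjective : Function.Surjective c.cls := fun g =>
  Submodule.Quotient.mk_surjective _ g.toAdd

theorem phase_cls (v : N) (l) :
    c.phase (c.cls v) l = Complex.exp (2 * Real.pi * c.coord v l * Complex.I) := by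
  have : c.angle (c.cls v).toAdd l = ((c.coord v l : ℝ) : UnitAddCircle) := rfl
  rw [phase, this, AddCircle.toCircle_apply_mk, Circle.coe_exp]
  congr 2
  push_cast
  ring

theorem exp_eq_exp_iff_of_mem_Ico {a b : ℝ} (ha : a ∈ Set.Ico (0 : ℝ) 1)
    (hb : b ∈ Set.Ico (0 : ℝ) 1) :
    Complex.exp (2 * Real.pi * a * Complex.I) = Complex.exp (2 * Real.pi * b * Complex.I) ↔
      a = b := by
  refine ⟨fun h => ?_, fun h => by rw [h]⟩
  obtain ⟨n, hn⟩ := Complex.exp_eq_exp_iff_exists_int.1 h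
  have hne : (2 * Real.pi * Complex.I : ℂ) ≠ 0 := Complex.two_pi_I_ne_zero
  have h1 : (2 * Real.pi * Complex.I : ℂ) * a = (2 * Real.pi * Complex.I) * (b + n) := by
    linear_combination hn
  have h2 : (a : ℂ) = b + n := mul_left_cancel₀ hne h1
  have h3 : a = b + n := by exact_mod_cast h2
  have h4 : (n : ℝ) < 1 := by linarith [ha.2, hb.1]
  have h5 : (-1 : ℝ) < n := by linarith [ha.1, hb.2]
  have h6 : n < 1 := by exact_mod_cast h4
  have h7 : -1 < n := by exact_mod_cast h5
  have : n = 0 := by omega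
  rw [h3, this]; simp

variable {c d}

theorem act_eq_self_iff {g} {z : Fin (Module.finrank ℤ N) → ℂ} :
    c.act g z = z ↔ ∀ l, z l ≠ 0 → c.phase g l = 1 := by
  rw [act_eq, funext_iff]
  refine forall_congr' fun l => ?_
  rw [Pi.mul_apply]
  constructor
  · exact fun h h0 => mul_right_cancel₀ h0 (by rw [h, one_mul])
  · intro h
    by_cases h0 : z l = 0
    · rw [h0, mul_zero]
    · rw [h h0, one_mul]

theorem coord_eq_of_match {S : Set N} (hc : S ⊆ Set.range c.w) (hd : S ⊆ Set.range d.w)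
    {v : N} {a : Fin (Module.finrank ℤ N) → ℝ}
    (h : ∀ l l', c.w l = d.w l' → c.w l ∈ S → c.coord v l = a l')
    (h0 : ∀ l, c.w l ∉ S → c.coord v l = 0) (h1 : ∀ l, d.w l ∉ S → a l = 0) (l) :
    d.coord v l = a l := by
  refine d.coord_eq_of_sum ?_ l
  rw [← c.sum_coord_smul v]
  refine sum_eq_sum_of_match hc hd (fun l l' hl hS => ?_) (fun l hl => ?_) fun l hl => ?_
  · rw [h l l' hl hS, hl]
  · rw [h0 l hl, zero_smul]
  · rw [h1 l hl, zero_smul]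

/-- Coordinates in different charts agree for vectors in the span of common basis vectors. -/
theorem coord_eq_coord {S : Set N} (hc : S ⊆ Set.range c.w) (hd : S ⊆ Set.range d.w)
    {v : N} (h0 : ∀ l, c.w l ∉ S → c.coord v l = 0) {l l'} (hl : c.w l = d.w l') :
    d.coord v l' = c.coord v l := by
  classical
  have hd' : ∀ k, d.w k ∈ S → ∃ l', c.w l' = d.w k := fun k hk => hc hk
  choose! e he using hd'
  have := coord_eq_of_match hc hd (v := v)
    (a := fun k => if d.w k ∈ S then c.coord v (e k) else 0)
    (fun k k' hk hS => by
      have hS' : d.w k' ∈ S := hk ▸ hS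
      rw [if_pos hS', c.w_injective ((he k' hS').trans hk.symm)]) h0
    (fun k hk => if_neg hk) l'
  rw [this]
  split_ifs with hS
  · rw [c.w_injective ((he l' hS).trans hl.symm)]
  · rw [h0 l (hl ▸ hS)]

theorem coord_eq_zero {S : Set N} (hc : S ⊆ Set.range c.w) (hd : S ⊆ Set.range d.w)
    {v : N} (h0 : ∀ l, c.w l ∉ S → c.coord v l = 0) {l} (hl : d.w l ∉ S) : d.coord v l = 0 := by
  classical
  have hd' : ∀ k, d.w k ∈ S → ∃ l', c.w l' = d.w k := fun k hk => hc hk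
  choose! e he using hd'
  have := coord_eq_of_match hc hd (v := v)
    (a := fun k => if d.w k ∈ S then c.coord v (e k) else 0)
    (fun k k' hk hS => by
      have hS' : d.w k' ∈ S := hk ▸ hS
      rw [if_pos hS', c.w_injective ((he k' hS').trans hk.symm)]) h0
    (fun k hk => if_neg hk) l
  rw [this, if_neg hl]

theorem zeros_subset_range (z : Fin (Module.finrank ℤ N) → ℂ) : c.zeros z ⊆ Set.range c.w := by
  rintro _ ⟨l, rfl, -⟩; exact ⟨l, rfl⟩

variable (c d)

theorem exists_box (g : Multiplicative (N ⧸ c.sublattice)) :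
    ∃ v : N, c.cls v = g ∧ ∀ l, c.coord v l ∈ Set.Ico (0 : ℝ) 1 := by
  obtain ⟨v, rfl⟩ := c.cls_surjective g
  refine ⟨v - ∑ l, ⌊c.coord v l⌋ • c.w l, ?_, fun l => ?_⟩
  · refine congrArg Multiplicative.ofAdd ((Submodule.Quotient.eq _).2 ?_)
    rw [sub_sub_cancel_left]
    exact neg_mem (Submodule.sum_mem _ fun l _ =>
      Submodule.smul_mem _ _ (Submodule.subset_span ⟨l, rfl⟩))
  · have : c.coord (∑ l, ⌊c.coord v l⌋ • c.w l) l = ⌊c.coord v l⌋ :=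
      by
      refine c.coord_eq_of_sum (a := fun l => (⌊c.coord v l⌋ : ℝ)) ?_ l
      rw [latt_sum]
      exact Finset.sum_congr rfl fun k _ => latt_zsmul _ _
    rw [coord_sub, this]
    exact ⟨Int.fract_nonneg _, Int.fract_lt_one _⟩

/-- The representative of a group element with coordinates in `[0, 1)`. -/
noncomputable def boxVec (g : Multiplicative (N ⧸ c.sublattice)) : N := (c.exists_box g).choose

theorem cls_boxVec (g) : c.cls (c.boxVec g) = g := (c.exists_box g).choose_spec.1

theorem coord_boxVec_mem (g) (l) : c.coord (c.boxVec g) l ∈ Set.Ico (0 : ℝ) 1 :=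
  (c.exists_box g).choose_spec.2 l

variable {c d}

theorem phase_eq_exp (g) (l) :
    c.phase g l = Complex.exp (2 * Real.pi * c.coord (c.boxVec g) l * Complex.I) := by
  conv_lhs => rw [← c.cls_boxVec g]
  rw [phase_cls]

theorem phase_eq_one_iff {g} {l} : c.phase g l = 1 ↔ c.coord (c.boxVec g) l = 0 := by
  rw [phase_eq_exp, ← exp_eq_exp_iff_of_mem_Ico (c.coord_boxVec_mem _ _) ⟨le_rfl, one_pos⟩]
  simp

theorem phase_eq_phase_iff {g : Multiplicative (N ⧸ c.sublattice)}
    {h : Multiplicative (N ⧸ d.sublattice)} {l l'} :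
    c.phase g l = d.phase h l' ↔ c.coord (c.boxVec g) l = d.coord (d.boxVec h) l' := by
  rw [phase_eq_exp, phase_eq_exp, exp_eq_exp_iff_of_mem_Ico (c.coord_boxVec_mem _ _)
    (d.coord_boxVec_mem _ _)]

theorem act_eq_self_iff_boxVec {g} {z : Fin (Module.finrank ℤ N) → ℂ} :
    c.act g z = z ↔ ∀ l, c.w l ∉ c.zeros z → c.coord (c.boxVec g) l = 0 := by
  simp only [act_eq_self_iff, w_mem_zeros, phase_eq_one_iff, ne_eq]

variable [Module.Free ℤ N]

theorem eq_of_coord_eq {v v' : N} (h : ∀ l, c.coord v l = c.coord v' l) : v = v' := by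
  refine latt_injective ?_
  rw [← c.sum_coord_smul v, ← c.sum_coord_smul v']
  simp only [h]

theorem cls_eq_iff_of_mem {v v' : N} (h : ∀ l, c.coord v l ∈ Set.Ico (0 : ℝ) 1)
    (h' : ∀ l, c.coord v' l ∈ Set.Ico (0 : ℝ) 1) (hp : c.phase (c.cls v) = c.phase (c.cls v')) :
    v = v' :=
  eq_of_coord_eq fun l => by
    have := congrFun hp l
    rw [phase_cls, phase_cls] at this
    exact (exp_eq_exp_iff_of_mem_Ico (h l) (h' l)).1 this

theorem boxVec_cls {v : N} (h : ∀ l, c.coord v l ∈ Set.Ico (0 : ℝ) 1) : c.boxVec (c.cls v) = v :=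
  cls_eq_iff_of_mem (c.coord_boxVec_mem _) h (by rw [cls_boxVec])

theorem phase_injective : Function.Injective c.phase := by
  intro g h hgh
  rw [← c.cls_boxVec g, ← c.cls_boxVec h] at hgh ⊢
  rw [cls_eq_iff_of_mem (c.coord_boxVec_mem _) (c.coord_boxVec_mem _) hgh]

end ChartIndex

end ToricOrbifold

namespace ToricOrbifold

variable {N : Type u} [AddCommGroup N]

namespace ChartIndex

variable {Ξ : Fan N} {c d : ChartIndex Ξ}

/-- A linear isomorphism compatible with diagonal maps `φ (ζ z) = ζ' φ(z)`, whose `l'`-th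
coordinate vanishes when the `l`-th coordinate does, matches the diagonal entries. -/
theorem eq_of_hasFDerivAt {ι : Type*} [Fintype ι] {φ : (ι → ℂ) → (ι → ℂ)}
    {L : (ι → ℂ) →L[ℂ] (ι → ℂ)} {x : ι → ℂ} {l l' : ι} {a b : ℂ} (hL : HasFDerivAt φ L x)
    (hsurj : Function.Surjective L) [DecidableEq ι]
    (hz : ∀ᶠ z in 𝓝 x, z l = 0 → φ z l' = 0) (hx : x l = 0)
    (hφ : ∀ᶠ t in 𝓝 (0 : ℂ), φ (x + (t * a) • Pi.single l 1) l' = b * φ (x + t • Pi.single l 1) l') :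
    a = b := by
  have hcurve : ∀ (s : ℂ) (k : ι), HasDerivAt (fun t : ℂ => φ (x + (t * s) • Pi.single k 1) l')
      (s * L (Pi.single k 1) l') 0 := by
    intro s k
    have h1 : HasDerivAt (fun t : ℂ => x + (t * s) • (Pi.single k 1 : ι → ℂ))
        (s • (Pi.single k 1 : ι → ℂ)) 0 := by
      have := (((hasDerivAt_id (0 : ℂ)).mul_const s).smul_const (Pi.single k 1 : ι → ℂ)).const_add x
      simpa using this
    have h2 : HasFDerivAt φ L (x + ((0 : ℂ) * s) • (Pi.single k 1 : ι → ℂ)) := by simpa using hL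
    have h3 := h2.comp_hasDerivAt (0 : ℂ) h1
    have h4 := (hasDerivAt_pi.1 h3) l'
    simpa using h4
  have h0 : ∀ k, k ≠ l → L (Pi.single k 1) l' = 0 := by
    intro k hk
    have h1 := hcurve 1 k
    have hcont : Filter.Tendsto (fun t : ℂ => x + (t * 1) • (Pi.single k 1 : ι → ℂ)) (𝓝 0) (𝓝 x) := by
      have : Continuous fun t : ℂ => x + (t * 1) • (Pi.single k 1 : ι → ℂ) := by fun_prop
      simpa using this.tendsto 0
    have h2 : (fun t : ℂ => φ (x + (t * 1) • (Pi.single k 1 : ι → ℂ)) l') =ᶠ[𝓝 0] fun _ => 0 := by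
      filter_upwards [hcont.eventually hz] with t ht
      refine ht ?_
      simp [hx, hk.symm]
    have h3 := h1.congr_of_eventuallyEq h2.symm
    simpa using h3.unique (hasDerivAt_const (0 : ℂ) (0 : ℂ))
  have hl : L (Pi.single l 1) l' ≠ 0 := by
    intro h
    obtain ⟨v, hv⟩ := hsurj (Pi.single l' 1)
    have h1 : L v l' = 0 := by
      rw [← Finset.univ_sum_single v, map_sum, Finset.sum_apply]
      refine Finset.sum_eq_zero fun k _ => ?_
      have : (Pi.single k (v k) : ι → ℂ) = v k • Pi.single k 1 := by
        rw [← Pi.single_smul, smul_eq_mul, mul_one]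
      rw [this, map_smul, Pi.smul_apply]
      by_cases hk : k = l
      · rw [hk, h, smul_zero]
      · rw [h0 k hk, smul_zero]
    rw [hv] at h1
    simp at h1
  have h1 := hcurve a l
  have h2 := (hcurve 1 l).const_mul b
  simp only [mul_one] at h2
  have h3 := h1.congr_of_eventuallyEq (hφ.mono fun t ht => ht.symm)
  have h4 := h3.unique h2
  rw [one_mul] at h4
  exact mul_right_cancel₀ hl h4

theorem act_add_single {g : Multiplicative (N ⧸ c.sublattice)} {x : Fin (Module.finrank ℤ N) → ℂ}
    (hfix : c.act g x = x) (t : ℂ) (l : Fin (Module.finrank ℤ N)) :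
    c.act g (x + t • Pi.single l 1) = x + (t * c.phase g l) • Pi.single l 1 := by
  rw [act_eq, mul_add, ← act_eq, hfix]
  congr 1
  ext k
  by_cases hk : k = l
  · subst hk; simp [mul_comm]
  · simp [hk]

theorem boxVec_eq_of_germRel [Module.Free ℤ N] [Module.Finite ℤ N] (hΞ : Ξ.IsSimplicial) {x : c.chart.dom} {g : c.chart.G}
    {y : d.chart.dom} {h : d.chart.G} (hrel : c.chart.GermRel d.chart x g y h) :
    c.boxVec g = d.boxVec h := by
  classical
  obtain ⟨φ, hs, ht, iso, hx, hxy, hφ, hψ, hproj, hequiv, hg, hgh⟩ := hrel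
  have hfix : c.act g x = x := hg
  have hzeros : ∀ z ∈ φ.source, c.zeros z = d.zeros (φ z) := fun z hz =>
    ((mk_monomial_eq_iff hΞ (hs hz) (ht (φ.map_source hz))).1 (hproj z hz).symm).1
  have hzxy : c.zeros x = d.zeros y := by rw [hzeros _ hx, hxy]
  have hfix' : d.act h y = y := by
    have := (hequiv ⟨g, hg⟩ x hx).2
    rw [hgh, hxy] at this
    exact (this.symm.trans (congrArg φ hfix)).trans hxy
  have d1 : HasFDerivAt φ (fderiv ℂ φ x) x :=
    (hφ.differentiableAt (φ.open_source.mem_nhds hx)).hasFDerivAt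
  have hyt : y.1 ∈ φ.target := hxy ▸ φ.map_source hx
  have hyx : φ.symm y = x := by rw [← hxy, φ.left_inv hx]
  have d2 : HasFDerivAt φ.symm (fderiv ℂ φ.symm y) y :=
    (hψ.differentiableAt (φ.open_target.mem_nhds hyt)).hasFDerivAt
  have e2 : (fderiv ℂ φ x).comp (fderiv ℂ φ.symm y) = ContinuousLinearMap.id ℂ _ := by
    have h1 : HasFDerivAt (φ ∘ φ.symm) ((fderiv ℂ φ x).comp (fderiv ℂ φ.symm y)) y := by
      refine HasFDerivAt.comp _ ?_ d2
      rw [hyx]; exact d1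
    refine (h1.congr_of_eventuallyEq ?_).unique (hasFDerivAt_id _)
    filter_upwards [φ.open_target.mem_nhds hyt] with z hz
    simp [φ.right_inv hz]
  have hsurj : Function.Surjective (fderiv ℂ φ x) := fun v =>
    ⟨fderiv ℂ φ.symm y v, congrArg (fun L : (Fin _ → ℂ) →L[ℂ] (Fin _ → ℂ) => L v) e2⟩
  have hmatch : ∀ l l', c.w l = d.w l' → c.w l ∈ c.zeros x →
      c.coord (c.boxVec g) l = d.coord (d.boxVec h) l' := by
    intro l l' hl hlx
    refine phase_eq_phase_iff.1 ?_
    refine eq_of_hasFDerivAt (l := l) (l' := l') d1 hsurj ?_ (w_mem_zeros.1 hlx) ?_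
    · filter_upwards [φ.open_source.mem_nhds hx] with z hz h0
      have : d.w l' ∈ d.zeros (φ z) := by rw [← hzeros z hz, ← hl]; exact w_mem_zeros.2 h0
      exact w_mem_zeros.1 this
    · have hcont : Filter.Tendsto (fun t : ℂ => x.1 +
          t • (Pi.single l 1 : Fin (Module.finrank ℤ N) → ℂ)) (𝓝 0) (𝓝 x) := by
        have : Continuous fun t : ℂ => x.1 +
          t • (Pi.single l 1 : Fin (Module.finrank ℤ N) → ℂ) := by fun_prop
        simpa using this.tendsto 0
      filter_upwards [hcont.eventually (φ.open_source.mem_nhds hx)] with t hts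
      have h1 := (hequiv ⟨g, hg⟩ _ hts).2
      rw [hgh] at h1
      have h2 := congrFun h1 l'
      have h3 := act_add_single hfix t l
      exact (congrArg (fun u => φ u l') h3).symm.trans h2
  have hcz := act_eq_self_iff_boxVec.1 hfix
  have hdz := act_eq_self_iff_boxVec.1 hfix'
  refine eq_of_coord_eq (c := d) fun l => ?_
  exact coord_eq_of_match (zeros_subset_range x) (hzxy ▸ zeros_subset_range _) hmatch
    hcz (fun l hl => hdz l (hzxy ▸ hl)) l

/-- The data of a local isomorphism between two charts at points over the same point of the toric
variety. -/
theorem exists_transition {x : c.dom} {y : d.dom} (hxy : c.zeros x = d.zeros y)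
    (hval : ∀ m : Module.Dual ℤ N, (∀ v ∈ c.zeros x, 0 ≤ m v) → c.val x m = d.val y m) :
    ∃ (e e' : Fin (Module.finrank ℤ N) → Fin (Module.finrank ℤ N))
      (C C' : Fin (Module.finrank ℤ N) → ℂ),
      TransitionData x y (fun l k => d.coord (c.w k) l) (fun k l => c.coord (d.w l) k) e e' C C' ∧
      TransitionData y x (fun k l => c.coord (d.w l) k) (fun l k => d.coord (c.w k) l) e' e C' C ∧
      (∀ l, y.1 l = 0 → c.w (e l) = d.w l) ∧ (∀ l, y.1 l = 0 → C l ≠ 0) ∧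
      ∀ z ∈ transitionDom x y (fun l k => d.coord (c.w k) l), ∀ m : Module.Dual ℤ N,
        d.val (transition x y (fun l k => d.coord (c.w k) l) e C z) m = c.val z m := by
  classical
  have hd' : ∀ l, y.1 l = 0 → ∃ k, c.w k = d.w l := fun l hl =>
    zeros_subset_range x.1 (hxy ▸ w_mem_zeros.2 hl)
  have hc' : ∀ k, x.1 k = 0 → ∃ l, d.w l = c.w k := fun k hk =>
    zeros_subset_range y.1 (hxy ▸ w_mem_zeros.2 hk)
  choose! e he using hd'
  choose! e' he' using hc'
  have zero_e : ∀ l, y.1 l = 0 → x.1 (e l) = 0 := fun l hl =>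
    w_mem_zeros.1 (by rw [hxy, he l hl]; exact w_mem_zeros.2 hl)
  have zero_e' : ∀ k, x.1 k = 0 → y.1 (e' k) = 0 := fun k hk =>
    w_mem_zeros.1 (by rw [← hxy, he' k hk]; exact w_mem_zeros.2 hk)
  have e_e' : ∀ k, x.1 k = 0 → e (e' k) = k := fun k hk =>
    c.w_injective (by rw [he _ (zero_e' k hk), he' k hk])
  have e'_e : ∀ l, y.1 l = 0 → e' (e l) = l := fun l hl =>
    d.w_injective (by rw [he' _ (zero_e l hl), he l hl])
  let wt : (Fin (Module.finrank ℤ N) → ℂ) → Fin (Module.finrank ℤ N) → ℂ :=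
    fun u l => if u l = 0 then 1 else u l
  have hwt : ∀ u l, wt u l ≠ 0 := by
    intro u l
    simp only [wt]
    split_ifs with h
    · exact one_ne_zero
    · exact h
  let E : Module.Dual ℤ N →+ (Fin (Module.finrank ℤ N) → ℤ) :=
    { toFun := fun m l => if y.1 l = 0 then m (d.w l) else 0
      map_zero' := by ext l; simp
      map_add' := by
        intro a b
        ext l
        simp only [Pi.add_apply]
        split_ifs <;> simp }
  obtain ⟨C, hC0, hC⟩ := exists_prod_zpow_eq E ⊤
    (fun m => (∏ k, wt x k ^ m.1 (c.w k)) / ∏ l, wt y l ^ m.1 (d.w l)) (by simp) (by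
      intro a b
      have hadd : ∀ (c : ChartIndex Ξ) (u : Fin (Module.finrank ℤ N) → ℂ),
          ∏ k, wt u k ^ ((a + b).1 (c.w k)) =
          (∏ k, wt u k ^ (a.1 (c.w k))) * ∏ k, wt u k ^ (b.1 (c.w k)) := by
        intro c u
        rw [← Finset.prod_mul_distrib]
        refine Finset.prod_congr rfl fun k _ => ?_
        rw [AddSubgroup.coe_add, LinearMap.add_apply, zpow_add₀ (hwt u k)]
      rw [hadd, hadd, mul_div_mul_comm]) (by
      intro m hm
      have h0 : ∀ l, y.1 l = 0 → m.1 (d.w l) = 0 := by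
        intro l hl
        have h1 := congrFun hm l
        change (if y.1 l = 0 then m.1 (d.w l) else 0) = 0 at h1
        rwa [if_pos hl] at h1
      have h1 : ∀ v ∈ c.zeros x, m.1 v = 0 := by
        rw [hxy]
        rintro _ ⟨l, rfl, hl⟩
        exact h0 l hl
      have h2 := hval m.1 fun v hv => (h1 v hv).ge
      have h3 : ∏ k, wt x k ^ m.1 (c.w k) = c.val x m.1 := by
        refine Finset.prod_congr rfl fun k _ => ?_
        simp only [wt]
        split_ifs with hk
        · rw [h1 _ (w_mem_zeros.2 hk), zpow_zero, zpow_zero]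
        · rfl
      have h4 : ∏ l, wt y l ^ m.1 (d.w l) = d.val y m.1 := by
        refine Finset.prod_congr rfl fun l _ => ?_
        simp only [wt]
        split_ifs with hl
        · rw [h0 l hl, zpow_zero, zpow_zero]
        · rfl
      rw [h3, h4, h2, div_self]
      exact val_ne_zero_iff.2 fun v hv => h1 v (hxy ▸ hv))
  have hmul : ∀ (c d : ChartIndex Ξ) (k) (v : Fin (Module.finrank ℤ N) → ℂ),
      ∑ l, (c.coord (d.w l) k : ℂ) * ∑ k', (d.coord (c.w k') l : ℂ) * v k' = v k := by
    intro c d k v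
    simp only [Finset.mul_sum]
    rw [Finset.sum_comm]
    have h1 : ∀ k', ∑ l, (c.coord (d.w l) k : ℂ) * ((d.coord (c.w k') l : ℂ) * v k') =
        if k' = k then v k' else 0 := by
      intro k'
      have h2 : ∑ l, c.coord (d.w l) k * d.coord (c.w k') l = if k' = k then 1 else 0 := by
        rw [← c.repr_w k' k]
        conv_rhs => rw [← d.sum_coord_smul (c.w k')]
        rw [map_sum, Finsupp.finsetSum_apply]
        refine Finset.sum_congr rfl fun l _ => ?_
        rw [map_smul, Finsupp.smul_apply, smul_eq_mul, mul_comm]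
        rfl
      have h3 : ((∑ l, c.coord (d.w l) k * d.coord (c.w k') l : ℝ) : ℂ) =
        ((if k' = k then 1 else 0 : ℝ) : ℂ) := by rw [h2]
      push_cast at h3
      simp only [← mul_assoc]
      rw [← Finset.sum_mul, h3]
      split_ifs <;> simp
    simp only [h1]
    simp
  have hone : ∀ (c d : ChartIndex Ξ) k l, c.w k = d.w l →
      c.coord (d.w l) k = 1 ∧ ∀ k', k' ≠ k → c.coord (d.w l) k' = 0 := by
    intro c d k l h
    rw [← h]
    refine ⟨by rw [coord, repr_w, if_pos rfl], fun k' hk' => ?_⟩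
    rw [coord, repr_w, if_neg hk'.symm]
  refine ⟨e, e', C, fun k => (C (e' k))⁻¹, ?_, ?_, he, fun l _ => hC0 l, ?_⟩
  · exact ⟨hmul c d, zero_e, zero_e', e'_e, e_e', fun l hl => hone c d _ l (he l hl),
      fun k _ => inv_mul_cancel₀ (hC0 _)⟩
  · refine ⟨hmul d c, zero_e', zero_e, e_e', e'_e, fun k hk => hone d c _ k (he' k hk),
      fun l hl => ?_⟩
    rw [e'_e l hl]
    exact mul_inv_cancel₀ (hC0 l)
  · intro z hz m
    have h1 : ∏ l, Complex.exp (logComb (x : Fin _ → ℂ) (fun l k => d.coord (c.w k) l) z l) ^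
        (m (d.w l)) = ∏ k, expWeight (x : Fin _ → ℂ) z k ^ (m (c.w k)) := by
      have h2 : ∀ k, expWeight (x : Fin _ → ℂ) z k = Complex.exp (logCoord (x : Fin _ → ℂ) z k) :=
        fun k => (exp_logCoord fun hk => ne_zero_of_mem_transitionDom hz hk).symm
      simp only [h2, ← Complex.exp_int_mul, ← Complex.exp_sum]
      congr 1
      simp only [logComb, Finset.mul_sum]
      rw [Finset.sum_comm]
      refine Finset.sum_congr rfl fun k _ => ?_
      simp only [← mul_assoc]
      rw [← Finset.sum_mul]
      congr 1
      have := d.sum_mul_repr m (c.w k)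
      exact_mod_cast congrArg (fun r : ℝ => (r : ℂ)) this
    have h2 : ∏ l, (if y.1 l = 0 then C l else y.1 l) ^ (m (d.w l)) =
        ∏ k, wt x k ^ (m (c.w k)) := by
      have h3 := hC ⟨m, trivial⟩
      rw [div_eq_iff (Finset.prod_ne_zero_iff.2 fun l _ => zpow_ne_zero _ (hwt _ l)),
        ← Finset.prod_mul_distrib] at h3
      rw [h3]
      refine Finset.prod_congr rfl fun l _ => ?_
      change _ = C l ^ (if y.1 l = 0 then m (d.w l) else 0) * wt y l ^ m (d.w l)
      simp only [wt]
      split_ifs <;> simp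
    have h3 : ∏ l, (if y.1 l = 0 then z (e l) else 1) ^ (m (d.w l)) =
        ∏ k, (if x.1 k = 0 then z k else 1) ^ (m (c.w k)) := by
      refine (prod_eq_prod_of_match (c := c) (d := d) (S := c.zeros x) (zeros_subset_range _)
        (hxy ▸ zeros_subset_range _) (fun k l hkl hk => ?_) (fun k hk => ?_) fun l hl => ?_).symm
      · have hk0 := w_mem_zeros.1 hk
        have hl0 : y.1 l = 0 := w_mem_zeros.1 (by rw [← hxy, ← hkl]; exact hk)
        rw [if_pos hk0, if_pos hl0, hkl, c.w_injective (hkl.trans (he l hl0).symm)]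
      · rw [w_mem_zeros] at hk
        rw [if_neg hk, one_zpow]
      · rw [hxy, w_mem_zeros] at hl
        rw [if_neg hl, one_zpow]
    have h4 : d.val (transition x y (fun l k => d.coord (c.w k) l) e C z) m =
        (∏ l, (if y.1 l = 0 then C l else y.1 l) ^ (m (d.w l))) *
        (∏ l, (if y.1 l = 0 then z (e l) else 1) ^ (m (d.w l))) *
        ∏ l, Complex.exp (logComb (x : Fin _ → ℂ) (fun l k => d.coord (c.w k) l) z l) ^
          (m (d.w l)) := by
      rw [val, ← Finset.prod_mul_distrib, ← Finset.prod_mul_distrib]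
      refine Finset.prod_congr rfl fun l _ => ?_
      rw [← mul_zpow, ← mul_zpow, transition]
      split_ifs <;> simp
    rw [h4, h1, h2, h3, val, ← Finset.prod_mul_distrib, ← Finset.prod_mul_distrib]
    refine Finset.prod_congr rfl fun k _ => ?_
    rw [← mul_zpow, ← mul_zpow]
    congr 1
    simp only [wt, expWeight]
    split_ifs with hk
    · simp
    · rw [mul_one, mul_div_cancel₀ _ hk]

theorem zeros_transition {x : c.dom} {y : d.dom} (hxy : c.zeros x = d.zeros y)
    {B : Fin (Module.finrank ℤ N) → Fin (Module.finrank ℤ N) → ℝ}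
    {e : Fin (Module.finrank ℤ N) → Fin (Module.finrank ℤ N)} {C : Fin (Module.finrank ℤ N) → ℂ}
    (he : ∀ l, y.1 l = 0 → c.w (e l) = d.w l) (hC : ∀ l, y.1 l = 0 → C l ≠ 0)
    {z : Fin (Module.finrank ℤ N) → ℂ} (hz : z ∈ transitionDom x y B) :
    d.zeros (transition x y B e C z) = c.zeros z := by
  have hd : ∀ l, transition (x : Fin _ → ℂ) y B e C z l = 0 ↔ y.1 l = 0 ∧ z (e l) = 0 := by
    intro l
    rw [transition, mul_eq_zero, or_iff_left (Complex.exp_ne_zero _)]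
    split_ifs with h
    · simp [hC l h, h]
    · simp [h]
  ext v
  constructor
  · rintro ⟨l, rfl, hl⟩
    obtain ⟨h1, h2⟩ := (hd l).1 hl
    exact ⟨e l, he l h1, h2⟩
  · rintro ⟨k, rfl, hk⟩
    have hxk : x.1 k = 0 := by
      by_contra h; exact ne_zero_of_mem_transitionDom hz h hk
    obtain ⟨l, hl, hl0⟩ : c.w k ∈ d.zeros y := hxy ▸ w_mem_zeros.2 hxk
    refine ⟨l, hl, (hd l).2 ⟨hl0, ?_⟩⟩
    rwa [c.w_injective ((he l hl0).trans hl)]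

theorem mem_dom_of_mem_transitionDom {x : c.dom}
    {y : Fin (Module.finrank ℤ N) → ℂ}
    {B : Fin (Module.finrank ℤ N) → Fin (Module.finrank ℤ N) → ℝ}
    {z : Fin (Module.finrank ℤ N) → ℂ} (hz : z ∈ transitionDom x y B) : z ∈ c.dom :=
  fun l hl => ne_zero_of_mem_transitionDom hz (x.2 l hl)

end ChartIndex

end ToricOrbifold

namespace ToricOrbifold

variable {N : Type u} [AddCommGroup N]

namespace ChartIndex

variable {Ξ : Fan N} {c d : ChartIndex Ξ}

theorem boxVec_injective : Function.Injective c.boxVec := fun g h hgh => by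
  rw [← c.cls_boxVec g, hgh, c.cls_boxVec]

variable [Module.Free ℤ N]

theorem boxVec_cls_boxVec {S : Set N} (hc : S ⊆ Set.range c.w) (hd : S ⊆ Set.range d.w)
    {g : Multiplicative (N ⧸ c.sublattice)}
    (hg : ∀ l, c.w l ∉ S → c.coord (c.boxVec g) l = 0) :
    d.boxVec (d.cls (c.boxVec g)) = c.boxVec g := by
  refine boxVec_cls fun l => ?_
  by_cases hl : d.w l ∈ S
  · obtain ⟨k, hk⟩ := hc hl
    rw [coord_eq_coord hc hd hg hk]
    exact c.coord_boxVec_mem _ _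
  · rw [coord_eq_zero hc hd hg hl]
    exact ⟨le_rfl, one_pos⟩

theorem cls_boxVec_mul {S : Set N} (hc : S ⊆ Set.range c.w) (hd : S ⊆ Set.range d.w)
    {g h : Multiplicative (N ⧸ c.sublattice)}
    (hg : ∀ l, c.w l ∉ S → c.coord (c.boxVec g) l = 0)
    (hh : ∀ l, c.w l ∉ S → c.coord (c.boxVec h) l = 0)
    (hgh : ∀ l, c.w l ∉ S → c.coord (c.boxVec (g * h)) l = 0) :
    d.cls (c.boxVec (g * h)) = d.cls (c.boxVec g) * d.cls (c.boxVec h) := by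
  have key : ∀ g' : Multiplicative (N ⧸ c.sublattice),
      (∀ l, c.w l ∉ S → c.coord (c.boxVec g') l = 0) →
      (∀ l k, c.w k = d.w l → d.phase (d.cls (c.boxVec g')) l = c.phase g' k) ∧
      ∀ l, d.w l ∉ S → d.phase (d.cls (c.boxVec g')) l = 1 := by
    intro g' hg'
    have h1 := boxVec_cls_boxVec hc hd hg'
    refine ⟨fun l k hk => phase_eq_phase_iff.2 ?_, fun l hl => phase_eq_one_iff.2 ?_⟩
    · rw [h1, coord_eq_coord hc hd hg' hk]
    · rw [h1, coord_eq_zero hc hd hg' hl]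
  refine phase_injective (funext fun l => ?_)
  rw [phase_mul, Pi.mul_apply]
  by_cases hl : d.w l ∈ S
  · obtain ⟨k, hk⟩ := hc hl
    rw [(key _ hg).1 l k hk, (key _ hh).1 l k hk, (key _ hgh).1 l k hk, phase_mul, Pi.mul_apply]
  · rw [(key _ hg).2 l hl, (key _ hh).2 l hl, (key _ hgh).2 l hl, mul_one]

variable [Module.Finite ℤ N]

theorem mem_isotropy_iff {x : c.chart.dom} {g : Multiplicative (N ⧸ c.sublattice)} :
    g ∈ c.chart.isotropy x ↔ ∀ l, c.w l ∉ c.zeros x → c.coord (c.boxVec g) l = 0 :=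
  act_eq_self_iff_boxVec

/-- The isomorphism of the isotropy groups at two points over the same point. -/
noncomputable def isotropyEquiv (x : c.chart.dom) (y : d.chart.dom)
    (h : c.zeros x = d.zeros y) : c.chart.isotropy x ≃* d.chart.isotropy y where
  toFun g := ⟨d.cls (c.boxVec g.1), mem_isotropy_iff.2 fun l hl => by
    have hc := zeros_subset_range (c := c) x
    have hd : c.zeros x ⊆ Set.range d.w := h ▸ zeros_subset_range y.1
    rw [boxVec_cls_boxVec hc hd (mem_isotropy_iff.1 g.2)]
    exact coord_eq_zero hc hd (mem_isotropy_iff.1 g.2) (h ▸ hl)⟩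
  invFun g := ⟨c.cls (d.boxVec g.1), mem_isotropy_iff.2 fun l hl => by
    have hd := zeros_subset_range (c := d) y
    have hc : d.zeros y ⊆ Set.range c.w := h ▸ zeros_subset_range x.1
    rw [boxVec_cls_boxVec hd hc (mem_isotropy_iff.1 g.2)]
    exact coord_eq_zero hd hc (mem_isotropy_iff.1 g.2) (h ▸ hl)⟩
  left_inv g := Subtype.ext (by
    have hc := zeros_subset_range (c := c) x
    have hd : c.zeros x ⊆ Set.range d.w := h ▸ zeros_subset_range y.1
    change c.cls (d.boxVec (d.cls (c.boxVec g.1))) = g.1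
    rw [boxVec_cls_boxVec hc hd (mem_isotropy_iff.1 g.2)]
    exact c.cls_boxVec _)
  right_inv g := Subtype.ext (by
    have hd := zeros_subset_range (c := d) y
    have hc : d.zeros y ⊆ Set.range c.w := h ▸ zeros_subset_range x.1
    change d.cls (c.boxVec (c.cls (d.boxVec g.1))) = g.1
    rw [boxVec_cls_boxVec hd hc (mem_isotropy_iff.1 g.2)]
    exact d.cls_boxVec _)
  map_mul' g g' := Subtype.ext (by
    have hc := zeros_subset_range (c := c) x
    have hd : c.zeros x ⊆ Set.range d.w := h ▸ zeros_subset_range y.1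
    exact cls_boxVec_mul hc hd (mem_isotropy_iff.1 g.2) (mem_isotropy_iff.1 g'.2)
      (mem_isotropy_iff.1 (g * g').2))

theorem boxVec_isotropyEquiv (x : c.chart.dom) (y : d.chart.dom)
    (h : c.zeros x = d.zeros y) (g : c.chart.isotropy x) :
    d.boxVec (isotropyEquiv x y h g).1 = c.boxVec g.1 :=
  boxVec_cls_boxVec (zeros_subset_range (c := c) x)
    (h ▸ zeros_subset_range y.1 : c.zeros x ⊆ Set.range d.w) (mem_isotropy_iff.1 g.2)

/-- The charts are locally isomorphic at points over the same point of the toric variety. -/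
theorem exists_germ (hΞ : Ξ.IsSimplicial) (x : c.chart.dom) (y : d.chart.dom)
    (hxy : c.chart.proj x = d.chart.proj y) :
    ∃ (φ : OpenPartialHomeomorph (Fin (Module.finrank ℤ N) → ℂ) (Fin (Module.finrank ℤ N) → ℂ))
      (hs : φ.source ⊆ c.chart.dom) (ht : φ.target ⊆ d.chart.dom)
      (iso : c.chart.isotropy x ≃* d.chart.isotropy y),
      x.1 ∈ φ.source ∧ φ x = y ∧
      DifferentiableOn ℂ φ φ.source ∧ DifferentiableOn ℂ φ.symm φ.target ∧
      (∀ (z : Fin (Module.finrank ℤ N) → ℂ) (hz : z ∈ φ.source),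
        d.chart.proj ⟨φ z, ht (φ.map_source hz)⟩ = c.chart.proj ⟨z, hs hz⟩) ∧
      (∀ k : c.chart.isotropy x, ∀ z ∈ φ.source,
        c.chart.act k z ∈ φ.source ∧ φ (c.chart.act k z) = d.chart.act (iso k) (φ z)) ∧
      ∀ k : c.chart.isotropy x, d.boxVec (iso k).1 = c.boxVec k.1 := by
  obtain ⟨hz, hv⟩ := (mk_monomial_eq_iff hΞ x.2 y.2).1 hxy
  obtain ⟨e, e', C, C', h, h', he, hC, hval⟩ := exists_transition (c := c) (d := d) (x := x)
    (y := y) hz hv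
  have hs : (transitionHomeo h h').source ⊆ c.dom := fun z hz =>
    mem_dom_of_mem_transitionDom (c := c) (x := x) hz.1
  have ht : (transitionHomeo h h').target ⊆ d.dom := fun z hz =>
    mem_dom_of_mem_transitionDom (c := d) (x := y) hz.1
  refine ⟨transitionHomeo h h', hs, ht, isotropyEquiv x y hz,
    ⟨self_mem_transitionDom _ _ _, ?_⟩, transition_self h.zero_e,
    fun z hz => (differentiableAt_transition hz.1).differentiableWithinAt,
    fun z hz => (differentiableAt_transition hz.1).differentiableWithinAt,
    fun z hzs => ?_, fun k z hzs => ?_, fun k => boxVec_isotropyEquiv x y hz k⟩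
  · rw [Set.mem_preimage, transition_self h.zero_e]
    exact self_mem_transitionDom _ _ _
  · refine (mk_monomial_eq_iff hΞ (ht ((transitionHomeo h h').map_source hzs)) (hs hzs)).2
      ⟨zeros_transition (c := c) (d := d) (x := x) (y := y) hz he hC hzs.1, fun m _ => ?_⟩
    exact hval z hzs.1 m
  · have hk1 : ∀ l, x.1 l ≠ 0 → c.phase k.1 l = 1 := act_eq_self_iff.1 k.2
    have hk2 : ∀ l, y.1 l ≠ 0 → d.phase (isotropyEquiv x y hz k).1 l = 1 :=
      act_eq_self_iff.1 (isotropyEquiv x y hz k).2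
    have hk3 : ∀ l, y.1 l = 0 → d.phase (isotropyEquiv x y hz k).1 l = c.phase k.1 (e l) := by
      intro l hl
      refine phase_eq_phase_iff.2 ?_
      have hc := zeros_subset_range (c := c) x
      have hd : c.zeros x ⊆ Set.range d.w := hz ▸ zeros_subset_range y.1
      refine Eq.trans ?_ (coord_eq_coord hc hd (mem_isotropy_iff.1 k.2) (he l hl))
      exact congrArg (fun v => d.coord v l) (boxVec_isotropyEquiv x y hz k)
    have hmul : transition x.1 y.1 (fun l k => d.coord (c.w k) l) e C (c.phase k.1 * z) =
        d.phase (isotropyEquiv x y hz k).1 *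
          transition x.1 y.1 (fun l k => d.coord (c.w k) l) e C z :=
      transition_mul hk1 hk3 hk2 z
    refine ⟨⟨mul_mem_transitionDom hk1 hzs.1, ?_⟩, hmul⟩
    change transition x.1 y.1 (fun l k => d.coord (c.w k) l) e C (c.phase k.1 * z) ∈
      transitionDom y.1 x.1 (fun k l => c.coord (d.w l) k)
    rw [hmul]
    exact mul_mem_transitionDom hk2 hzs.2

end ChartIndex

section Inertia

variable [Module.Free ℤ N] [Module.Finite ℤ N] {Ξ : Fan N}

/-- The lattice vector with coordinates in `[0, 1)` which represents the group element. -/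
noncomputable def TwistedPoint.boxVec (q : TwistedPoint (toricAtlas Ξ)) : N :=
  q.1.1.boxVec q.1.2.1

theorem TwistedPoint.rel_of_eq (hΞ : Ξ.IsSimplicial) {q r : TwistedPoint (toricAtlas Ξ)}
    (h : q.chart.proj q.pt = r.chart.proj r.pt) (hb : q.boxVec = r.boxVec) : q.Rel r := by
  obtain ⟨φ, hs, ht, iso, h1, h2, h3, h4, h5, h6, h7⟩ :=
    ChartIndex.exists_germ (c := q.1.1) (d := r.1.1) hΞ q.pt r.pt h
  have hg : q.elt ∈ q.chart.isotropy q.pt := q.2.2.2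
  exact ⟨φ, hs, ht, iso, h1, h2, h3, h4, h5, h6, hg,
    ChartIndex.boxVec_injective (c := r.1.1) ((h7 ⟨q.elt, hg⟩).trans hb)⟩

namespace TwistedInertia

/-- The lattice vector of a point of the inertia space. -/
noncomputable def boxVec (hΞ : Ξ.IsSimplicial) : TwistedInertia (toricAtlas Ξ) → N :=
  Quot.lift TwistedPoint.boxVec fun q r h =>
    ChartIndex.boxVec_eq_of_germRel (c := q.1.1) (d := r.1.1) hΞ h

theorem mk_eq_mk_iff (hΞ : Ξ.IsSimplicial) {q r : TwistedPoint (toricAtlas Ξ)} :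
    mk q = mk r ↔ q.chart.proj q.pt = r.chart.proj r.pt ∧ q.boxVec = r.boxVec :=
  ⟨fun h => ⟨congrArg proj h, congrArg (boxVec hΞ) h⟩,
    fun h => Quot.sound (TwistedPoint.rel_of_eq hΞ h.1 h.2)⟩

theorem ext (hΞ : Ξ.IsSimplicial) {s t : TwistedInertia (toricAtlas Ξ)}
    (h : proj s = proj t) (hb : boxVec hΞ s = boxVec hΞ t) : s = t := by
  obtain ⟨q, rfl⟩ := Quot.exists_rep s
  obtain ⟨r, rfl⟩ := Quot.exists_rep t
  exact (mk_eq_mk_iff hΞ).2 ⟨h, hb⟩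

theorem continuous_mk : Continuous (mk (A := toricAtlas Ξ)) := continuous_quot_mk

theorem mk_surjective : Function.Surjective (mk (A := toricAtlas Ξ)) := Quot.exists_rep

theorem isOpenMap_mk (hΞ : Ξ.IsSimplicial) : IsOpenMap (mk (A := toricAtlas Ξ)) := by
  intro W hW
  change IsOpen (mk ⁻¹' (mk '' W))
  rw [isOpen_iff_mem_nhds]
  rintro r ⟨q, hqW, hqr⟩
  obtain ⟨hp, hb⟩ := (mk_eq_mk_iff hΞ).1 hqr
  obtain ⟨φ, hs, ht, iso, h1, h2, h3, h4, h5, h6, h7⟩ :=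
    ChartIndex.exists_germ (c := r.1.1) (d := q.1.1) hΞ r.pt q.pt hp.symm
  obtain ⟨a, z⟩ := q
  obtain ⟨b, x⟩ := r
  have hWa : IsOpen {t : (toricAtlas Ξ a.1).fixedLocus a.2.1 | Sigma.mk a t ∈ W} :=
    hW.preimage continuous_sigmaMk
  obtain ⟨O, hO, hOW⟩ := isOpen_induced_iff.1 hWa
  have hzO : z.1 ∈ O := by
    have : z ∈ Subtype.val ⁻¹' O := by rw [hOW]; exact hqW
    exact this
  have hopen : IsOpen (φ.source ∩ φ ⁻¹' O) := φ.isOpen_inter_preimage hO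
  let ib : (toricAtlas Ξ b.1).fixedLocus b.2.1 → TwistedPoint (toricAtlas Ξ) := fun t => ⟨b, t⟩
  have hib : IsOpenMap ib := @isOpenMap_sigmaMk _
    (fun a : (Σ i : ChartIndex Ξ, {g : (toricAtlas Ξ i).G // g ≠ 1}) =>
      (toricAtlas Ξ a.1).fixedLocus a.2.1) _ b
  have hnhds : ib '' (Subtype.val ⁻¹' (φ.source ∩ φ ⁻¹' O)) ∈ 𝓝 (ib x) := by
    refine (hib _ (hopen.preimage continuous_subtype_val)).mem_nhds ⟨x, ⟨h1, ?_⟩, rfl⟩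
    rw [Set.mem_preimage, h2]; exact hzO
  refine Filter.mem_of_superset hnhds ?_
  rintro _ ⟨x', ⟨hx's, hx'O⟩, rfl⟩
  have hfix : (toricAtlas Ξ a.1).act a.2.1 (φ x'.1) = φ x'.1 := by
    have hz := (ChartIndex.mk_monomial_eq_iff hΞ (c := a.1) (d := b.1)
      (ht (φ.map_source hx's)) (hs hx's)).1 (h5 x'.1 hx's)
    have hfx : b.1.act b.2.1 x'.1 = x'.1 := x'.2.2
    have hbox : a.1.boxVec a.2.1 = b.1.boxVec b.2.1 := hb
    refine ChartIndex.act_eq_self_iff_boxVec.2 fun l hl => ?_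
    rw [hbox]
    have hb' := ChartIndex.act_eq_self_iff_boxVec.1 hfx
    refine ChartIndex.coord_eq_zero (c := b.1) (d := a.1) (S := b.1.zeros x'.1)
      (ChartIndex.zeros_subset_range _) ?_ hb' (hz.1 ▸ hl)
    rw [← hz.1]
    exact ChartIndex.zeros_subset_range _
  refine ⟨⟨a, ⟨φ x'.1, ht (φ.map_source hx's), hfix⟩⟩, ?_, (mk_eq_mk_iff hΞ).2 ⟨h5 x'.1 hx's, hb⟩⟩
  have : (⟨φ x'.1, ht (φ.map_source hx's), hfix⟩ : (toricAtlas Ξ a.1).fixedLocus a.2.1) ∈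
    Subtype.val ⁻¹' O := hx'O
  rw [hOW] at this
  exact this

end TwistedInertia

end Inertia

end ToricOrbifold

namespace ToricOrbifold

variable {N : Type u} [AddCommGroup N]

section Closed

theorem AffinePoint.isClosed_setOf_subset_rays {σ : PointedCone ℝ (ℝ ⊗[ℤ] N)} (R : Set N) :
    IsClosed {x : AffinePoint σ | R ⊆ x.rays} := by
  have : {x : AffinePoint σ | R ⊆ x.rays} =
      ⋂ v ∈ R, {x : AffinePoint σ | v ∈ rayGenerators σ ∧ ∀ m, x.eval m ≠ 0 → m.1 v = 0} := by
    ext x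
    simp only [Set.mem_ofPred_eq, Set.mem_iInter]
    rfl
  rw [this]
  refine isClosed_biInter fun v _ => ?_
  by_cases hv : v ∈ rayGenerators σ
  · simp only [hv, true_and]
    have : {x : AffinePoint σ | ∀ m, x.eval m ≠ 0 → m.1 v = 0} =
        ⋂ m : dualMonoid σ, {x | x.eval m = 0 ∨ m.1 v = 0} := by
      ext x
      simp only [Set.mem_ofPred_eq, Set.mem_iInter]
      exact forall_congr' fun m => by rw [or_iff_not_imp_left]
    rw [this]
    refine isClosed_iInter fun m => ?_
    by_cases hm : m.1 v = 0
    · simp [hm]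
    · simp only [hm, or_false]
      exact isClosed_eq (AffinePoint.continuous_eval m) continuous_const
  · simp [hv]

end Closed

namespace ToricVariety

variable {Ξ : Fan N}

theorem mk_surjective (p : ToricVariety Ξ) : ∃ σ x, mk σ x = p := by
  obtain ⟨⟨σ, x⟩, rfl⟩ := Quot.exists_rep p
  exact ⟨σ, x, rfl⟩

theorem isClosed_iff {A : Set (ToricVariety Ξ)} :
    IsClosed A ↔ ∀ σ, IsClosed {x : AffinePoint σ.1 | mk (Ξ := Ξ) σ x ∈ A} := by
  have h : Topology.IsQuotientMap (Quot.mk Ξ.Glue : _ → ToricVariety Ξ) := isQuotientMap_quot_mk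
  exact h.isClosed_preimage.symm.trans isClosed_sigma_iff

theorem continuous_mk (σ : Ξ.cones) : Continuous (mk (Ξ := Ξ) σ) :=
  continuous_quot_mk.comp continuous_sigmaMk

end ToricVariety

variable [Module.Free ℤ N] [Module.Finite ℤ N] {Ξ : Fan N} (hΞ : Ξ.IsSimplicial)

namespace ToricVariety

/-- The ray generators of the cone of the orbit of a point. -/
def rays : ToricVariety Ξ → Set N :=
  Quot.lift (fun p => p.2.rays) (by
    rintro p q ⟨hf, he⟩
    rw [← he, AffinePoint.rays_incl hΞ hf])

theorem rays_mk (σ : Ξ.cones) (x : AffinePoint σ.1) : rays hΞ (mk σ x) = x.rays := rfl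

theorem rays_mk_monomial (c : ChartIndex Ξ) (z : c.dom) :
    rays hΞ (mk c.cone (c.monomial z)) = c.zeros z := c.rays_monomial hΞ z.2

theorem isClosed_setOf_subset_rays (R : Set N) : IsClosed {p | R ⊆ rays hΞ p} :=
  isClosed_iff.2 fun _ => AffinePoint.isClosed_setOf_subset_rays R

include hΞ in
theorem exists_chart_point (p : ToricVariety Ξ) :
    ∃ (c : ChartIndex Ξ) (z : c.dom), mk c.cone (c.monomial z) = p := by
  obtain ⟨σ, x, rfl⟩ := mk_surjective p
  obtain ⟨c, rfl⟩ := exists_chartIndex hΞ σ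
  obtain ⟨z, rfl⟩ := c.monomial_surjective hΞ x
  exact ⟨c, z, rfl⟩

end ToricVariety

open ToricVariety

theorem mem_orbit_iff {τ : Ξ.cones} {p : ToricVariety Ξ} :
    p ∈ orbit τ ↔ rays hΞ p = rayGenerators τ.1 := by
  constructor
  · rintro ⟨x, rfl, hx⟩
    rw [rays_mk]
    ext v
    exact ⟨fun h => h.1, fun h => ⟨h, fun m hm => (hx m).1 hm v (rayGenerators_subset_cone h)⟩⟩
  · intro h
    obtain ⟨c, z, rfl⟩ := exists_chart_point hΞ p
    rw [rays_mk_monomial] at h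
    obtain ⟨τ', hτ', hR⟩ := c.exists_face hΞ (ChartIndex.zeros_subset z.2)
    have : τ' = τ := hΞ.cone_eq_of_rays_eq (by rw [hR, h])
    subst this
    have hz' : z.1 ∈ (c.restrict τ' hτ').dom := ChartIndex.mem_dom_iff.2 (by
      change c.zeros z ⊆ rayGenerators τ'.1; rw [hR])
    refine ⟨(c.restrict τ' hτ').monomial ⟨z, hz'⟩,
      (ChartIndex.mk_monomial_restrict τ' hτ' z.2 hz').symm, fun m => ?_⟩
    refine Iff.trans (ChartIndex.val_ne_zero_iff (c := c) (z := z) (m := m.1)) ?_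
    rw [h]
    refine ⟨fun hm v hv => ?_, fun hm v hv => hm v (rayGenerators_subset_cone hv)⟩
    have hv' := ((c.restrict τ' hτ').mem_cone_iff hΞ).1 hv
    have : (m.1 v : ℝ) = 0 := by
      rw [← c.sum_mul_repr]
      refine Finset.sum_eq_zero fun l _ => ?_
      by_cases hl : c.w l ∈ rayGenerators τ'.1
      · rw [hm _ hl, Int.cast_zero, zero_mul]
      · exact mul_eq_zero_of_right _ ((hv' l).2 hl)
    exact_mod_cast this

theorem mem_orbitClosure_iff {τ : Ξ.cones} {p : ToricVariety Ξ} :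
    p ∈ orbitClosure τ ↔ rayGenerators τ.1 ⊆ rays hΞ p := by
  classical
  constructor
  · intro h
    refine closure_minimal (fun q hq => ?_) (isClosed_setOf_subset_rays hΞ _) h
    exact ((mem_orbit_iff hΞ).1 hq).ge
  · intro h
    obtain ⟨c, z, rfl⟩ := exists_chart_point hΞ p
    rw [rays_mk_monomial] at h
    let f : ℂ → Fin (Module.finrank ℤ N) → ℂ := fun ε l =>
      if z.1 l = 0 ∧ c.w l ∉ rayGenerators τ.1 then ε else z.1 l
    have hf : ∀ ε, f ε ∈ c.dom := by
      intro ε l hl h0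
      have hzl := z.2 l hl
      simp only [f, hzl, false_and, if_false] at h0
    have hcont : Continuous fun ε => (⟨f ε, hf ε⟩ : c.dom) := by
      refine Continuous.subtype_mk (continuous_pi fun l => ?_) _
      simp only [f]
      split_ifs
      · exact continuous_id
      · exact continuous_const
    have hf0 : (⟨f 0, hf 0⟩ : c.dom) = z := by
      refine Subtype.ext (funext fun l => ?_)
      simp only [f]
      split_ifs with h
      · exact h.1.symm
      · rfl
    have hcont' : Continuous fun ε => ToricVariety.mk c.cone (c.monomial ⟨f ε, hf ε⟩) :=
      (continuous_mk _).comp (c.continuous_monomial.comp hcont)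
    have ht : Filter.Tendsto (fun ε => ToricVariety.mk c.cone (c.monomial ⟨f ε, hf ε⟩))
        (𝓝[≠] 0) (𝓝 (ToricVariety.mk c.cone (c.monomial z))) := by
      have := (hcont'.tendsto 0).mono_left (nhdsWithin_le_nhds (s := {0}ᶜ))
      rwa [hf0] at this
    refine mem_closure_of_tendsto ht ?_
    filter_upwards [self_mem_nhdsWithin] with ε hε
    rw [mem_orbit_iff hΞ, rays_mk_monomial]
    ext v
    constructor
    · rintro ⟨l, rfl, hl⟩
      simp only [f] at hl
      split_ifs at hl with hcond
      · exact absurd hl hε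
      · by_contra hτ
        exact hcond ⟨hl, hτ⟩
    · intro hv
      obtain ⟨l, rfl, hl⟩ := h hv
      exact ⟨l, rfl, by simp [f, hv, hl]⟩

theorem exists_mem_orbit (τ : Ξ.cones) : ∃ p, rays hΞ p = rayGenerators τ.1 := by
  classical
  obtain ⟨c, rfl⟩ := exists_chartIndex hΞ τ
  let z : Fin (Module.finrank ℤ N) → ℂ := fun l =>
    if c.w l ∈ rayGenerators c.cone.1 then 0 else 1
  have hz : c.zeros z = rayGenerators c.cone.1 := by
    ext v
    constructor
    · rintro ⟨l, rfl, hl⟩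
      simp only [z] at hl
      split_ifs at hl with h
      · exact h
      · exact absurd hl one_ne_zero
    · intro hv
      obtain ⟨l, rfl⟩ := c.rays_subset hv
      exact ⟨l, rfl, if_pos hv⟩
  refine ⟨ToricVariety.mk c.cone (c.monomial ⟨z, ChartIndex.mem_dom_iff.2 hz.le⟩), ?_⟩
  rw [rays_mk_monomial, hz]

include hΞ

theorem orbitClosure_injective : Function.Injective (orbitClosure (Ξ := Ξ)) := by
  have key : ∀ σ τ : Ξ.cones, orbitClosure σ = orbitClosure τ →
      rayGenerators τ.1 ⊆ rayGenerators σ.1 := by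
    intro σ τ h
    obtain ⟨p, hp⟩ := exists_mem_orbit hΞ σ
    have : p ∈ orbitClosure σ := (mem_orbitClosure_iff hΞ).2 hp.ge
    rw [h, mem_orbitClosure_iff hΞ, hp] at this
    exact this
  exact fun σ τ h => hΞ.cone_eq_of_rays_eq ((key τ σ h.symm).antisymm (key σ τ h))

theorem isConnected_orbitClosure (τ : Ξ.cones) : IsConnected (orbitClosure τ) := by
  classical
  obtain ⟨p, hp⟩ := exists_mem_orbit hΞ τ
  refine ⟨⟨p, (mem_orbitClosure_iff hΞ).2 hp.ge⟩, IsPreconnected.closure ?_⟩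
  obtain ⟨c, rfl⟩ := exists_chartIndex hΞ τ
  let T : Set (Fin (Module.finrank ℤ N) → ℂ) := Set.univ.pi fun l =>
    if c.w l ∈ rayGenerators c.cone.1 then {0} else {0}ᶜ
  have hT : IsPreconnected T := isPreconnected_univ_pi fun l => by
    split_ifs
    · exact isPreconnected_singleton
    · exact (isConnected_compl_singleton_of_one_lt_rank (by simp) 0).isPreconnected
  have hTz : ∀ z : Fin (Module.finrank ℤ N) → ℂ, z ∈ T ↔ c.zeros z = rayGenerators c.cone.1 := by
    intro z
    simp only [T, Set.mem_univ_pi]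
    constructor
    · intro h
      ext v
      constructor
      · rintro ⟨l, rfl, hl⟩
        by_contra hv
        have := h l
        rw [if_neg hv] at this
        exact this hl
      · intro hv
        obtain ⟨l, rfl⟩ := c.rays_subset hv
        have := h l
        rw [if_pos hv] at this
        exact ⟨l, rfl, this⟩
    · intro h l
      split_ifs with hl
      · rw [← h] at hl; exact ChartIndex.w_mem_zeros.1 hl
      · rw [← h] at hl; exact fun h0 => hl (ChartIndex.w_mem_zeros.2 h0)
  have hTd : T ⊆ c.dom := fun z hz => ChartIndex.mem_dom_iff.2 ((hTz z).1 hz).le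
  let F : T → ToricVariety Ξ := fun z => ToricVariety.mk c.cone (c.monomial ⟨z, hTd z.2⟩)
  have hF : Continuous F := (continuous_mk _).comp (c.continuous_monomial.comp
    (Continuous.subtype_mk continuous_subtype_val _))
  have hrange : orbit c.cone = Set.range F := by
    ext q
    rw [mem_orbit_iff hΞ]
    constructor
    · intro hq
      obtain ⟨x, rfl, -⟩ := (mem_orbit_iff hΞ).2 hq
      obtain ⟨z, rfl⟩ := c.monomial_surjective hΞ x
      rw [rays_mk_monomial] at hq
      exact ⟨⟨z, (hTz z).2 hq⟩, rfl⟩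
    · rintro ⟨z, rfl⟩
      rw [rays_mk_monomial]
      exact (hTz z).1 z.2
  rw [hrange, ← Set.image_univ]
  have : PreconnectedSpace T := isPreconnected_iff_preconnectedSpace.1 hT
  exact isPreconnected_univ.image _ hF.continuousOn

end ToricOrbifold

namespace ToricOrbifold

section Analysis

open Metric

theorem differentiableAt_circleIntegral {E : Type*} [NormedAddCommGroup E] [NormedSpace ℂ E]
    [FiniteDimensional ℂ E] {Ψ : E × ℂ → ℂ} {x : E} {r ρ : ℝ} (hρ : 0 < ρ)
    (h : ∀ w ∈ closedBall x r, ∀ ζ ∈ sphere (0 : ℂ) ρ, DifferentiableAt ℂ Ψ (w, ζ))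
    {w₀ : E} (hw₀ : w₀ ∈ ball x r) :
    DifferentiableAt ℂ (fun w => ∮ ζ in C(0, ρ), Ψ (w, ζ)) w₀ := by
  have : ProperSpace E := FiniteDimensional.proper ℂ E
  let _ : MeasurableSpace E := borel E
  have : BorelSpace E := ⟨rfl⟩
  have hcirc : ∀ t : ℝ, circleMap 0 ρ t ∈ sphere (0 : ℂ) ρ := circleMap_mem_sphere 0 hρ.le
  obtain ⟨C, hC⟩ := ((isCompact_closedBall x r).prod (isCompact_sphere (0 : ℂ) ρ)).exists_bound_of_continuousOn
    (f := Ψ) (fun p hp => (h p.1 hp.1 p.2 hp.2).continuousAt.continuousWithinAt)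
  have hC' : ∀ w ∈ closedBall x r, ∀ ζ ∈ sphere (0 : ℂ) ρ, ‖Ψ (w, ζ)‖ ≤ C :=
    fun w hw ζ hζ => hC (w, ζ) ⟨hw, hζ⟩
  set δ := (r - dist w₀ x) / 2 with hδ
  have hδ0 : 0 < δ := by have := mem_ball.1 hw₀; linarith
  have hball : ∀ w ∈ ball w₀ δ, ball w δ ⊆ closedBall x r := by
    intro w hw y hy
    rw [mem_ball] at hw hy
    rw [mem_closedBall]
    have := dist_triangle4 y w w₀ x
    linarith
  have hd : ∀ w ∈ closedBall x r, ∀ ζ ∈ sphere (0 : ℂ) ρ,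
      HasFDerivAt (fun w => Ψ (w, ζ)) ((fderiv ℂ Ψ (w, ζ)).comp (.inl ℂ E ℂ)) w := by
    intro w hw ζ hζ
    have h1 : HasFDerivAt (fun w : E => (w, ζ)) (.inl ℂ E ℂ) w := hasFDerivAt_prodMk_left w ζ
    exact (h w hw ζ hζ).hasFDerivAt.comp w h1
  have hmem : ∀ w ∈ ball w₀ δ, w ∈ closedBall x r := fun w hw =>
    hball w hw (mem_ball_self hδ0)
  have hcont : ∀ w ∈ closedBall x r, Continuous fun t : ℝ =>
      deriv (circleMap 0 ρ) t • Ψ (w, circleMap 0 ρ t) := by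
    intro w hw
    have h1 : Continuous (deriv (circleMap 0 ρ)) := by
      rw [show deriv (circleMap 0 ρ) = fun t => circleMap 0 ρ t * Complex.I from
        funext fun t => deriv_circleMap 0 ρ t]
      fun_prop
    refine h1.smul (continuous_iff_continuousAt.2 fun t => ?_)
    have h2 : ContinuousAt (fun t : ℝ => (w, circleMap 0 ρ t)) t := by fun_prop
    exact ContinuousAt.comp (f := fun t : ℝ => (w, circleMap 0 ρ t)) (g := Ψ)
      (h w hw _ (hcirc t)).continuousAt h2
  refine (intervalIntegral.hasFDerivAt_integral_of_dominated_of_fderiv_le (𝕜 := ℂ)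
    (s := ball w₀ δ) (bound := fun _ => ρ * (2 * C / δ))
    (F := fun w t => deriv (circleMap 0 ρ) t • Ψ (w, circleMap 0 ρ t))
    (F' := fun w t => deriv (circleMap 0 ρ) t •
      (fderiv ℂ Ψ (w, circleMap 0 ρ t)).comp (.inl ℂ E ℂ))
    (ball_mem_nhds _ hδ0) ?_ ?_ ?_ ?_ ?_ ?_).differentiableAt
  · filter_upwards [ball_mem_nhds w₀ hδ0] with w hw
    exact (hcont w (hmem w hw)).aestronglyMeasurable
  · exact (hcont w₀ (hmem _ (mem_ball_self hδ0))).intervalIntegrable _ _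
  · have hfd : FiniteDimensional ℂ (E × ℂ →L[ℂ] ℂ) := inferInstance
    have hfp : ProperSpace (E × ℂ →L[ℂ] ℂ) := FiniteDimensional.proper ℂ _
    have h1 : Measurable fun t : ℝ => fderiv ℂ Ψ (w₀, circleMap 0 ρ t) :=
      (measurable_fderiv ℂ Ψ).comp (by fun_prop : Continuous fun t : ℝ => (w₀, circleMap 0 ρ t)).measurable
    have h2 : MeasureTheory.StronglyMeasurable fun t : ℝ => fderiv ℂ Ψ (w₀, circleMap 0 ρ t) :=
      h1.stronglyMeasurable
    have h3 : Continuous fun L : E × ℂ →L[ℂ] ℂ => L.comp (.inl ℂ E ℂ) := by fun_prop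
    have h4 : Continuous (deriv (circleMap 0 ρ)) := by
      rw [show deriv (circleMap 0 ρ) = fun t => circleMap 0 ρ t * Complex.I from
        funext fun t => deriv_circleMap 0 ρ t]
      fun_prop
    exact (h4.stronglyMeasurable.smul (h3.comp_stronglyMeasurable h2)).aestronglyMeasurable
  · refine Filter.Eventually.of_forall fun t _ w hw => ?_
    rw [norm_smul, deriv_circleMap, norm_mul, Complex.norm_I, mul_one, norm_circleMap_zero,
      abs_of_pos hρ]
    refine mul_le_mul_of_nonneg_left ?_ hρ.le
    rw [← (hd w (hmem w hw) _ (hcirc t)).fderiv]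
    refine Complex.norm_fderiv_le_div_of_mapsTo_ball (fun y hy =>
      (hd y (hball w hw hy) _ (hcirc t)).differentiableAt.differentiableWithinAt) ?_ hδ0
    intro y hy
    rw [mem_closedBall, dist_eq_norm]
    have h1 := hC' y (hball w hw hy) _ (hcirc t)
    have h2 := hC' w (hmem w hw) _ (hcirc t)
    exact (norm_sub_le _ _).trans (by linarith)
  · exact continuous_const.intervalIntegrable _ _
  · refine Filter.Eventually.of_forall fun t _ w hw => ?_
    exact (hd w (hmem w hw) _ (hcirc t)).const_smul (deriv (circleMap 0 ρ) t)

theorem exists_eventually_eq_sum_pow {ι : Type*} [Fintype ι] [DecidableEq ι] {F : (ι → ℂ) → ℂ}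
    {x : ι → ℂ}
    (hF : ∀ᶠ t in 𝓝 x, DifferentiableAt ℂ F t) {i : ι} (hi : x i = 0) {D : ℕ} (hD : 0 < D) :
    ∃ f : Fin D → (ι → ℂ) → ℂ, (∀ b, ∀ᶠ t in 𝓝 x, DifferentiableAt ℂ (f b) t) ∧
      ∀ᶠ z in 𝓝 x, F z = ∑ b : Fin D, z i ^ (b : ℕ) * f b (Function.update z i (z i ^ D)) := by
  obtain ⟨R, hR, hRF⟩ := Metric.nhds_basis_closedBall.eventually_iff.1 hF
  set r := min R (R ^ D) / 2 with hr
  have hRD : 0 < R ^ D := pow_pos hR D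
  have hr0 : 0 < r := half_pos (lt_min hR hRD)
  have hrR : r < R := (half_lt_self (lt_min hR hRD)).trans_le (min_le_left _ _)
  have hrRD : r < R ^ D := (half_lt_self (lt_min hR hRD)).trans_le (min_le_right _ _)
  have hupd : ∀ w ∈ closedBall x R, ∀ ζ ∈ closedBall (0 : ℂ) R,
      Function.update w i ζ ∈ closedBall x R := by
    intro w hw ζ hζ
    rw [mem_closedBall, dist_pi_le_iff hR.le] at hw ⊢
    intro k
    rcases eq_or_ne k i with rfl | hk
    · rw [Function.update_self, hi]; exact hζ
    · rw [Function.update_of_ne hk]; exact hw k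
  have hdu : ∀ p : (ι → ℂ) × ℂ, DifferentiableAt ℂ
      (fun p : (ι → ℂ) × ℂ => Function.update p.1 i p.2) p := by
    intro p
    refine differentiableAt_pi.2 fun k => ?_
    rcases eq_or_ne k i with rfl | hk
    · simp only [Function.update_self]; fun_prop
    · simp only [Function.update_of_ne hk]; fun_prop
  have hne : ∀ w ∈ closedBall x r, ∀ ζ ∈ sphere (0 : ℂ) R, ζ ^ D - w i ≠ 0 := by
    intro w hw ζ hζ h0
    rw [mem_closedBall, dist_pi_le_iff hr0.le] at hw
    have h1 := hw i
    rw [hi, dist_zero_right, ← sub_eq_zero.1 h0, norm_pow, mem_sphere_zero_iff_norm.1 hζ] at h1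
    linarith
  let Ψ : ℕ → (ι → ℂ) × ℂ → ℂ := fun b p =>
    F (Function.update p.1 i p.2) * p.2 ^ (D - 1 - b) * (p.2 ^ D - p.1 i)⁻¹
  have hΨ : ∀ b, ∀ w ∈ closedBall x r, ∀ ζ ∈ sphere (0 : ℂ) R, DifferentiableAt ℂ (Ψ b) (w, ζ) := by
    intro b w hw ζ hζ
    have hproj : DifferentiableAt ℂ (fun p : (ι → ℂ) × ℂ => p.1 i) (w, ζ) :=
      DifferentiableAt.comp (g := fun w : ι → ℂ => w i) (w, ζ) (differentiableAt_apply i _)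
        differentiableAt_fst
    have hpow : ∀ k : ℕ, DifferentiableAt ℂ (fun p : (ι → ℂ) × ℂ => p.2 ^ k) (w, ζ) :=
      fun k => by fun_prop
    have hcomp : DifferentiableAt ℂ (fun p : (ι → ℂ) × ℂ => F (Function.update p.1 i p.2)) (w, ζ) :=
      DifferentiableAt.comp (w, ζ) (g := F) (hRF (hupd w (closedBall_subset_closedBall hrR.le hw) ζ
        (sphere_subset_closedBall hζ))) (hdu _)
    have hinv : DifferentiableAt ℂ (fun p : (ι → ℂ) × ℂ => (p.2 ^ D - p.1 i)⁻¹) (w, ζ) :=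
      DifferentiableAt.comp (f := fun p : (ι → ℂ) × ℂ => p.2 ^ D - p.1 i) (g := fun z : ℂ => z⁻¹)
        (w, ζ) (differentiableAt_inv (hne w hw ζ hζ)) ((hpow D).fun_sub hproj)
    exact (hcomp.fun_mul (hpow (D - 1 - b))).fun_mul hinv
  refine ⟨fun b w => (2 * Real.pi * Complex.I)⁻¹ * ∮ ζ in C(0, R), Ψ b (w, ζ), fun b => ?_, ?_⟩
  · filter_upwards [ball_mem_nhds x hr0] with w hw
    exact (differentiableAt_circleIntegral hR (hΨ b) hw).const_mul _
  · have hcont : ContinuousAt (fun z : ι → ℂ => Function.update z i (z i ^ D)) x := by fun_prop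
    have hx : Function.update x i (x i ^ D) = x := by
      rw [hi, zero_pow hD.ne', ← hi, Function.update_eq_self]
    have hev : ∀ᶠ z in 𝓝 x, Function.update z i (z i ^ D) ∈ closedBall x r := by
      have := hcont.eventually (p := fun y => y ∈ closedBall x r)
        (by beta_reduce; rw [hx]; exact closedBall_mem_nhds x hr0)
      exact this
    filter_upwards [ball_mem_nhds x hR, hev] with z hz hzu
    have hzi : z i ∈ ball (0 : ℂ) R := by
      rw [mem_ball, dist_pi_lt_iff hR] at hz
      have := hz i
      rwa [hi] at this
    have hd : DifferentiableOn ℂ (fun ζ => F (Function.update z i ζ)) (closedBall 0 R) := by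
      intro ζ hζ
      refine DifferentiableAt.differentiableWithinAt ?_
      have h1 : DifferentiableAt ℂ (fun ζ : ℂ => Function.update z i ζ) ζ :=
        DifferentiableAt.comp (f := fun ζ : ℂ => (z, ζ)) ζ (hdu (z, ζ)) (by fun_prop)
      exact DifferentiableAt.comp (g := F) ζ (hRF (hupd z (ball_subset_closedBall hz) ζ hζ)) h1
    have hcauchy := hd.circleIntegral_sub_inv_smul hzi
    rw [Function.update_eq_self] at hcauchy
    have hpi : (2 * Real.pi * Complex.I : ℂ) ≠ 0 := Complex.two_pi_I_ne_zero
    have hΨc : ∀ b : ℕ, ContinuousOn (fun ζ => Ψ b (Function.update z i (z i ^ D), ζ))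
        (sphere 0 R) := by
      intro b ζ hζ
      refine ContinuousAt.continuousWithinAt ?_
      exact ContinuousAt.comp (f := fun ζ : ℂ => (Function.update z i (z i ^ D), ζ)) (g := Ψ b)
        (hΨ b _ hzu ζ hζ).continuousAt (by fun_prop)
    have hsum : ∑ b : Fin D, z i ^ (b : ℕ) * ∮ ζ in C(0, R), Ψ b (Function.update z i (z i ^ D), ζ) =
        ∮ ζ in C(0, R), (ζ - z i)⁻¹ • F (Function.update z i ζ) := by
      have h1 : ∀ b : Fin D, z i ^ (b : ℕ) * ∮ ζ in C(0, R), Ψ b (Function.update z i (z i ^ D), ζ) =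
          ∮ ζ in C(0, R), z i ^ (b : ℕ) * Ψ b (Function.update z i (z i ^ D), ζ) :=
        fun b => (circleIntegral.integral_const_mul _ _ _ _).symm
      simp_rw [h1]
      rw [← circleIntegral.integral_fun_sum]
      · refine circleIntegral.integral_congr hR.le fun ζ hζ => ?_
        have hne' := hne _ hzu ζ hζ
        rw [Function.update_self] at hne'
        have hg := Commute.geom_sum₂_mul (Commute.all (z i) ζ) D
        have hne2 : ζ - z i ≠ 0 := by
          intro h0
          rw [sub_eq_zero.1 h0, sub_self] at hne'
          exact hne' rfl
        simp only [Ψ, Function.update_idem, Function.update_self, smul_eq_mul]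
        rw [← Fin.sum_univ_eq_sum_range (fun b => z i ^ b * ζ ^ (D - 1 - b))] at hg
        have : ∀ b : Fin D, z i ^ (b : ℕ) * (F (Function.update z i ζ) * ζ ^ (D - 1 - (b : ℕ)) *
            (ζ ^ D - z i ^ D)⁻¹) = (z i ^ (b : ℕ) * ζ ^ (D - 1 - (b : ℕ))) *
              (F (Function.update z i ζ) * (ζ ^ D - z i ^ D)⁻¹) := fun b => by ring
        simp_rw [this]
        rw [← Finset.sum_mul]
        field_simp
        linear_combination (-F (Function.update z i ζ)) * hg
      · intro b _
        exact (continuousOn_const.mul (hΨc b)).circleIntegrable hR.le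
    have : ∀ b : Fin D, z i ^ (b : ℕ) * ((2 * Real.pi * Complex.I)⁻¹ *
        ∮ ζ in C(0, R), Ψ b (Function.update z i (z i ^ D), ζ)) = (2 * Real.pi * Complex.I)⁻¹ *
        (z i ^ (b : ℕ) * ∮ ζ in C(0, R), Ψ b (Function.update z i (z i ^ D), ζ)) := fun b => by ring
    simp_rw [this]
    rw [← Finset.mul_sum, hsum, hcauchy, smul_eq_mul, inv_mul_cancel_left₀ hpi]

end Analysis

end ToricOrbifold

namespace ToricOrbifold

section Analysis

theorem exists_local_root {x : ℂ} (hx : x ≠ 0) {D : ℕ} (hD : 0 < D) :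
    ∃ ρ : ℂ → ℂ, (∀ᶠ t in 𝓝 (x ^ D), DifferentiableAt ℂ ρ t) ∧ ∀ᶠ z in 𝓝 x, ρ (z ^ D) = z := by
  have hxD : x ^ D ≠ 0 := pow_ne_zero _ hx
  refine ⟨fun t => x * Complex.exp (Complex.log (t / x ^ D) / D), ?_, ?_⟩
  · have : ∀ᶠ t in 𝓝 (x ^ D), t / x ^ D ∈ Complex.slitPlane := by
      have hc : ContinuousAt (fun t : ℂ => t / x ^ D) (x ^ D) := by fun_prop
      refine hc.eventually_mem (Complex.isOpen_slitPlane.mem_nhds ?_)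
      simp [div_self hxD]
    filter_upwards [this] with t ht
    have h1 : DifferentiableAt ℂ (fun t : ℂ => t / x ^ D) t := by fun_prop
    exact (((h1.clog ht).div_const _).cexp).const_mul x
  · have hc : ContinuousAt (fun z : ℂ => (D : ℝ) * Complex.arg (z / x)) x := by
      refine continuousAt_const.mul ?_
      refine ContinuousAt.comp (f := fun z : ℂ => z / x) (g := Complex.arg)
        (Complex.continuousAt_arg ?_) (by fun_prop)
      simp [div_self hx]
    have h1 : ∀ᶠ z in 𝓝 x, (D : ℝ) * Complex.arg (z / x) ∈ Set.Ioo (-Real.pi) Real.pi := by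
      refine hc.eventually_mem (isOpen_Ioo.mem_nhds ?_)
      simp [div_self hx, Real.pi_pos]
    filter_upwards [h1, isOpen_ne.mem_nhds hx] with z hz hz0
    have him : ((D : ℂ) * Complex.log (z / x)).im = D * Complex.arg (z / x) := by
      rw [← Complex.ofReal_natCast, Complex.im_ofReal_mul, Complex.log_im]
    have hlog : Complex.log ((z / x) ^ D) = D * Complex.log (z / x) := by
      conv_lhs => rw [← Complex.exp_log (div_ne_zero hz0 hx), ← Complex.exp_nat_mul]
      exact Complex.log_exp (him ▸ hz.1) (him ▸ hz.2.le)
    rw [← div_pow, hlog, mul_div_cancel_left₀ _ (Nat.cast_ne_zero.2 hD.ne'),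
      Complex.exp_log (div_ne_zero hz0 hx)]
    field_simp

variable {ι : Type*} [DecidableEq ι]

/-- The map which raises the coordinates in `S` to the power `D`. -/
def powOn (S : Finset ι) (D : ℕ) (z : ι → ℂ) (i : ι) : ℂ := if i ∈ S then z i ^ D else z i

theorem continuous_powOn (S : Finset ι) (D : ℕ) : Continuous (powOn S D) := by
  refine continuous_pi fun i => ?_
  unfold powOn
  split_ifs <;> fun_prop

theorem powOn_self {S : Finset ι} {D : ℕ} (hD : 0 < D) {x : ι → ℂ} (hx : ∀ i ∈ S, x i = 0) :
    powOn S D x = x := by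
  ext i
  unfold powOn
  split_ifs with h
  · rw [hx i h, zero_pow hD.ne']
  · rfl

variable [Fintype ι]

theorem exists_eventually_eq_sum_monomial {F : (ι → ℂ) → ℂ} {x : ι → ℂ}
    (hF : ∀ᶠ t in 𝓝 x, DifferentiableAt ℂ F t) {D : ℕ} (hD : 0 < D) (S : Finset ι)
    (hx : ∀ i ∈ S, x i = 0) :
    ∃ (J : Type) (_ : Fintype J) (β : J → ι → ℕ) (f : J → (ι → ℂ) → ℂ),
      (∀ j, ∀ i ∉ S, β j i = 0) ∧ (∀ j, ∀ᶠ t in 𝓝 x, DifferentiableAt ℂ (f j) t) ∧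
      ∀ᶠ z in 𝓝 x, F z = ∑ j, (∏ i, z i ^ β j i) * f j (powOn S D z) := by
  induction S using Finset.induction_on with
  | empty =>
    refine ⟨Unit, inferInstance, fun _ _ => 0, fun _ => F, fun _ _ _ => rfl, fun _ => hF,
      Filter.Eventually.of_forall fun z => ?_⟩
    have : powOn ∅ D z = z := by ext i; simp [powOn]
    simp [this]
  | insert i S hi ih =>
    obtain ⟨J, _, β, f, hβ, hf, hsum⟩ := ih fun k hk => hx k (Finset.mem_insert_of_mem hk)
    have hxi := hx i (Finset.mem_insert_self _ _)
    choose g hg hgs using fun j => exists_eventually_eq_sum_pow (hf j) hxi hD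
    refine ⟨J × Fin D, inferInstance, fun p => Function.update (β p.1) i p.2, fun p => g p.1 p.2,
      fun p k hk => ?_, fun p => hg _ _, ?_⟩
    · rw [Finset.mem_insert, not_or] at hk
      beta_reduce
      rw [Function.update_of_ne hk.1, hβ _ _ hk.2]
    · have hS : powOn S D x = x := powOn_self hD fun k hk => hx k (Finset.mem_insert_of_mem hk)
      have hev : ∀ᶠ z in 𝓝 x, ∀ j, f j (powOn S D z) = ∑ b : Fin D, (powOn S D z) i ^ (b : ℕ) *
          g j b (Function.update (powOn S D z) i ((powOn S D z) i ^ D)) := by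
        refine Filter.eventually_all.2 fun j => ?_
        have ht := (continuous_powOn S D).tendsto x
        rw [hS] at ht
        exact ht.eventually (hgs j)
      filter_upwards [hsum, hev] with z hz hz'
      rw [hz, Fintype.sum_prod_type]
      refine Finset.sum_congr rfl fun j _ => ?_
      rw [hz' j, Finset.mul_sum]
      refine Finset.sum_congr rfl fun b _ => ?_
      have h1 : powOn S D z i = z i := if_neg hi
      have h2 : Function.update (powOn S D z) i (z i ^ D) = powOn (insert i S) D z := by
        ext k
        rcases eq_or_ne k i with rfl | hk
        · simp [powOn]
        · simp [powOn, hk]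
      rw [h1, h2, ← mul_assoc]
      congr 1
      rw [← Finset.mul_prod_erase _ _ (Finset.mem_univ i),
        ← Finset.mul_prod_erase _ (fun k => z k ^ Function.update (β j) i (b : ℕ) k)
          (Finset.mem_univ i), Function.update_self, hβ j i hi, pow_zero, one_mul, mul_comm]
      congr 1
      exact Finset.prod_congr rfl fun k hk => by rw [Function.update_of_ne (Finset.ne_of_mem_erase hk)]

/-- A holomorphic function which is invariant under a finite group of diagonal matrices is a sum of
invariant monomials times functions of powers of the coordinates. -/
theorem exists_eventually_eq_sum_invariant {G : Type*} [Group G] [Finite G] (p : G →* (ι → ℂ))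
    {F : (ι → ℂ) → ℂ} {x : ι → ℂ}
    (hF : ∀ᶠ t in 𝓝 x, DifferentiableAt ℂ F t) {D : ℕ} (hD : 0 < D) {S : Finset ι}
    (hx : ∀ i ∈ S, x i = 0) (hpD : ∀ g i, p g i ^ D = 1) (hp1 : ∀ g, ∀ i ∉ S, p g i = 1)
    (hinv : ∀ g, ∀ᶠ z in 𝓝 x, F (p g * z) = F z) :
    ∃ (J : Type) (_ : Fintype J) (β : J → ι → ℕ) (f : J → (ι → ℂ) → ℂ),
      (∀ j, ∀ i ∉ S, β j i = 0) ∧ (∀ j, ∀ g, ∏ i, p g i ^ β j i = 1) ∧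
      (∀ j, ∀ᶠ t in 𝓝 x, DifferentiableAt ℂ (f j) t) ∧
      ∀ᶠ z in 𝓝 x, F z = ∑ j, (∏ i, z i ^ β j i) * f j (powOn S D z) := by
  classical
  have := Fintype.ofFinite G
  obtain ⟨J, _, β, f, hβ, hf, hsum⟩ := exists_eventually_eq_sum_monomial hF hD S hx
  refine ⟨{j : J // ∀ g, ∏ i, p g i ^ β j i = 1}, inferInstance, fun j => β j.1, fun j => f j.1,
    fun j => hβ j.1, fun j => j.2, fun j => hf j.1, ?_⟩
  have hev : ∀ᶠ z in 𝓝 x, ∀ g : G, F (p g * z) = ∑ j, (∏ i, (p g * z) i ^ β j i) *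
      f j (powOn S D (p g * z)) := by
    refine Filter.eventually_all.2 fun g => ?_
    have hgx : p g * x = x := by
      ext i
      rw [Pi.mul_apply]
      by_cases hi : i ∈ S
      · rw [hx i hi, mul_zero]
      · rw [hp1 g i hi, one_mul]
    have ht : Filter.Tendsto (fun z => p g * z) (𝓝 x) (𝓝 (p g * x)) :=
      (by fun_prop : Continuous fun z => p g * z).tendsto x
    rw [hgx] at ht
    exact ht.eventually hsum
  let χ : J → G →* ℂ := fun j =>
    { toFun := fun g => ∏ i, p g i ^ β j i
      map_one' := by simp
      map_mul' := fun g h => by simp [mul_pow, Finset.prod_mul_distrib] }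
  have hχ : ∀ j, ∑ g, χ j g = if (∀ g, ∏ i, p g i ^ β j i = 1) then (Fintype.card G : ℂ) else 0 := by
    intro j
    split_ifs with h
    · have : ∀ g, χ j g = 1 := h
      simp [this]
    · exact sum_hom_units_eq_zero _ fun h1 => h fun g => DFunLike.congr_fun h1 g
  have hcard : (Fintype.card G : ℂ) ≠ 0 := Nat.cast_ne_zero.2 Fintype.card_ne_zero
  filter_upwards [hev, Filter.eventually_all.2 hinv] with z hz hz'
  have hpow : ∀ g, powOn S D (p g * z) = powOn S D z := by
    intro g
    ext i
    simp only [powOn, Pi.mul_apply]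
    split_ifs with h
    · rw [mul_pow, hpD, one_mul]
    · rw [hp1 g i h, one_mul]
  refine mul_left_cancel₀ hcard ?_
  calc (Fintype.card G : ℂ) * F z = ∑ g : G, F (p g * z) := by simp [hz']
    _ = ∑ g, ∑ j, χ j g * ((∏ i, z i ^ β j i) * f j (powOn S D z)) := by
      refine Finset.sum_congr rfl fun g _ => ?_
      rw [hz g]
      refine Finset.sum_congr rfl fun j _ => ?_
      rw [hpow, ← mul_assoc]
      congr 1
      simp [χ, mul_pow, Finset.prod_mul_distrib]
    _ = ∑ j, (∑ g, χ j g) * ((∏ i, z i ^ β j i) * f j (powOn S D z)) := by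
      rw [Finset.sum_comm]
      exact Finset.sum_congr rfl fun j _ => by rw [Finset.sum_mul]
    _ = _ := by
      simp_rw [hχ, ite_mul, zero_mul]
      rw [← Finset.sum_filter, ← Finset.sum_subtype_eq_sum_filter, Finset.mul_sum]
      exact Finset.sum_congr (by ext; simp) fun _ _ => rfl

end Analysis

end ToricOrbifold

namespace ToricOrbifold

theorem differentiableAt_prod {ι E : Type*} [NormedAddCommGroup E] [NormedSpace ℂ E]
    {f : ι → E → ℂ} {x : E} (s : Finset ι) (h : ∀ i, DifferentiableAt ℂ (f i) x) :
    DifferentiableAt ℂ (fun y => ∏ i ∈ s, f i y) x := by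
  classical
  induction s using Finset.induction_on with
  | empty => simp
  | insert i s hi ih =>
    simp only [Finset.prod_insert hi]
    exact (h i).fun_mul ih

variable {N : Type u} [AddCommGroup N]

namespace ChartIndex

variable {Ξ : Fan N} (c : ChartIndex Ξ)

theorem coord_add (v v' : N) (l) : c.coord (v + v') l = c.coord v l + c.coord v' l := by
  simp [coord, latt_add]

theorem coord_w (k l) : c.coord (c.w k) l = if k = l then 1 else 0 := by
  rw [coord, repr_w]

variable {c} in
theorem phase_pow_eq_one {D : ℕ} {μ : Module.Dual ℤ N} {l}
    (hμ : ∀ k, μ (c.w k) = if k = l then (D : ℤ) else 0) (g : Multiplicative (N ⧸ c.sublattice)) :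
    c.phase g l ^ D = 1 := by
  have h : (D : ℝ) * c.coord (c.boxVec g) l = μ (c.boxVec g) := by
    rw [← c.sum_mul_repr μ, Finset.sum_eq_single l]
    · rw [hμ, if_pos rfl]; rfl
    · intro k _ hk
      rw [hμ, if_neg hk]; simp
    · simp
  rw [phase_eq_exp, ← Complex.exp_nat_mul, Complex.exp_eq_one_iff]
  refine ⟨μ (c.boxVec g), ?_⟩
  have h' : ((D : ℝ) * c.coord (c.boxVec g) l : ℂ) = ((μ (c.boxVec g) : ℝ) : ℂ) := by
    exact_mod_cast h
  push_cast at h'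
  linear_combination (2 * Real.pi * Complex.I) * h'

variable [Module.Finite ℤ N]

theorem exists_dual_extension {S : Finset (Fin (Module.finrank ℤ N))}
    {β : Fin (Module.finrank ℤ N) → ℤ}
    (h : ∀ v : N, (∀ l ∉ S, c.coord v l = 0) → ∃ k : ℤ, ∑ l ∈ S, β l * c.coord v l = k) :
    ∃ m : Module.Dual ℤ N, ∀ l ∈ S, m (c.w l) = β l := by
  classical
  let f : N →ₗ[ℤ] (Fin (Module.finrank ℤ N) → ℝ) := AddMonoidHom.toIntLinearMap
    (AddMonoidHom.mk' (fun v l => if l ∈ S then 0 else c.coord v l) fun a b => by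
      ext l
      simp only [Pi.add_apply]
      split_ifs
      · simp
      · exact c.coord_add a b l)
  have hf : ∀ v l, f v l = if l ∈ S then 0 else c.coord v l := fun _ _ => rfl
  obtain ⟨s, hs⟩ := Module.projective_lifting_property f.rangeRestrict LinearMap.id
    f.surjective_rangeRestrict
  have hs' : ∀ v, f (s (f.rangeRestrict v)) = f v := fun v =>
    congrArg Subtype.val (LinearMap.congr_fun hs (f.rangeRestrict v))
  have hr : ∀ v, ∃ k : ℤ, ∑ l ∈ S, β l * c.coord (v - s (f.rangeRestrict v)) l = k := by
    refine fun v => h _ fun l hl => ?_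
    have := congrFun (hs' v) l
    rw [hf, hf, if_neg hl, if_neg hl] at this
    rw [coord_sub, this, sub_self]
  choose k hk using hr
  refine ⟨AddMonoidHom.toIntLinearMap (AddMonoidHom.mk' k fun a b => ?_), fun l hl => ?_⟩
  · have : ((k (a + b) : ℤ) : ℝ) = ((k a + k b : ℤ) : ℝ) := by
      rw [Int.cast_add, ← hk, ← hk, ← hk, ← Finset.sum_add_distrib]
      refine Finset.sum_congr rfl fun l _ => ?_
      rw [map_add, map_add, coord_sub, coord_sub, coord_sub, coord_add, coord_add]
      ring
    exact_mod_cast this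
  · change k (c.w l) = β l
    have h0 : f.rangeRestrict (c.w l) = 0 := by
      refine Subtype.ext (funext fun j => ?_)
      change f (c.w l) j = 0
      rw [hf, coord_w]
      split_ifs with h1 h2
      · rfl
      · exact absurd (h2 ▸ hl) h1
      · rfl
    have := hk (c.w l)
    rw [h0, map_zero, sub_zero, Finset.sum_eq_single l] at this
    · rw [coord_w, if_pos rfl, mul_one] at this
      exact_mod_cast this.symm
    · intro j _ hj
      rw [coord_w, if_neg hj.symm, mul_zero]
    · exact fun h => absurd hl h

variable [Module.Free ℤ N] {c}

theorem exists_dual_extending_invariant {x : c.chart.dom} {β : Fin (Module.finrank ℤ N) → ℕ}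
    (hinv : ∀ g ∈ c.chart.isotropy x, ∏ l, c.phase g l ^ β l = 1) :
    ∃ m : Module.Dual ℤ N, ∀ l, x.1 l = 0 → m (c.w l) = β l := by
  classical
  obtain ⟨m, hm⟩ := c.exists_dual_extension (S := {l | x.1 l = 0}) (β := fun l => β l) (by
    intro v hv
    simp only [Finset.mem_filter_univ] at hv
    have hg : c.cls v ∈ c.chart.isotropy x := act_eq_self_iff.2 fun l hl => by
      rw [phase_cls, hv l hl]; simp
    have h1 := hinv _ hg
    simp_rw [phase_cls, ← Complex.exp_nat_mul] at h1
    rw [← Complex.exp_sum, Complex.exp_eq_one_iff] at h1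
    obtain ⟨k, hk⟩ := h1
    refine ⟨k, ?_⟩
    have hpi : (2 * Real.pi * Complex.I : ℂ) ≠ 0 := Complex.two_pi_I_ne_zero
    have h2 : ((∑ l, (β l : ℝ) * c.coord v l : ℝ) : ℂ) = (k : ℝ) := by
      refine mul_right_cancel₀ hpi ?_
      push_cast
      rw [← hk, Finset.sum_mul]
      exact Finset.sum_congr rfl fun l _ => by ring
    rw [← Complex.ofReal_injective h2]
    simp only [Int.cast_natCast]
    refine Finset.sum_subset (Finset.subset_univ _) fun l _ hl => ?_
    rw [hv l (by simpa using hl), mul_zero])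
  exact ⟨m, fun l hl => hm l (by simpa using hl)⟩

/-- A holomorphic function which is invariant under the isotropy group is locally a holomorphic
function of finitely many characters. -/
theorem exists_eventually_eq_comp_val {x : c.chart.dom} {F : (Fin (Module.finrank ℤ N) → ℂ) → ℂ}
    (hF : ∀ᶠ t in 𝓝 x.1, DifferentiableAt ℂ F t)
    (hinv : ∀ g ∈ c.chart.isotropy x, ∀ᶠ z in 𝓝 x.1, F (c.act g z) = F z) :
    ∃ (k : ℕ) (m : Fin k → Module.Dual ℤ N) (Φ : (Fin k → ℂ) → ℂ),
      (∀ j l, x.1 l = 0 → 0 ≤ m j (c.w l)) ∧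
      (∀ᶠ t in 𝓝 (fun j => c.val x.1 (m j)), DifferentiableAt ℂ Φ t) ∧
      ∀ᶠ z in 𝓝 x.1, F z = Φ fun j => c.val z (m j) := by
  classical
  obtain ⟨D, hD, hdual⟩ := c.exists_dual_basis
  choose μ hμ using hdual
  let S : Finset (Fin (Module.finrank ℤ N)) := {l | x.1 l = 0}
  have hS : ∀ l, l ∈ S ↔ x.1 l = 0 := fun l => by simp [S]
  let p : c.chart.isotropy x →* (Fin (Module.finrank ℤ N) → ℂ) :=
    { toFun := fun g => c.phase g.1
      map_one' := c.phase_one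
      map_mul' := fun g h => c.phase_mul g.1 h.1 }
  obtain ⟨J, _, β, f, hβ, hβinv, hf, hsum⟩ := exists_eventually_eq_sum_invariant p hF hD (S := S)
    (fun l hl => (hS l).1 hl) (fun g l => phase_pow_eq_one (hμ l) g.1)
    (fun g l hl => act_eq_self_iff.1 g.2 l fun h => hl ((hS l).2 h)) (fun g => hinv g.1 g.2)
  choose m hm using fun j => exists_dual_extending_invariant (x := x) (β := β j) fun g hg => hβinv j ⟨g, hg⟩
  have hroot : ∀ l, ∃ ρ : ℂ → ℂ, (∀ᶠ t in 𝓝 (x.1 l ^ D), DifferentiableAt ℂ ρ t) ∧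
      ∀ᶠ z in 𝓝 (x.1 l), ρ (z ^ D) = if l ∈ S then z ^ D else z := by
    intro l
    by_cases hl : x.1 l = 0
    · refine ⟨id, Filter.Eventually.of_forall fun _ => differentiableAt_id, ?_⟩
      simp [(hS l).2 hl]
    · simpa [hS, hl] using exists_local_root hl hD
  choose ρ hρ hρ' using hroot
  let R : (Fin (Module.finrank ℤ N) ⊕ J → ℂ) → Fin (Module.finrank ℤ N) → ℂ :=
    fun t l => ρ l (t (.inl l))
  let ev : (Fin (Module.finrank ℤ N) → ℂ) → Fin (Module.finrank ℤ N) ⊕ J → ℂ :=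
    fun z i => c.val z (Sum.elim μ m i)
  have hval : ∀ z l, c.val z (μ l) = z l ^ D := by
    intro z l
    rw [val, Finset.prod_eq_single l]
    · rw [hμ, if_pos rfl, zpow_natCast]
    · intro k _ hk
      rw [hμ, if_neg hk, zpow_zero]
    · simp
  have hRev : ∀ᶠ z in 𝓝 x.1, R (ev z) = powOn S D z := by
    have : ∀ᶠ z in 𝓝 x.1, ∀ l, ρ l (z l ^ D) = if l ∈ S then z l ^ D else z l :=
      Filter.eventually_all.2 fun l => ((continuous_apply l).tendsto x.1).eventually (hρ' l)
    filter_upwards [this] with z hz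
    ext l
    change ρ l (c.val z (μ l)) = _
    rw [hval, hz l]
    rfl
  have hRx : R (ev x.1) = x.1 :=
    hRev.self_of_nhds.trans (powOn_self hD fun l hl => (hS l).1 hl)
  let P : J → (Fin (Module.finrank ℤ N) → ℂ) → ℂ := fun j y =>
    ∏ l, if l ∈ S then 1 else y l ^ (-(m j (c.w l)))
  let Φ : (Fin (Module.finrank ℤ N) ⊕ J → ℂ) → ℂ := fun t =>
    ∑ j, t (.inr j) * (P j (R t) * f j (R t))
  have hR : ∀ᶠ t in 𝓝 (ev x.1), DifferentiableAt ℂ R t := by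
    have : ∀ᶠ t in 𝓝 (ev x.1), ∀ l, DifferentiableAt ℂ (ρ l) (t (.inl l)) := by
      refine Filter.eventually_all.2 fun l => ?_
      have h1 : Filter.Tendsto (fun t : Fin (Module.finrank ℤ N) ⊕ J → ℂ => t (.inl l))
          (𝓝 (ev x.1)) (𝓝 (ev x.1 (.inl l))) := (continuous_apply _).tendsto _
      have h2 : ev x.1 (.inl l) = x.1 l ^ D := hval _ _
      rw [h2] at h1
      exact h1.eventually (hρ l)
    filter_upwards [this] with t ht
    exact differentiableAt_pi.2 fun l => DifferentiableAt.comp (g := ρ l) t (ht l)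
      (differentiableAt_apply _ _)
  have hΦ : ∀ᶠ t in 𝓝 (ev x.1), DifferentiableAt ℂ Φ t := by
    have hRc : Filter.Tendsto R (𝓝 (ev x.1)) (𝓝 x.1) := by
      have := hR.self_of_nhds.continuousAt.tendsto
      rwa [hRx] at this
    have h1 := hRc.eventually (Filter.eventually_all.2 hf)
    have h2 : ∀ᶠ y in 𝓝 x.1, ∀ l, l ∉ S → y l ≠ 0 := by
      refine Filter.eventually_all.2 fun l => ?_
      by_cases hl : l ∈ S
      · simp [hl]
      · have : x.1 l ≠ 0 := fun h => hl ((hS l).2 h)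
        filter_upwards [((continuous_apply l).tendsto x.1).eventually (isOpen_ne.mem_nhds this)]
          with y hy _ using hy
    filter_upwards [h1, hRc.eventually h2, hR] with t ht1 ht2 ht3
    have hRl : ∀ l, DifferentiableAt ℂ (fun t => R t l) t := differentiableAt_pi.1 ht3
    have hP : ∀ j, DifferentiableAt ℂ (fun t => P j (R t)) t := by
      intro j
      refine differentiableAt_prod Finset.univ fun l => ?_
      by_cases hl : l ∈ S
      · simp only [hl, if_true]; exact differentiableAt_const _
      · simp only [hl, if_false]
        exact DifferentiableAt.comp (g := fun y : ℂ => y ^ (-(m j (c.w l)))) t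
          (differentiableAt_zpow.2 (Or.inl (ht2 l hl))) (hRl l)
    refine DifferentiableAt.fun_sum fun j _ => (differentiableAt_apply _ _).fun_mul
      ((hP j).fun_mul ?_)
    exact DifferentiableAt.comp (g := f j) t (ht1 j) ht3
  have hFΦ : ∀ᶠ z in 𝓝 x.1, F z = Φ (ev z) := by
    have h2 : ∀ᶠ y in 𝓝 x.1, ∀ l, l ∉ S → y l ≠ 0 := by
      refine Filter.eventually_all.2 fun l => ?_
      by_cases hl : l ∈ S
      · simp [hl]
      · have : x.1 l ≠ 0 := fun h => hl ((hS l).2 h)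
        filter_upwards [((continuous_apply l).tendsto x.1).eventually (isOpen_ne.mem_nhds this)]
          with y hy _ using hy
    filter_upwards [hsum, hRev, h2] with z hz1 hz2 hz3
    rw [hz1]
    refine Finset.sum_congr rfl fun j _ => ?_
    rw [hz2, ← mul_assoc]
    congr 1
    change _ = c.val z (m j) * ∏ l, _
    rw [val, ← Finset.prod_mul_distrib]
    refine Finset.prod_congr rfl fun l _ => ?_
    split_ifs with hl
    · rw [mul_one, hm j l ((hS l).1 hl), zpow_natCast]
    · have : powOn S D z l = z l := if_neg hl
      rw [hβ j l hl, this, zpow_neg, mul_inv_cancel₀ (zpow_ne_zero _ (hz3 l hl)), pow_zero]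
  let e := (Fintype.equivFin (Fin (Module.finrank ℤ N) ⊕ J)).symm
  refine ⟨_, fun j => Sum.elim μ m (e j), fun t => Φ fun i => t (e.symm i), ?_, ?_, ?_⟩
  · intro j l hl
    beta_reduce
    rcases e j with k | k
    · rw [Sum.elim_inl, hμ]; split_ifs <;> simp
    · rw [Sum.elim_inr, hm k l hl]; simp
  · have h1 : Filter.Tendsto (fun (t : Fin _ → ℂ) i => t (e.symm i))
        (𝓝 fun j => c.val x.1 (Sum.elim μ m (e j)))
        (𝓝 fun i => c.val x.1 (Sum.elim μ m (e (e.symm i)))) :=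
      (by fun_prop : Continuous fun (t : Fin _ → ℂ) i => t (e.symm i)).tendsto _
    simp only [Equiv.apply_symm_apply] at h1
    filter_upwards [h1.eventually hΦ] with t ht
    have h2 : DifferentiableAt ℂ (fun (t : Fin _ → ℂ) i => t (e.symm i)) t := by fun_prop
    exact DifferentiableAt.comp (g := Φ) t ht h2
  · filter_upwards [hFΦ] with z hz
    rw [hz]
    simp only [Equiv.apply_symm_apply]
    rfl

end ChartIndex

end ToricOrbifold

namespace ToricOrbifold

variable {N : Type u} [AddCommGroup N]

section Box

variable {Ξ : Fan N} {c : ChartIndex Ξ}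

namespace ChartIndex

theorem coord_eq_of_isBoxRepr {τ : PointedCone ℝ (ℝ ⊗[ℤ] N)} {v : N} {a : N →₀ ℝ}
    (hR : rayGenerators τ ⊆ Set.range c.w) (h : IsBoxRepr τ v a) (l) :
    c.coord v l = a (c.w l) := by
  classical
  refine c.coord_eq_of_sum (a := fun l => a (c.w l)) ?_ l
  have hs : a.support ⊆ Finset.univ.image c.w := by
    intro ρ hρ
    have : ρ ∈ (a.support : Set N) := hρ
    rw [h.1] at this
    obtain ⟨l, rfl⟩ := hR this
    exact Finset.mem_image_of_mem _ (Finset.mem_univ _)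
  rw [h.2.2, Finsupp.sum_of_support_subset _ hs _ (by simp),
    Finset.sum_image fun _ _ _ _ h => c.w_injective h]

theorem coord_mem_Ico_of_isBoxRepr {τ : PointedCone ℝ (ℝ ⊗[ℤ] N)} {v : N} {a : N →₀ ℝ}
    (hR : rayGenerators τ ⊆ Set.range c.w) (h : IsBoxRepr τ v a) (l) :
    c.coord v l ∈ Set.Ico (0 : ℝ) 1 := by
  rw [coord_eq_of_isBoxRepr hR h]
  by_cases hl : c.w l ∈ rayGenerators τ
  · exact Set.Ioo_subset_Ico_self (h.2.1 _ hl)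
  · rw [← h.1, Finset.mem_coe, Finsupp.notMem_support_iff] at hl
    rw [hl]; simp

theorem coord_ne_zero_iff_of_mem_box {τ : PointedCone ℝ (ℝ ⊗[ℤ] N)} {v : N}
    (hR : rayGenerators τ ⊆ Set.range c.w) (hv : v ∈ box τ) {l} :
    c.coord v l ≠ 0 ↔ c.w l ∈ rayGenerators τ := by
  obtain ⟨a, h⟩ := hv
  rw [coord_eq_of_isBoxRepr hR h, ← h.1, Finset.mem_coe, Finsupp.mem_support_iff]

theorem rays_subset_range {τ : Ξ.cones} (h : τ.1 ≤ c.cone.1) :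
    rayGenerators τ.1 ⊆ Set.range c.w := by
  refine Set.Subset.trans ?_ c.rays_subset
  rw [rayGenerators_trans (Fan.isFaceOf_of_le h)]
  exact fun v hv => hv.1

end ChartIndex

/-- The points of the box of `τ` lie in the relative interior of `τ`. -/
theorem Fan.IsSimplicial.le_of_latt_mem (hΞ : Ξ.IsSimplicial) {σ τ : Ξ.cones} {v : N}
    (hv : v ∈ box τ.1) (h : latt v ∈ σ.1) [Module.Free ℤ N] [Module.Finite ℤ N] :
    τ.1 ≤ σ.1 := by
  classical
  obtain ⟨a, ha1, ha2, ha3⟩ := hv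
  have hray : ∀ ρ ∈ a.support, latt ρ ∈ τ.1 := fun ρ hρ =>
    rayGenerators_subset_cone (ha1 ▸ hρ)
  have ha0 : ∀ ρ ∈ a.support, 0 < a ρ := fun ρ hρ => (ha2 ρ (ha1 ▸ hρ)).1
  have hmem : ∀ s ⊆ a.support, ∑ ρ ∈ s, a ρ • latt ρ ∈ τ.1 := fun s hs =>
    Submodule.sum_mem _ fun ρ hρ =>
      Submodule.smul_mem _ (⟨a ρ, (ha0 ρ (hs hρ)).le⟩ : {r : ℝ // 0 ≤ r}) (hray ρ (hs hρ))
  have hvτ : latt v ∈ σ.1 ⊓ τ.1 := ⟨h, by rw [ha3]; exact hmem _ subset_rfl⟩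
  rw [(hΞ.rays_spec τ).2]
  refine Submodule.span_le.2 ?_
  rintro _ ⟨ρ, hρ, rfl⟩
  have hρ' : ρ ∈ a.support := by rw [← ha1] at hρ; exact hρ
  refine ((Ξ.inf_isFaceOf σ.1 σ.2 τ.1 τ.2).2.mem_of_smul_add_mem (hray ρ hρ')
    (hmem (a.support.erase ρ) (Finset.erase_subset _ _)) (ha0 ρ hρ') ?_).1
  rw [Finset.add_sum_erase _ (fun ρ => a ρ • latt ρ) hρ']
  rw [ha3] at hvτ
  exact hvτ

end Box

variable [Module.Free ℤ N] {Ξ : Fan N}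

namespace ChartIndex

variable {c : ChartIndex Ξ}

theorem boxVec_cls_of_mem_box {τ : PointedCone ℝ (ℝ ⊗[ℤ] N)} {v : N}
    (hR : rayGenerators τ ⊆ Set.range c.w) (hv : v ∈ box τ) : c.boxVec (c.cls v) = v :=
  boxVec_cls fun l => by
    obtain ⟨a, h⟩ := hv
    exact coord_mem_Ico_of_isBoxRepr hR h l

theorem act_cls_eq_self_iff {τ : PointedCone ℝ (ℝ ⊗[ℤ] N)} {v : N}
    (hR : rayGenerators τ ⊆ Set.range c.w) (hv : v ∈ box τ)
    {z : Fin (Module.finrank ℤ N) → ℂ} :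
    c.act (c.cls v) z = z ↔ rayGenerators τ ⊆ c.zeros z := by
  rw [act_eq_self_iff_boxVec, boxVec_cls_of_mem_box hR hv]
  constructor
  · intro h ρ hρ
    obtain ⟨l, rfl⟩ := hR hρ
    by_contra hl
    exact (coord_ne_zero_iff_of_mem_box hR hv).2 hρ (h l hl)
  · intro h l hl
    by_contra h0
    exact hl (h ((coord_ne_zero_iff_of_mem_box hR hv).1 h0))

variable [Module.Finite ℤ N]

theorem rayGenerators_nonempty (hΞ : Ξ.IsSimplicial) {τ : Ξ.cones} (hτ : τ.1 ≠ ⊥) :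
    (rayGenerators τ.1).Nonempty := by
  by_contra h
  rw [Set.not_nonempty_iff_eq_empty] at h
  refine hτ ?_
  rw [(hΞ.rays_spec τ).2, h, Set.image_empty]
  exact Submodule.span_empty

theorem cls_ne_one (hΞ : Ξ.IsSimplicial) {τ : Ξ.cones} (hτ : τ.1 ≠ ⊥) {v : N}
    (hR : rayGenerators τ.1 ⊆ Set.range c.w) (hv : v ∈ box τ.1) : c.cls v ≠ 1 := by
  intro h
  obtain ⟨ρ, hρ⟩ := rayGenerators_nonempty hΞ hτ
  obtain ⟨l, rfl⟩ := hR hρ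
  refine (coord_ne_zero_iff_of_mem_box hR hv).2 hρ ?_
  rw [← boxVec_cls_of_mem_box hR hv, ← phase_eq_one_iff, h, phase_one]
  rfl

/-- The lattice vector of a group element with a fixed point lies in the box of a cone. -/
theorem exists_boxVec_mem_box (hΞ : Ξ.IsSimplicial) {g : Multiplicative (N ⧸ c.sublattice)}
    (hg : g ≠ 1) {z : Fin (Module.finrank ℤ N) → ℂ} (hz : z ∈ c.dom) (hgz : c.act g z = z) :
    ∃ τ : Ξ.cones, τ.1 ≠ ⊥ ∧ c.boxVec g ∈ box τ.1 ∧ rayGenerators τ.1 ⊆ c.zeros z := by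
  classical
  have hsub : {v | ∃ l, c.w l = v ∧ c.coord (c.boxVec g) l ≠ 0} ⊆ c.zeros z := by
    rintro _ ⟨l, rfl, hl⟩
    by_contra h
    exact hl (act_eq_self_iff_boxVec.1 hgz l h)
  obtain ⟨τ, -, hτ⟩ := c.exists_face hΞ (hsub.trans (zeros_subset hz))
  refine ⟨τ, ?_, ⟨(Finsupp.equivFunOnFinite.symm (c.coord (c.boxVec g))).embDomain
    ⟨c.w, c.w_injective⟩, ?_, ?_, ?_⟩, hτ ▸ hsub⟩
  · intro h0
    refine hg (phase_injective (funext fun l => ?_))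
    rw [phase_one]
    refine phase_eq_one_iff.2 ?_
    by_contra hl
    have h1 : c.w l ∈ rayGenerators τ.1 := by rw [hτ]; exact ⟨l, rfl, hl⟩
    have h2 := rayGenerators_subset_cone h1
    rw [h0] at h2
    exact h1.1 (latt_eq_zero.1 h2)
  · rw [hτ]
    ext v
    simp
    exact exists_congr fun l => and_comm
  · intro ρ hρ
    rw [hτ] at hρ
    obtain ⟨l, rfl, hl⟩ := hρ
    have h1 : Finsupp.embDomain ⟨c.w, c.w_injective⟩
        (Finsupp.equivFunOnFinite.symm (c.coord (c.boxVec g))) (c.w l) =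
        c.coord (c.boxVec g) l := Finsupp.embDomain_apply_self ⟨c.w, c.w_injective⟩ _ l
    rw [h1]
    have h2 := c.coord_boxVec_mem g l
    exact ⟨lt_of_le_of_ne h2.1 hl.symm, h2.2⟩
  · rw [Finsupp.sum_embDomain, Finsupp.sum_fintype _ _ (by simp)]
    exact (c.sum_coord_smul _).symm

end ChartIndex

variable [Module.Finite ℤ N]

open ChartIndex

/-- The point of the inertia space given by a lattice vector and a fixed point. -/
def TwistedPoint.ofVec (c : ChartIndex Ξ) (v : N) (h : c.cls v ≠ 1)
    (z : Fin (Module.finrank ℤ N) → ℂ) (hz : z ∈ c.dom) (hf : c.act (c.cls v) z = z) :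
    TwistedPoint (toricAtlas Ξ) := ⟨⟨c, ⟨c.cls v, h⟩⟩, ⟨z, hz, hf⟩⟩

namespace TwistedInertia

theorem continuous_proj : Continuous (proj (A := toricAtlas Ξ)) := by
  refine continuous_quot_lift _ (continuous_sigma fun i => ?_)
  exact (toricAtlas Ξ i.1).continuous_proj.comp
    (Continuous.subtype_mk continuous_subtype_val
      fun z : (toricAtlas Ξ i.1).fixedLocus i.2.1 => z.2.1)

variable (hΞ : Ξ.IsSimplicial)

theorem isOpen_boxVec_preimage (A : Set N) : IsOpen (boxVec hΞ ⁻¹' A) := by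
  have h : Topology.IsQuotientMap (mk (A := toricAtlas Ξ)) := isQuotientMap_quot_mk
  rw [← h.isOpen_preimage, isOpen_sigma_iff]
  intro i
  by_cases hi : i.1.boxVec i.2.1 ∈ A
  · convert isOpen_univ
    exact Set.eq_univ_of_forall fun _ => hi
  · convert isOpen_empty
    exact Set.eq_empty_of_forall_notMem fun _ h => hi h

theorem isClopen_boxVec_preimage (A : Set N) : IsClopen (boxVec hΞ ⁻¹' A) :=
  ⟨⟨isOpen_boxVec_preimage hΞ Aᶜ⟩, isOpen_boxVec_preimage hΞ A⟩

theorem exists_mem_box (s : TwistedInertia (toricAtlas Ξ)) :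
    ∃ τ : Ξ.cones, τ.1 ≠ ⊥ ∧ boxVec hΞ s ∈ box τ.1 := by
  obtain ⟨q, rfl⟩ := mk_surjective s
  obtain ⟨τ, h1, h2, -⟩ := exists_boxVec_mem_box (c := q.1.1) hΞ q.1.2.2 q.2.2.1 q.2.2.2
  exact ⟨τ, h1, h2⟩

variable {τ : Ξ.cones} {v : N} (hv : v ∈ box τ.1)

include hv in
theorem proj_mem_orbitClosure {s : TwistedInertia (toricAtlas Ξ)} (hs : boxVec hΞ s = v) :
    proj s ∈ orbitClosure τ := by
  obtain ⟨q, rfl⟩ := mk_surjective s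
  have hqv : q.1.1.boxVec q.1.2.1 = v := hs
  obtain ⟨τ', -, h2, h3⟩ := exists_boxVec_mem_box (c := q.1.1) hΞ q.1.2.2 q.2.2.1 q.2.2.2
  rw [hqv] at h2
  rw [mem_orbitClosure_iff hΞ]
  have h4 : q.1.1.zeros q.2.1 = ToricVariety.rays hΞ (proj (mk q)) :=
    (ToricVariety.rays_mk_monomial hΞ q.1.1 ⟨q.2.1, q.2.2.1⟩).symm
  rw [← h4]
  refine Set.Subset.trans ?_ h3
  have hle : τ.1 ≤ τ'.1 := by
    refine hΞ.le_of_latt_mem hv ?_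
    obtain ⟨a, ha1, ha2, ha3⟩ := h2
    rw [ha3]
    exact Submodule.sum_mem _ fun ρ hρ => Submodule.smul_mem _
      (⟨a ρ, (ha2 ρ (ha1 ▸ hρ)).1.le⟩ : {r : ℝ // 0 ≤ r}) (rayGenerators_subset_cone (ha1 ▸ hρ))
  rw [rayGenerators_trans (Fan.isFaceOf_of_le hle)]
  exact fun v hv => hv.1

include hv in
theorem exists_ofVec (hτ : τ.1 ≠ ⊥) (c : ChartIndex Ξ) (z : c.dom)
    (h : ToricVariety.mk c.cone (c.monomial z) ∈ orbitClosure τ) :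
    ∃ h1 h2, boxVec hΞ (mk (TwistedPoint.ofVec c v h1 z z.2 h2)) = v := by
  rw [mem_orbitClosure_iff hΞ, ToricVariety.rays_mk_monomial] at h
  have hR : rayGenerators τ.1 ⊆ Set.range c.w := h.trans (zeros_subset_range _)
  exact ⟨cls_ne_one hΞ hτ hR hv, (act_cls_eq_self_iff hR hv).2 h, boxVec_cls_of_mem_box hR hv⟩

include hv in
theorem isClosed_proj_image (hτ : τ.1 ≠ ⊥) {A : Set (TwistedInertia (toricAtlas Ξ))}
    (hA : IsClosed A) (hAv : ∀ s ∈ A, boxVec hΞ s = v) : IsClosed (proj '' A) := by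
  rw [ToricVariety.isClosed_iff]
  intro σ
  obtain ⟨c, rfl⟩ := exists_chartIndex hΞ σ
  by_cases hR : rayGenerators τ.1 ⊆ Set.range c.w
  · let i : Σ i : ChartIndex Ξ, {g : (toricAtlas Ξ i).G // g ≠ 1} :=
      ⟨c, ⟨c.cls v, cls_ne_one hΞ hτ hR hv⟩⟩
    have hsub : (toricAtlas Ξ c).fixedLocus (c.cls v) ⊆ c.dom := fun z hz => hz.1
    have hcl : IsClosed ((Subtype.val : c.dom → _) ⁻¹' (toricAtlas Ξ c).fixedLocus (c.cls v)) := by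
      have : (Subtype.val : c.dom → _) ⁻¹' (toricAtlas Ξ c).fixedLocus (c.cls v) =
          {z : c.dom | c.phase (c.cls v) * z.1 = z.1} := by
        ext z
        exact ⟨fun h => h.2, fun h => ⟨z.2, h⟩⟩
      rw [this]
      exact isClosed_eq (by fun_prop) (by fun_prop)
    have hemb := Topology.IsClosedEmbedding.inclusion hsub hcl
    have hmap : IsClosedMap (c.monomial ∘ Set.inclusion hsub) :=
      (c.isProperMap_monomial hΞ).isClosedMap.comp hemb.isClosedMap
    have hcont : Continuous fun z : (toricAtlas Ξ c).fixedLocus (c.cls v) =>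
        mk (A := toricAtlas Ξ) ⟨i, z⟩ := continuous_mk.comp continuous_sigmaMk
    convert hmap _ (hA.preimage hcont)
    ext x
    constructor
    · rintro ⟨s, hs, hsx⟩
      obtain ⟨z, rfl⟩ := c.monomial_surjective hΞ x
      have hO := proj_mem_orbitClosure hΞ hv (hAv s hs)
      rw [hsx] at hO
      obtain ⟨h1, h2, h3⟩ := exists_ofVec hΞ hv hτ c z hO
      refine ⟨⟨z, z.2, h2⟩, ?_, rfl⟩
      have : mk (TwistedPoint.ofVec c v h1 z z.2 h2) = s :=
        TwistedInertia.ext hΞ hsx.symm (h3.trans (hAv s hs).symm)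
      rw [← this] at hs
      exact hs
    · rintro ⟨z, hz, rfl⟩
      exact ⟨_, hz, rfl⟩
  · convert isClosed_empty
    refine Set.eq_empty_of_forall_notMem ?_
    rintro x ⟨s, hs, hsx⟩
    obtain ⟨z, rfl⟩ := c.monomial_surjective hΞ x
    have hO := proj_mem_orbitClosure hΞ hv (hAv s hs)
    rw [hsx, mem_orbitClosure_iff hΞ, ToricVariety.rays_mk_monomial] at hO
    exact hR (hO.trans (zeros_subset_range _))

/-- The homeomorphism of the part of the inertia space which belongs to a lattice vector with an
orbit closure. -/
noncomputable def homeoOrbitClosure (hτ : τ.1 ≠ ⊥) :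
    {s : TwistedInertia (toricAtlas Ξ) // boxVec hΞ s = v} ≃ₜ orbitClosure τ :=
  (Equiv.ofBijective (fun s => ⟨proj s.1, proj_mem_orbitClosure hΞ hv s.2⟩) (by
    constructor
    · intro s t h
      exact Subtype.ext (TwistedInertia.ext hΞ (congrArg Subtype.val h) (s.2.trans t.2.symm))
    · rintro ⟨p, hp⟩
      obtain ⟨c, z, rfl⟩ := ToricVariety.exists_chart_point hΞ p
      obtain ⟨h1, h2, h3⟩ := exists_ofVec hΞ hv hτ c z hp
      exact ⟨⟨_, h3⟩, rfl⟩)).toHomeomorphOfContinuousClosed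
  (Continuous.subtype_mk (continuous_proj.comp continuous_subtype_val) _) (by
    intro A hA
    refine ⟨?_⟩
    have h1 : IsClosed (Subtype.val '' A) :=
      (isClopen_boxVec_preimage hΞ {v}).isClosed.isClosedEmbedding_subtypeVal.isClosedMap A hA
    have h2 := isClosed_proj_image hΞ hv hτ h1 (by rintro _ ⟨s, -, rfl⟩; exact s.2)
    convert (h2.preimage continuous_subtype_val).isOpen_compl
    ext p
    constructor
    · rintro ⟨s, hs, rfl⟩
      exact ⟨s.1, ⟨s, hs, rfl⟩, rfl⟩
    · rintro ⟨_, ⟨s, hs, rfl⟩, h⟩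
      exact ⟨s, hs, Subtype.ext h⟩)

include hv in
theorem carrier_mk_eq (hτ : τ.1 ≠ ⊥) {s : TwistedInertia (toricAtlas Ξ)} (hs : boxVec hΞ s = v) :
    (TwistedSector.carrier (s : TwistedSector (toricAtlas Ξ))) = {t | boxVec hΞ t = v} := by
  have hc : TwistedSector.carrier (s : TwistedSector (toricAtlas Ξ)) = connectedComponent s := by
    ext t
    exact ConnectedComponents.coe_eq_coe'
  rw [hc]
  refine Set.Subset.antisymm ?_ ?_
  · have := (isClopen_boxVec_preimage hΞ {v}).connectedComponent_subset (x := s) hs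
    exact this
  · refine IsPreconnected.subset_connectedComponent ?_ hs
    have := isPreconnected_iff_preconnectedSpace.1 (isConnected_orbitClosure hΞ τ).isPreconnected
    have h2 := (isPreconnected_univ (α := orbitClosure τ)).image
      (fun p => ((homeoOrbitClosure hΞ hv hτ).symm p).1)
      (continuous_subtype_val.comp (Homeomorph.continuous _)).continuousOn
    convert h2
    ext t
    constructor
    · intro ht
      exact ⟨homeoOrbitClosure hΞ hv hτ ⟨t, ht⟩, trivial, by simp⟩
    · rintro ⟨p, -, rfl⟩
      exact ((homeoOrbitClosure hΞ hv hτ).symm p).2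

end TwistedInertia

end ToricOrbifold

namespace ToricOrbifold

section Age

theorem fract_arg_exp {a : ℝ} (ha : a ∈ Set.Ico (0 : ℝ) 1) :
    Int.fract (Complex.arg (Complex.exp (2 * Real.pi * a * Complex.I)) / (2 * Real.pi)) = a := by
  have hpi := Real.pi_pos
  have key : ∀ b : ℝ, -(1 / 2) < b → b ≤ 1 / 2 →
      Complex.arg (Complex.exp (2 * Real.pi * b * Complex.I)) / (2 * Real.pi) = b := by
    intro b h1 h2
    have him : (2 * Real.pi * b * Complex.I : ℂ).im = 2 * Real.pi * b := by simp
    rw [← Complex.log_im, Complex.log_exp (by rw [him]; nlinarith) (by rw [him]; nlinarith), him]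
    field_simp
  rcases le_or_gt a (1 / 2) with h | h
  · rw [key a (by linarith [ha.1]) h, Int.fract_eq_self.2 ⟨ha.1, ha.2⟩]
  · have h1 : Complex.exp (2 * Real.pi * a * Complex.I) =
        Complex.exp (2 * Real.pi * (a - 1 : ℝ) * Complex.I) := by
      rw [Complex.exp_eq_exp_iff_exists_int]
      exact ⟨1, by push_cast; ring⟩
    rw [h1, key (a - 1) (by linarith) (by linarith [ha.2]), Int.fract_sub_one,
      Int.fract_eq_self.2 ⟨ha.1, ha.2⟩]

theorem age_diagonal {n : ℕ} (p : Fin n → ℂ) :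
    age (fderiv ℂ (fun z : Fin n → ℂ => p * z) 0).toLinearMap =
      ∑ l, Int.fract (Complex.arg (p l) / (2 * Real.pi)) := by
  have h1 : HasFDerivAt (fun z : Fin n → ℂ => p * z)
      (LinearMap.toContinuousLinearMap (Matrix.toLin' (Matrix.diagonal p))) 0 := by
    have h2 : (fun z : Fin n → ℂ => p * z) =
        LinearMap.toContinuousLinearMap (Matrix.toLin' (Matrix.diagonal p)) := by
      ext z l
      simp [Matrix.mulVec_diagonal]
    rw [h2]
    exact ContinuousLinearMap.hasFDerivAt _
  rw [h1.fderiv, age]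
  have h3 : (LinearMap.toContinuousLinearMap (Matrix.toLin' (Matrix.diagonal p))).toLinearMap =
      Matrix.toLin' (Matrix.diagonal p) := rfl
  rw [h3, ← LinearMap.charpoly_toMatrix _ (Pi.basisFun ℂ (Fin n)), LinearMap.toMatrix_eq_toMatrix',
    LinearMap.toMatrix'_toLin', Matrix.charpoly_diagonal, Polynomial.roots_prod _ _ (by
      simp [Finset.prod_ne_zero_iff, Polynomial.X_sub_C_ne_zero])]
  simp [List.sum_ofFn]

end Age

variable {N : Type u} [AddCommGroup N] {Ξ : Fan N}

theorem ChartIndex.sum_coord_eq {c : ChartIndex Ξ} {τ : PointedCone ℝ (ℝ ⊗[ℤ] N)} {v : N}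
    {a : N →₀ ℝ} (hR : rayGenerators τ ⊆ Set.range c.w) (h : IsBoxRepr τ v a) :
    ∑ l, c.coord v l = a.sum fun _ t => t := by
  classical
  have hs : a.support ⊆ Finset.univ.image c.w := by
    intro ρ hρ
    have : ρ ∈ (a.support : Set N) := hρ
    rw [h.1] at this
    obtain ⟨l, rfl⟩ := hR this
    exact Finset.mem_image_of_mem _ (Finset.mem_univ _)
  rw [Finsupp.sum_of_support_subset _ hs _ (by simp),
    Finset.sum_image fun _ _ _ _ h => c.w_injective h]
  exact Finset.sum_congr rfl fun l _ => c.coord_eq_of_isBoxRepr hR h l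

variable [Module.Free ℤ N] [Module.Finite ℤ N]

theorem TwistedPoint.age_eq_sum (q : TwistedPoint (toricAtlas Ξ)) :
    q.age = ∑ l, q.1.1.coord (q.boxVec) l := by
  have h1 : fderiv ℂ (q.chart.act q.elt) q.pt =
      fderiv ℂ (fun z : Fin (Module.finrank ℤ N) → ℂ => q.1.1.phase q.1.2.1 * z) 0 := by
    let L := LinearMap.toContinuousLinearMap (LinearMap.mulLeft ℂ (q.1.1.phase q.1.2.1))
    have h2 : ∀ z, HasFDerivAt (fun z : Fin (Module.finrank ℤ N) → ℂ =>
        q.1.1.phase q.1.2.1 * z) L z := fun z => L.hasFDerivAt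
    exact (h2 q.pt).fderiv.trans (h2 0).fderiv.symm
  rw [age, h1, age_diagonal]
  refine Finset.sum_congr rfl fun l _ => ?_
  exact (congrArg (fun z => Int.fract (Complex.arg z / (2 * Real.pi)))
    (ChartIndex.phase_eq_exp (c := q.1.1) q.1.2.1 l)).trans
      (fract_arg_exp (q.1.1.coord_boxVec_mem _ l))

theorem TwistedInertia.degreeShift_eq (hΞ : Ξ.IsSimplicial) {τ : Ξ.cones} {v : N} {a : N →₀ ℝ}
    (h : IsBoxRepr τ.1 v a) {s : TwistedInertia (toricAtlas Ξ)} (hs : boxVec hΞ s = v) :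
    degreeShift s = a.sum fun _ t => t := by
  have hO := proj_mem_orbitClosure hΞ ⟨a, h⟩ hs
  obtain ⟨q, rfl⟩ := mk_surjective s
  rw [mem_orbitClosure_iff hΞ] at hO
  have hR : rayGenerators τ.1 ⊆ Set.range q.1.1.w := hO.trans
    ((ToricVariety.rays_mk_monomial hΞ q.1.1 ⟨q.2.1, q.2.2.1⟩).le.trans
      (ChartIndex.zeros_subset_range _))
  rw [← ChartIndex.sum_coord_eq hR h]
  have hv : q.boxVec = v := hs
  rw [← hv]
  exact q.age_eq_sum

end ToricOrbifold

namespace ToricOrbifold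

variable {N : Type u} [AddCommGroup N] {Ξ : Fan N}

theorem ChartIndex.differentiableAt_val {c : ChartIndex Ξ} {m : Module.Dual ℤ N}
    (hm : m ∈ dualMonoid c.cone.1) {z : Fin (Module.finrank ℤ N) → ℂ} (hz : z ∈ c.dom) :
    DifferentiableAt ℂ (fun t => c.val t m) z :=
  differentiableAt_prod Finset.univ fun l =>
    DifferentiableAt.comp (g := fun y : ℂ => y ^ (m (c.w l))) z
      (differentiableAt_zpow.2 (c.ne_zero_or_nonneg hz ⟨m, hm⟩ l)) (differentiableAt_apply l z)

variable [Module.Free ℤ N] [Module.Finite ℤ N]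

open ChartIndex TwistedInertia

theorem TwistedPoint.eventually_nhds_iff {q : TwistedPoint (toricAtlas Ξ)}
    {P : TwistedPoint (toricAtlas Ξ) → Prop} :
    (∀ᶠ r in 𝓝 q, P r) ↔ ∀ᶠ y in 𝓝 (q.pt : Fin (Module.finrank ℤ N) → ℂ),
      ∀ h : y ∈ (toricAtlas Ξ q.1.1).fixedLocus q.1.2.1, P ⟨q.1, ⟨y, h⟩⟩ := by
  obtain ⟨i, y⟩ := q
  have h1 : 𝓝 (⟨i, y⟩ : TwistedPoint (toricAtlas Ξ)) = Filter.map (Sigma.mk i) (𝓝 y) :=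
    Sigma.nhds_mk (σ := fun a : (Σ i : ChartIndex Ξ, {g : (toricAtlas Ξ i).G // g ≠ 1}) =>
      (toricAtlas Ξ a.1).fixedLocus a.2.1) i y
  rw [h1, Filter.eventually_map, nhds_subtype_eq_comap, Filter.eventually_comap]
  refine Filter.eventually_congr (Filter.Eventually.of_forall fun z => ?_)
  exact ⟨fun h hz => h ⟨z, hz⟩ rfl, fun h a ha => by subst ha; exact h a.2⟩

variable (hΞ : Ξ.IsSimplicial) {τ : Ξ.cones} (hτ : τ.1 ≠ ⊥) {v : N} (hv : v ∈ box τ.1)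
  {Z : TwistedSector (toricAtlas Ξ)} (hZ : ∀ s, s ∈ Z.carrier ↔ boxVec hΞ s = v)
  (e : Z.carrier ≃ₜ orbitClosure τ) (he : ∀ s, (e s : ToricVariety Ξ) = proj s.1)
  {f : orbitClosure τ → ℂ} {s : Z.carrier}

include hv hZ he

include hτ in
theorem holomorphicAt_comp_of_holomorphicAt
    (h : ToricVariety.HolomorphicAt (orbitClosure τ) f (e s)) : Z.HolomorphicAt (f ∘ e) s := by
  obtain ⟨σ, x, hx, k, m, F, hF, hf⟩ := h
  obtain ⟨c, rfl⟩ := exists_chartIndex hΞ σ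
  obtain ⟨z, rfl⟩ := c.monomial_surjective hΞ x
  obtain ⟨h1, h2, h3⟩ := exists_ofVec hΞ hv hτ c z (hx ▸ (e s).2)
  have hdiff : ∀ t ∈ c.dom, DifferentiableAt ℂ (fun t j => c.val t (m j).1) t := fun t ht =>
    differentiableAt_pi.2 fun j => differentiableAt_val (m j).2 ht
  refine ⟨TwistedPoint.ofVec c v h1 z z.2 h2, ?_, fun t => F fun j => c.val t (m j).1, ?_, ?_⟩
  · exact TwistedInertia.ext hΞ (hx.trans (he s)) (h3.trans ((hZ s).1 s.2).symm)
  · have ht := (hdiff z.1 z.2).continuousAt.tendsto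
    filter_upwards [ht.eventually hF, c.isOpen_dom.mem_nhds z.2] with t ht1 ht2
    exact DifferentiableAt.comp (g := F) t ht1 (hdiff t ht2)
  · rw [TwistedPoint.eventually_nhds_iff]
    have h4 := (c.continuous_monomial.tendsto z).eventually hf
    rw [show 𝓝 z = Filter.comap Subtype.val (𝓝 z.1) from nhds_subtype_eq_comap,
      Filter.eventually_comap] at h4
    filter_upwards [h4] with t ht hfix hmem
    have hO : ToricVariety.mk c.cone (c.monomial ⟨t, hfix.1⟩) ∈ orbitClosure τ := by
      have h6 := (e ⟨_, hmem⟩).2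
      rw [he] at h6
      exact h6
    have h5 : e ⟨_, hmem⟩ = ⟨ToricVariety.mk c.cone (c.monomial ⟨t, hfix.1⟩), hO⟩ :=
      Subtype.ext (he _)
    rw [Function.comp_apply, h5, ht ⟨t, hfix.1⟩ rfl]
    rfl

theorem holomorphicAt_of_holomorphicAt_comp
    (h : Z.HolomorphicAt (f ∘ e) s) : ToricVariety.HolomorphicAt (orbitClosure τ) f (e s) := by
  classical
  obtain ⟨⟨⟨c, ⟨g, hg⟩⟩, ⟨x, hx, hgx⟩⟩, hq, F, hF, hf⟩ := h
  change ∀ᶠ t in 𝓝 x, DifferentiableAt ℂ F t at hF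
  rw [TwistedPoint.eventually_nhds_iff] at hf
  let i : Σ i : ChartIndex Ξ, {g : (toricAtlas Ξ i).G // g ≠ 1} := ⟨c, ⟨g, hg⟩⟩
  have hbox : c.boxVec g = v := (congrArg (boxVec hΞ) hq).trans ((hZ s).1 s.2)
  have hcls : c.cls v = g := by rw [← hbox]; exact c.cls_boxVec g
  have hproj : (e s : ToricVariety Ξ) = ToricVariety.mk c.cone (c.monomial ⟨x, hx⟩) :=
    (he s).trans (congrArg proj hq).symm
  have hrx : rayGenerators τ.1 ⊆ c.zeros x := by
    have := (e s).2
    rwa [hproj, mem_orbitClosure_iff hΞ, ToricVariety.rays_mk_monomial] at this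
  have hR : rayGenerators τ.1 ⊆ Set.range c.w := hrx.trans (zeros_subset_range _)
  have hfix : ∀ y, c.act g y = y ↔ rayGenerators τ.1 ⊆ c.zeros y := by
    intro y
    rw [← hcls]
    exact act_cls_eq_self_iff hR hv
  have hmem : ∀ y hy, mk (A := toricAtlas Ξ) ⟨i, ⟨y, hy⟩⟩ ∈ Z.carrier := fun y hy =>
    (hZ _).2 hbox
  let P : (Fin (Module.finrank ℤ N) → ℂ) → Fin (Module.finrank ℤ N) → ℂ :=
    fun y l => if c.w l ∈ rayGenerators τ.1 then 0 else y l
  have hPd : Differentiable ℂ P := by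
    refine differentiable_pi.2 fun l => ?_
    simp only [P]
    split_ifs <;> fun_prop
  have hPfix : ∀ y, rayGenerators τ.1 ⊆ c.zeros y → P y = y := by
    intro y hy
    ext l
    simp only [P]
    split_ifs with hl
    · exact (w_mem_zeros.1 (hy hl)).symm
    · rfl
  have hPx : P x = x := hPfix x hrx
  have hPt : Filter.Tendsto P (𝓝 x) (𝓝 x) := by
    have := hPd.continuous.tendsto x
    rwa [hPx] at this
  have hPzero : ∀ y, rayGenerators τ.1 ⊆ c.zeros (P y) := by
    intro y ρ hρ
    obtain ⟨l, rfl⟩ := hR hρ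
    exact w_mem_zeros.2 (if_pos hρ)
  have hdom : ∀ᶠ y in 𝓝 x, y ∈ c.dom := c.isOpen_dom.mem_nhds hx
  obtain ⟨k, m, Φ, hm, hΦ, hFΦ⟩ := exists_eventually_eq_comp_val (c := c) (x := ⟨x, hx⟩)
    (F := F ∘ P) (by
      filter_upwards [hPt.eventually hF] with y hy
      exact DifferentiableAt.comp y hy (hPd y)) (by
    intro g' hg'
    have hat : Filter.Tendsto (c.act g') (𝓝 x) (𝓝 x) := by
      have h1 : Continuous (c.act g') := by
        change Continuous fun y => c.phase g' * y
        fun_prop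
      have h2 := h1.tendsto x
      have h3 : c.act g' x = x := hg'
      rwa [h3] at h2
    filter_upwards [hPt.eventually hf, hPt.eventually hdom, (hat.comp hPt).eventually hf]
      with y hy1 hy2 hy3
    have hcomm : P (c.act g' y) = c.act g' (P y) := by
      ext l
      change (if c.w l ∈ rayGenerators τ.1 then 0 else c.phase g' l * y l) =
        c.phase g' l * (if c.w l ∈ rayGenerators τ.1 then 0 else y l)
      rw [mul_ite, mul_zero]
    have hfy : c.act g (P y) = P y := (hfix _).2 (hPzero y)
    have hfy' : c.act g (c.act g' (P y)) = c.act g' (P y) := by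
      rw [← hcomm]; exact (hfix _).2 (hPzero _)
    have hd' : c.act g' (P y) ∈ c.dom := c.act_mem g' hy2
    have e1 := hy1 ⟨hy2, hfy⟩ (hmem _ _)
    have e2 := hy3 ⟨hd', hfy'⟩ (hmem _ _)
    have heq : mk (A := toricAtlas Ξ) ⟨i, ⟨c.act g' (P y), hd', hfy'⟩⟩ =
        mk (A := toricAtlas Ξ) ⟨i, ⟨P y, hy2, hfy⟩⟩ :=
      TwistedInertia.ext hΞ (congrArg (ToricVariety.mk c.cone) (c.monomial_act g' ⟨P y, hy2⟩)) rfl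
    change F (P (c.act g' y)) = F (P y)
    rw [hcomm]
    refine e2.symm.trans (Eq.trans ?_ e1)
    exact congrArg (f ∘ e) (Subtype.ext heq))
  obtain ⟨τ₀, hτ₀, hR₀⟩ := c.exists_face hΞ (zeros_subset hx)
  let d := c.restrict τ₀ hτ₀
  have hxd : x ∈ d.dom := mem_dom_iff.2 (by change c.zeros x ⊆ rayGenerators τ₀.1; rw [hR₀])
  have hmd : ∀ j, m j ∈ dualMonoid τ₀.1 := fun j => (d.mem_dualMonoid_iff hΞ).2 fun l hl =>
    hm j l (by
      have : c.w l ∈ rayGenerators τ₀.1 := hl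
      rw [hR₀] at this
      exact w_mem_zeros.1 this)
  refine ⟨τ₀, d.monomial ⟨x, hxd⟩, (mk_monomial_restrict τ₀ hτ₀ hx hxd).trans hproj.symm, k,
    fun j => ⟨m j, hmd j⟩, Φ, hΦ, ?_⟩
  have hall : ∀ᶠ y in 𝓝 x, y ∈ d.dom ∧ F (P y) = Φ (fun j => c.val y (m j)) ∧
      ∀ h : y ∈ (toricAtlas Ξ c).fixedLocus g, ∀ h' : mk (A := toricAtlas Ξ) ⟨i, ⟨y, h⟩⟩ ∈ Z.carrier,
        (f ∘ e) ⟨mk ⟨i, ⟨y, h⟩⟩, h'⟩ = F y := by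
    filter_upwards [d.isOpen_dom.mem_nhds hxd, hFΦ, hf] with y h1 h2 h3 using ⟨h1, h2, h3⟩
  obtain ⟨O, hO, hOo, hxO⟩ := eventually_nhds_iff.1 hall
  let W : Set (TwistedInertia (toricAtlas Ξ)) := mk '' (Sigma.mk i '' (Subtype.val ⁻¹' O))
  have hWo : IsOpen W := by
    refine isOpenMap_mk hΞ _ ?_
    have hi := @isOpenMap_sigmaMk _
      (fun a : (Σ i : ChartIndex Ξ, {g : (toricAtlas Ξ i).G // g ≠ 1}) =>
        (toricAtlas Ξ a.1).fixedLocus a.2.1) _ i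
    exact hi _ (hOo.preimage continuous_subtype_val)
  have hsW : s.1 ∈ W := ⟨_, ⟨⟨x, hx, hgx⟩, hxO, rfl⟩, hq⟩
  have hev1 : ∀ᶠ p in 𝓝 (e s), (e.symm p).1 ∈ W := by
    have h1 := (continuous_subtype_val.comp e.symm.continuous).tendsto (e s)
    refine h1.eventually_mem (hWo.mem_nhds ?_)
    simpa using hsW
  rw [show 𝓝 (e s) = Filter.comap Subtype.val (𝓝 (e s).1) from nhds_subtype_eq_comap,
    Filter.eventually_comap, hproj, ← mk_monomial_restrict τ₀ hτ₀ hx hxd] at hev1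
  filter_upwards [((ToricVariety.continuous_mk τ₀).tendsto _).eventually hev1] with x' hx' hx'O
  obtain ⟨_, ⟨⟨y, hy⟩, hyO, rfl⟩, hyx⟩ := hx' ⟨_, hx'O⟩ rfl
  obtain ⟨hyd, hyΦ, hyf⟩ := hO y hyO
  have hey : e ⟨mk ⟨i, ⟨y, hy⟩⟩, hmem y hy⟩ = ⟨ToricVariety.mk τ₀ x', hx'O⟩ := by
    rw [← e.apply_symm_apply ⟨ToricVariety.mk τ₀ x', hx'O⟩]
    exact congrArg e (Subtype.ext hyx)
  have hxy : x' = d.monomial ⟨y, hyd⟩ := by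
    refine ToricVariety.mk_injective hΞ τ₀ ?_
    rw [mk_monomial_restrict τ₀ hτ₀ hy.1 hyd]
    exact (congrArg Subtype.val hey).symm.trans (he _)
  rw [← hey]
  refine (hyf hy (hmem y hy)).trans ?_
  rw [hPfix y ((hfix y).1 hy.2)] at hyΦ
  rw [hyΦ, hxy]
  rfl

end ToricOrbifold

namespace ToricOrbifold

variable {N : Type u} [AddCommGroup N] [Module.Free ℤ N] [Module.Finite ℤ N] {Ξ : Fan N}

open TwistedInertia

theorem isOfType_mk (hΞ : Ξ.IsSimplicial) {τ : Ξ.cones} (hτ : τ.1 ≠ ⊥) {v : N}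
    (hv : v ∈ box τ.1) {s : TwistedInertia (toricAtlas Ξ)} (hs : boxVec hΞ s = v) :
    IsOfType (s : TwistedSector (toricAtlas Ξ)) τ := by
  have hc := carrier_mk_eq hΞ hv hτ hs
  let e := (Homeomorph.setCongr hc).trans (homeoOrbitClosure hΞ hv hτ)
  have he : ∀ t, (e t : ToricVariety Ξ) = proj t.1 := fun t => rfl
  have hZ : ∀ t, t ∈ TwistedSector.carrier (s : TwistedSector (toricAtlas Ξ)) ↔
      boxVec hΞ t = v := fun t => Set.ext_iff.1 hc t
  exact ⟨e, he, fun f t => ⟨holomorphicAt_comp_of_holomorphicAt hΞ hτ hv hZ e he,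
    holomorphicAt_of_holomorphicAt_comp hΞ hv hZ e he⟩⟩

theorem IsOfType.proj_image_carrier {Z : TwistedSector (toricAtlas Ξ)} {τ : Ξ.cones}
    (h : IsOfType Z τ) : proj '' Z.carrier = orbitClosure τ := by
  obtain ⟨e, he, -⟩ := h
  ext p
  constructor
  · rintro ⟨s, hs, rfl⟩
    rw [← he ⟨s, hs⟩]
    exact (e ⟨s, hs⟩).2
  · intro hp
    exact ⟨_, (e.symm ⟨p, hp⟩).2, by rw [← he, e.apply_symm_apply]⟩

theorem exists_boxVec_eq (hΞ : Ξ.IsSimplicial) {τ : Ξ.cones} (hτ : τ.1 ≠ ⊥) {v : N}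
    (hv : v ∈ box τ.1) : ∃ s, boxVec hΞ s = v := by
  obtain ⟨p, hp⟩ := (isConnected_orbitClosure hΞ τ).nonempty
  exact ⟨_, ((homeoOrbitClosure hΞ hv hτ).symm ⟨p, hp⟩).2⟩

/-- The bijection between the box of a cone and the twisted sectors of its type. -/
theorem exists_equiv_sectors (hΞ : Ξ.IsSimplicial) {τ : Ξ.cones} (hτ : τ.1 ≠ ⊥) :
    ∃ e : box τ.1 ≃ {Z : TwistedSector (toricAtlas Ξ) // IsOfType Z τ},
      ∀ v s, s ∈ (e v).1.carrier ↔ boxVec hΞ s = v.1 := by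
  choose s hs using fun v : box τ.1 => exists_boxVec_eq hΞ hτ v.2
  let F : box τ.1 → {Z : TwistedSector (toricAtlas Ξ) // IsOfType Z τ} :=
    fun v => ⟨(s v : TwistedSector (toricAtlas Ξ)), isOfType_mk hΞ hτ v.2 (hs v)⟩
  have hF : ∀ v t, t ∈ (F v).1.carrier ↔ boxVec hΞ t = v.1 := fun v t =>
    Set.ext_iff.1 (carrier_mk_eq hΞ v.2 hτ (hs v)) t
  refine ⟨Equiv.ofBijective F ⟨fun v v' h => ?_, fun Z => ?_⟩, hF⟩
  · have h1 : s v ∈ (F v').1.carrier := congrArg Subtype.val h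
    exact Subtype.ext ((hs v).symm.trans ((hF v' _).1 h1))
  · obtain ⟨Z, hZ⟩ := Z
    obtain ⟨t, rfl⟩ := ConnectedComponents.surjective_coe Z
    obtain ⟨τ', hτ', hv'⟩ := exists_mem_box hΞ t
    have h1 := (isOfType_mk hΞ hτ' hv' rfl).proj_image_carrier
    rw [hZ.proj_image_carrier] at h1
    obtain rfl := orbitClosure_injective hΞ h1
    refine ⟨⟨_, hv'⟩, Subtype.ext ?_⟩
    have h2 : t ∈ (F ⟨_, hv'⟩).1.carrier := (hF _ _).2 rfl
    exact h2.symm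

end ToricOrbifold

theorem theorem1 {N : Type*} [AddCommGroup N] [Module.Free ℤ N] [Module.Finite ℤ N]
    (Ξ : Fan N) (hΞ : Ξ.IsSimplicial) :
    (∀ Z : TwistedSector (toricAtlas Ξ), ∃ τ : Ξ.cones, τ.1 ≠ ⊥ ∧ IsOfType Z τ) ∧
    ∀ τ : Ξ.cones, τ.1 ≠ ⊥ →
      ∃ e : box τ.1 ≃ {Z : TwistedSector (toricAtlas Ξ) // IsOfType Z τ},
        (∀ (v : box τ.1) (q : TwistedPoint (toricAtlas Ξ)),
          τ.1 ≤ q.1.1.cone.1 → q.elt = q.1.1.elt v.1 →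
            TwistedInertia.mk q ∈ (e v).1.carrier) ∧
        ∀ (v : box τ.1) (a : N →₀ ℝ), IsBoxRepr τ.1 v.1 a →
          ∀ s ∈ (e v).1.carrier, TwistedInertia.degreeShift s = a.sum fun _ t => t := by
  refine ⟨fun Z => ?_, fun τ hτ => ?_⟩
  · obtain ⟨s, rfl⟩ := ConnectedComponents.surjective_coe Z
    obtain ⟨τ, hτ, hv⟩ := TwistedInertia.exists_mem_box hΞ s
    exact ⟨τ, hτ, isOfType_mk hΞ hτ hv rfl⟩
  · obtain ⟨e, he⟩ := exists_equiv_sectors hΞ hτ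
    refine ⟨e, fun v q hq hqv => (he v _).2 ?_, fun v a ha s hs =>
      TwistedInertia.degreeShift_eq hΞ ha ((he v s).1 hs)⟩
    exact (congrArg q.1.1.boxVec hqv).trans
      (ChartIndex.boxVec_cls_of_mem_box (ChartIndex.rays_subset_range hq) v.2)
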